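/- Let $\mathcal V$ be a symmetric monoidal closed category that is locally small, complete and cocomplete. "Category" and "functor" mean $\mathcal V$-category and $\mathcal V$-functor; a category is *small* if its isomorphism classes of objects form a small set. For a small category $\mathcal K$, $[\mathcal K,\mathcal A]$ is the functor category with hom-objects the ends $[\mathcal K,\mathcal A](F,G)=\int_{k}\mathcal A(Fk,Gk)$. A *weight* is a functor $\varphi:\mathcal K^{op}\to\mathcal V$ with $\mathcal K$ small. For $T:\mathcal K^{op}\to\mathcal A$, the *limit* $\{\varphi,T\}\in\mathcal A$ is an object with a counit $\varphi\to\mathcal A(\{\varphi,T\},T-)$ inducing an isomorphism $\mathcal A(a,\{\varphi,T\})\cong[\mathcal K^{op},\mathcal V](\varphi,\mathcal A(a,T-))$ for every $a$; for $S:\mathcal K\to\mathcal A$, the *colimit* $\varphi*S\in\mathcal A$ is an object with a unit $\varphi\to\mathcal A(S-,\varphi*S)$ inducing $\mathcal A(\varphi*S,a)\cong[\mathcal K^{op},\mathcal V](\varphi,\mathcal A(S-,a))$ for every $a$. A functor preserves such a limit (colimit) if it sends the counit (unit) to a counit (unit) of the same kind; it is *continuous* (*cocontinuous*) if it preserves all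 limits (colimits), with any weight, that exist in its domain. Since $\mathcal V$ is cocomplete, $\varphi*S$ exists for all $S:\mathcal K\to\mathcal V$, and gives a functor $\varphi*-:[\mathcal K,\mathcal V]\to\mathcal V$. A functor $\mathcal A\to\mathcal V$ is *representable* if it is $\mathcal V$-naturally isomorphic to some $\mathcal A(a,-)$. A weight $\varphi:\mathcal K^{op}\to\mathcal V$ is a *small projective* if $\{\varphi,-\}=[\mathcal K^{op},\mathcal V](\varphi,-):[\mathcal K^{op},\mathcal V]\to\mathcal V$ is cocontinuous. For weights $\varphi:\mathcal L^{op}\to\mathcal V$ and $\psi:\mathcal K^{op}\to\mathcal V$, say that *$\varphi$-colimits commute with $\psi$-limits in $\mathcal V$* if $\varphi*-:[\mathcal L,\mathcal V]\to\mathcal V$ preserves the limit $\{\psi,T\}$ of every $T:\mathcal K^{op}\to[\mathcal L,\mathcal V]$. Let $\mathcal P$ be the class of all weights, $\mathcal P^+$ (the *$\mathcal P$-flat* weights) the class of the weights $\varphi$ such that $\varphi$-colimits commute with $\psi$-limits in $\mathcal V$ for all weights $\psi$, $\mathcal P^-$ the class of the weights $\psi$ such that $\varphi$-colimits commute with $\psi$-limits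 in $\mathcal V$ for all weights $\varphi$, and $\mathcal Q$ the class of the small projective weights. **Proposition.** Let $\mathcal B$ be a small category, let $\varphi:\mathcal B^{op}\to\mathcal V$ be a weight, and let $Y':\mathcal B^{op}\to[\mathcal B,\mathcal V]$, $b\mapsto\mathcal B(b,-)$, be the Yoneda embedding. The limit $\{\varphi,Y'\}$ exists in $[\mathcal B,\mathcal V]$, and the following are equivalent: (i) $\varphi$ is a small projective; (ii) $\varphi*-:[\mathcal B,\mathcal V]\to\mathcal V$ is representable; (iii) $\varphi*-:[\mathcal B,\mathcal V]\to\mathcal V$ is continuous; (iv) $\varphi*-:[\mathcal B,\mathcal V]\to\mathcal V$ preserves the limit $\{\varphi,Y'\}$ of $Y'$ weighted by $\varphi$. In particular $\mathcal Q=\mathcal P^-=\mathcal P^+$: the small projective weights are the $\mathcal P$-flat weights. -/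

import Mathlib

open CategoryTheory MonoidalCategory BraidedCategory Limits Opposite
open scoped MonoidalClosed

universe w v u

namespace EnrichedWeights

noncomputable section

notation "𝓗[" V "]" => @EnrichedCategory.Hom V _ _ _ _

/-! ### Generalised elements of hom-objects and their composition -/

section Elements

variable {V : Type u} [Category.{v} V] [MonoidalCategory V]
variable {C : Type*} [EnrichedCategory V C] {D : Type*} [EnrichedCategory V D]

/-- Composition, in diagrammatic order, of generalised elements `X ⟶ C(a, b)` and
`Y ⟶ C(b, c)` of hom-objects. -/
def star {a b c : C} {X Y : V} (f : X ⟶ 𝓗[V] a b) (g : Y ⟶ 𝓗[V] b c) : X ⊗ Y ⟶ 𝓗[V] a c :=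
  (f ⊗ₘ g) ≫ eComp V a b c

theorem comp_star_comp {a b c : C} {X Y X' Y' : V} (p : X' ⟶ X) (q : Y' ⟶ Y)
    (f : X ⟶ 𝓗[V] a b) (g : Y ⟶ 𝓗[V] b c) :
    star (p ≫ f) (q ≫ g) = (p ⊗ₘ q) ≫ star f g := by
  simp [star]

theorem comp_star {a b c : C} {X Y X' : V} (p : X' ⟶ X)
    (f : X ⟶ 𝓗[V] a b) (g : Y ⟶ 𝓗[V] b c) :
    star (p ≫ f) g = p ▷ Y ≫ star f g := by
  simpa using comp_star_comp p (𝟙 _) f g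

theorem star_comp {a b c : C} {X Y Y' : V} (q : Y' ⟶ Y)
    (f : X ⟶ 𝓗[V] a b) (g : Y ⟶ 𝓗[V] b c) :
    star f (q ≫ g) = X ◁ q ≫ star f g := by
  simpa using comp_star_comp (𝟙 _) q f g

theorem star_star {a b c d : C} {X Y Z : V} (f : X ⟶ 𝓗[V] a b) (g : Y ⟶ 𝓗[V] b c)
    (h : Z ⟶ 𝓗[V] c d) :
    star f (star g h) = (α_ X Y Z).inv ≫ star (star f g) h := by
  have h1 : star f (star g h) = (f ⊗ₘ (g ⊗ₘ h)) ≫ _ ◁ eComp V b c d ≫ eComp V a b d := by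
    simp only [star]
    rw [← Category.comp_id f, ← tensorHom_comp_tensorHom]
    simp
  have h2 : star (star f g) h = ((f ⊗ₘ g) ⊗ₘ h) ≫ eComp V a b c ▷ _ ≫ eComp V a c d := by
    simp only [star]
    rw [← Category.comp_id h, ← tensorHom_comp_tensorHom]
    simp
  rw [h1, h2, ← e_assoc V a b c d]
  simp

theorem star_star' {a b c d : C} {X Y Z : V} (f : X ⟶ 𝓗[V] a b) (g : Y ⟶ 𝓗[V] b c)
    (h : Z ⟶ 𝓗[V] c d) :
    star (star f g) h = (α_ X Y Z).hom ≫ star f (star g h) := by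
  rw [star_star, Iso.hom_inv_id_assoc]

theorem star_map (F : EnrichedFunctor V C D) {a b c : C} {X Y : V} (f : X ⟶ 𝓗[V] a b)
    (g : Y ⟶ 𝓗[V] b c) :
    star f g ≫ F.map a c = star (f ≫ F.map a b) (g ≫ F.map b c) := by
  simp [star]

/-- Precomposition of a generalised element with a morphism of the underlying category. -/
def pre {a b c : C} {X : V} (e : 𝟙_ V ⟶ 𝓗[V] a b) (f : X ⟶ 𝓗[V] b c) : X ⟶ 𝓗[V] a c :=
  (λ_ X).inv ≫ star e f

/-- Postcomposition of a generalised element with a morphism of the underlying category. -/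
def post {a b c : C} {X : V} (f : X ⟶ 𝓗[V] a b) (e : 𝟙_ V ⟶ 𝓗[V] b c) : X ⟶ 𝓗[V] a c :=
  (ρ_ X).inv ≫ star f e

@[simp] theorem pre_id {a b : C} {X : V} (f : X ⟶ 𝓗[V] a b) : pre (eId V a) f = f := by
  have := e_id_comp V a b
  have h : f = f ≫ 𝟙 _ := by simp
  conv_rhs => rw [h, ← this]
  simp [pre, star, tensorHom_def']

@[simp] theorem post_id {a b : C} {X : V} (f : X ⟶ 𝓗[V] a b) : post f (eId V b) = f := by
  have := e_comp_id V a b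
  have h : f = f ≫ 𝟙 _ := by simp
  conv_rhs => rw [h, ← this]
  simp [post, star, MonoidalCategory.tensorHom_def]

theorem comp_pre {a b c : C} {X X' : V} (p : X' ⟶ X) (e : 𝟙_ V ⟶ 𝓗[V] a b)
    (f : X ⟶ 𝓗[V] b c) : pre e (p ≫ f) = p ≫ pre e f := by
  simp [pre, star_comp]

theorem comp_post {a b c : C} {X X' : V} (p : X' ⟶ X) (f : X ⟶ 𝓗[V] a b)
    (e : 𝟙_ V ⟶ 𝓗[V] b c) : post (p ≫ f) e = p ≫ post f e := by
  simp [post, comp_star]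

theorem pre_star {a b c d : C} {X Y : V} (e : 𝟙_ V ⟶ 𝓗[V] a b) (f : X ⟶ 𝓗[V] b c)
    (g : Y ⟶ 𝓗[V] c d) : pre e (star f g) = star (pre e f) g := by
  simp [pre, star_star, comp_star]

theorem star_post {a b c d : C} {X Y : V} (f : X ⟶ 𝓗[V] a b)
    (g : Y ⟶ 𝓗[V] b c) (e : 𝟙_ V ⟶ 𝓗[V] c d) : post (star f g) e = star f (post g e) := by
  simp [post, star_star, star_comp]

theorem post_star {a b c d : C} {X Y : V} (f : X ⟶ 𝓗[V] a b)
    (e : 𝟙_ V ⟶ 𝓗[V] b c) (g : Y ⟶ 𝓗[V] c d) : star (post f e) g = star f (pre e g) := by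
  simp [post, pre, star_star, comp_star, star_comp]

theorem pre_post {a b c d : C} {X : V} (e : 𝟙_ V ⟶ 𝓗[V] a b)
    (f : X ⟶ 𝓗[V] b c) (e' : 𝟙_ V ⟶ 𝓗[V] c d) : pre e (post f e') = post (pre e f) e' := by
  simp [post, pre, star_star, comp_star, star_comp]

theorem pre_pre {a b c d : C} {X : V} (e : 𝟙_ V ⟶ 𝓗[V] a b) (e' : 𝟙_ V ⟶ 𝓗[V] b c)
    (f : X ⟶ 𝓗[V] c d) : pre e (pre e' f) = pre (pre e e') f := by
  simp [pre, star_star, comp_star, star_comp]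

theorem post_post {a b c d : C} {X : V} (f : X ⟶ 𝓗[V] a b) (e : 𝟙_ V ⟶ 𝓗[V] b c)
    (e' : 𝟙_ V ⟶ 𝓗[V] c d) : post (post f e) e' = post f (pre e e') := by
  simp [post, pre, star_star, comp_star, star_comp]

theorem pre_map (F : EnrichedFunctor V C D) {a b c : C} {X : V} (e : 𝟙_ V ⟶ 𝓗[V] a b)
    (f : X ⟶ 𝓗[V] b c) : pre e f ≫ F.map a c = pre (e ≫ F.map a b) (f ≫ F.map b c) := by
  simp [pre, star_map]

theorem post_map (F : EnrichedFunctor V C D) {a b c : C} {X : V} (f : X ⟶ 𝓗[V] a b)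
    (e : 𝟙_ V ⟶ 𝓗[V] b c) : post f e ≫ F.map a c = post (f ≫ F.map a b) (e ≫ F.map b c) := by
  simp [post, star_map]

theorem whisker_eval_aux {A B C P Q X Y : V} (f : X ⟶ P) (g : Y ⟶ Q) (p : A ⊗ P ⟶ B)
    (q : B ⊗ Q ⟶ C) :
    A ◁ (f ⊗ₘ g) ≫ (α_ A P Q).inv ≫ p ▷ Q ≫ q =
      (α_ A X Y).inv ≫ (A ◁ f ≫ p) ▷ Y ≫ B ◁ g ≫ q := by
  simp only [MonoidalCategory.tensorHom_def, MonoidalCategory.whiskerLeft_comp, Category.assoc,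
    comp_whiskerRight, associator_inv_naturality_middle_assoc,
    associator_inv_naturality_right_assoc, whisker_exchange_assoc]

end Elements

/-! ### Objects of `V`-natural transformations -/

section Natural

variable {V : Type u} [Category.{v} V] [MonoidalCategory V] [SymmetricCategory V]
variable {J : Type*} [EnrichedCategory V J] {D : Type*} [EnrichedCategory V D]

/-- `V`-naturality of a family `X ⟶ D(F j, G j)` of generalised elements, where `X : V`. For
`X` the unit object these are the `V`-natural transformations from `F` to `G`. -/
def IsVNatural (F G : EnrichedFunctor V J D) {X : V}
    (f : ∀ j, X ⟶ 𝓗[V] (F.obj j) (G.obj j)) : Prop :=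
  ∀ j j' : J, (β_ X (𝓗[V] j j')).hom ≫ star (F.map j j') (f j') = star (f j) (G.map j j')

/-- The family `π` exhibits `N : V` as the object of `V`-natural transformations from `F`
to `G`, that is, as the end `∫ j, D(F j, G j)` : it is the universal `V`-natural family. -/
def IsNatObj (F G : EnrichedFunctor V J D) {N : V}
    (π : ∀ j, N ⟶ 𝓗[V] (F.obj j) (G.obj j)) : Prop :=
  IsVNatural F G π ∧
    ∀ (X : V) (f : ∀ j, X ⟶ 𝓗[V] (F.obj j) (G.obj j)), IsVNatural F G f →
      ∃! l : X ⟶ N, ∀ j, l ≫ π j = f j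

theorem IsVNatural.comp {F G : EnrichedFunctor V J D} {X Y : V}
    {f : ∀ j, X ⟶ 𝓗[V] (F.obj j) (G.obj j)} (hf : IsVNatural F G f) (p : Y ⟶ X) :
    IsVNatural F G (fun j => p ≫ f j) := by
  intro j j'
  rw [comp_star, star_comp, ← hf j j', ← braiding_naturality_left_assoc]

theorem IsVNatural.gen {F G : EnrichedFunctor V J D} {X : V}
    {f : ∀ j, X ⟶ 𝓗[V] (F.obj j) (G.obj j)} (hf : IsVNatural F G f) {Y : V} {j j' : J}
    (y : Y ⟶ 𝓗[V] j j') :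
    (β_ X Y).hom ≫ star (y ≫ F.map j j') (f j') = star (f j) (y ≫ G.map j j') := by
  rw [comp_star, star_comp, ← hf j j', ← braiding_naturality_right_assoc]

theorem IsVNatural.elem {F G : EnrichedFunctor V J D} {X : V}
    {f : ∀ j, X ⟶ 𝓗[V] (F.obj j) (G.obj j)} (hf : IsVNatural F G f) {j j' : J}
    (y : 𝟙_ V ⟶ 𝓗[V] j j') :
    pre (y ≫ F.map j j') (f j') = post (f j) (y ≫ G.map j j') := by
  rw [pre, post, ← hf.gen]
  simp

theorem isVNatural_id (F : EnrichedFunctor V J D) :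
    IsVNatural F F (fun j => eId V (F.obj j)) := by
  intro j j'
  have h1 := post_id (F.map j j')
  have h2 := pre_id (F.map j j')
  rw [post, Iso.inv_comp_eq] at h1
  rw [pre, Iso.inv_comp_eq] at h2
  rw [h1, h2, braiding_tensorUnit_left]
  simp

theorem IsVNatural.star {F G H : EnrichedFunctor V J D} {X Y : V}
    {f : ∀ j, X ⟶ 𝓗[V] (F.obj j) (G.obj j)} (hf : IsVNatural F G f)
    {g : ∀ j, Y ⟶ 𝓗[V] (G.obj j) (H.obj j)} (hg : IsVNatural G H g) :
    IsVNatural F H (fun j => EnrichedWeights.star (f j) (g j)) := by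
  intro j j'
  rw [star_star', ← hg j j', star_comp, star_star, star_star (f j), ← hf j j', comp_star]
  simp [braiding_tensor_left_hom]

theorem IsNatObj.hom_ext {F G : EnrichedFunctor V J D} {N : V}
    {π : ∀ j, N ⟶ 𝓗[V] (F.obj j) (G.obj j)} (h : IsNatObj F G π) {X : V} {p q : X ⟶ N}
    (hpq : ∀ j, p ≫ π j = q ≫ π j) : p = q :=
  (h.2 X (fun j => q ≫ π j) (h.1.comp q)).unique hpq (fun _ => rfl)

theorem whiskerLeft_symmetry_aux {X Y Z W : V} (f : X ⊗ Y ⊗ Z ⟶ W) :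
    X ◁ (β_ Y Z).hom ≫ X ◁ (β_ Z Y).hom ≫ f = f := by
  rw [← MonoidalCategory.whiskerLeft_comp_assoc, SymmetricCategory.symmetry,
    MonoidalCategory.whiskerLeft_id, Category.id_comp]

end Natural

/-! ### Small `V`-categories and existence of ends over them -/

section Small

/-- A `V`-category is small when its isomorphism classes of objects form a small set, where
smallness refers to the universe `v` of the hom-sets of the (locally small) category `V`. -/
class IsSmall (V : Type u) [Category.{v} V] [MonoidalCategory V] (K : Type w)
    [EnrichedCategory V K] : Prop where
  small : Small.{v} (Quotient (isIsomorphicSetoid (ForgetEnrichment V K)))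

variable {V : Type u} [Category.{v} V] [MonoidalCategory V]
variable {K : Type w} [EnrichedCategory V K]

/-- A family of objects to which every object is isomorphic. -/
def IsRepFamily (V : Type u) [Category.{v} V] [MonoidalCategory V] {K : Type w}
    [EnrichedCategory V K] {S : Type v} (r : S → K) : Prop :=
  ∀ k, ∃ (s : S) (e : 𝟙_ V ⟶ 𝓗[V] k (r s)) (e' : 𝟙_ V ⟶ 𝓗[V] (r s) k),
    pre e e' = eId V k ∧ pre e' e = eId V (r s)

theorem pre_eq_homTo_comp {a b c : K} (e : 𝟙_ V ⟶ 𝓗[V] a b) (e' : 𝟙_ V ⟶ 𝓗[V] b c) :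
    pre e e' = ForgetEnrichment.homTo V
      (ForgetEnrichment.homOf V e ≫ ForgetEnrichment.homOf V e') := by
  rw [ForgetEnrichment.homTo_comp]
  simp [pre, star]

theorem isRepFamily_of_iso {S : Type v} (r : S → K)
    (h : ∀ k : K, ∃ s, Nonempty (ForgetEnrichment.of V k ≅ ForgetEnrichment.of V (r s))) :
    IsRepFamily V r := by
  intro k
  obtain ⟨s, ⟨i⟩⟩ := h k
  refine ⟨s, ForgetEnrichment.homTo V i.hom, ForgetEnrichment.homTo V i.inv, ?_, ?_⟩
  · rw [pre_eq_homTo_comp]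
    exact (congrArg (ForgetEnrichment.homTo V) i.hom_inv_id).trans (ForgetEnrichment.homTo_id _ _)
  · rw [pre_eq_homTo_comp]
    exact (congrArg (ForgetEnrichment.homTo V) i.inv_hom_id).trans (ForgetEnrichment.homTo_id _ _)

theorem exists_isRepFamily (V : Type u) [Category.{v} V] [MonoidalCategory V] (K : Type w)
    [EnrichedCategory V K] [IsSmall V K] :
    ∃ (S : Type v) (r : S → K), IsRepFamily V r := by
  have := IsSmall.small (V := V) (K := K)
  let _ := isIsomorphicSetoid (ForgetEnrichment V K)
  refine ⟨Shrink.{v} (Quotient (isIsomorphicSetoid (ForgetEnrichment V K))),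
    fun s => ForgetEnrichment.to V ((equivShrink _).symm s).out, isRepFamily_of_iso _ fun k => ?_⟩
  refine ⟨equivShrink _ (Quotient.mk _ (ForgetEnrichment.of V k)), ?_⟩
  rw [Equiv.symm_apply_apply]
  exact Setoid.symm (Quotient.mk_out (ForgetEnrichment.of V k))

theorem isSmall_of_isRepFamily {S : Type v} {r : S → K} (h : IsRepFamily V r) :
    IsSmall V K where
  small := by
    let _ := isIsomorphicSetoid (ForgetEnrichment V K)
    refine small_of_surjective (f := fun s : S =>
      (Quotient.mk _ (ForgetEnrichment.of V (r s)) :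
        Quotient (isIsomorphicSetoid (ForgetEnrichment V K)))) ?_
    intro q
    induction q using Quotient.inductionOn with
    | h k =>
      obtain ⟨s, e, e', h1, h2⟩ := h (ForgetEnrichment.to V k)
      refine ⟨s, Quotient.sound ⟨⟨ForgetEnrichment.homOf V e', ForgetEnrichment.homOf V e,
        ?_, ?_⟩⟩⟩
      · rw [pre_eq_homTo_comp] at h2
        exact h2.trans (ForgetEnrichment.homTo_id _ _).symm
      · rw [pre_eq_homTo_comp] at h1
        exact h1.trans (ForgetEnrichment.homTo_id _ _).symm

end Small

section SmallEnds

variable {V : Type u} [Category.{v} V] [MonoidalCategory V] [SymmetricCategory V]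
variable {J : Type w} [EnrichedCategory V J] {D : Type*} [EnrichedCategory V D]

/-- Composition in the opposite `V`-category. -/
theorem star_op {a b c : Jᵒᵖ} {X Y : V} (f : X ⟶ 𝓗[V] a b) (g : Y ⟶ 𝓗[V] b c) :
    star f g = (β_ X Y).hom ≫
      star (a := c.unop) (b := b.unop) (c := a.unop) (C := J) g f :=
  tensorHom_eComp_op_eq V f g

theorem IsRepFamily.op {S : Type v} {r : S → J} (h : IsRepFamily V r) :
    IsRepFamily V (fun s => op (r s)) := by
  intro k
  obtain ⟨s, e, e', h1, h2⟩ := h k.unop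
  refine ⟨s, e', e, ?_, ?_⟩
  · rw [pre, star_op, leftUnitor_inv_braiding_assoc, ← unitors_inv_equal]
    exact h1
  · rw [pre, star_op, leftUnitor_inv_braiding_assoc, ← unitors_inv_equal]
    exact h2

instance [IsSmall V J] : IsSmall V Jᵒᵖ := by
  obtain ⟨S, r, h⟩ := exists_isRepFamily V J
  exact isSmall_of_isRepFamily h.op

/-- `V`-natural families are determined by, and can be extended from, their values on a
family of representatives of the isomorphism classes of objects. -/
theorem exists_extension {S : Type v} {r : S → J} (hr : IsRepFamily V r)
    (F G : EnrichedFunctor V J D) {X : V}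
    (f : ∀ s, X ⟶ 𝓗[V] (F.obj (r s)) (G.obj (r s)))
    (hf : ∀ s s', (β_ X (𝓗[V] (r s) (r s'))).hom ≫ star (F.map (r s) (r s')) (f s') =
      star (f s) (G.map (r s) (r s'))) :
    ∃ g : ∀ j, X ⟶ 𝓗[V] (F.obj j) (G.obj j), IsVNatural F G g ∧ ∀ s, g (r s) = f s := by
  choose s e e' h1 h2 using hr
  have key : ∀ s s' {Y : V} (y : Y ⟶ 𝓗[V] (r s) (r s')),
      (β_ X Y).hom ≫ star (y ≫ F.map _ _) (f s') = star (f s) (y ≫ G.map _ _) := by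
    intro s s' Y y
    rw [comp_star, star_comp, ← hf, ← braiding_naturality_right_assoc]
  have key1 : ∀ s s' (y : 𝟙_ V ⟶ 𝓗[V] (r s) (r s')),
      pre (y ≫ F.map _ _) (f s') = post (f s) (y ≫ G.map _ _) := by
    intro s s' y
    rw [pre, post, ← key]
    simp
  refine ⟨fun j => pre (e j ≫ F.map _ _) (post (f (s j)) (e' j ≫ G.map _ _)), ?_, ?_⟩
  · intro j j'
    have hy : pre (e' j) (𝟙 (𝓗[V] j j')) =
        post (post (pre (e' j) (𝟙 _)) (e j')) (e' j') := by
      rw [post_post, h1, post_id]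
    have hy' : post (𝟙 (𝓗[V] j j')) (e j') =
        pre (e j) (post (pre (e' j) (𝟙 _)) (e j')) := by
      rw [← pre_post, pre_pre, h1, pre_id]
    rw [← pre_star, post_star]
    have t1 : pre (e' j ≫ G.map _ _) (G.map j j') =
        post (post (pre (e' j) (𝟙 _)) (e j') ≫ G.map _ _) (e' j' ≫ G.map _ _) := by
      rw [← post_map, ← hy, pre_map, Category.id_comp]
    have t2 : post (F.map j j') (e j' ≫ F.map _ _) =
        pre (e j ≫ F.map _ _) (post (pre (e' j) (𝟙 _)) (e j') ≫ F.map _ _) := by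
      rw [← pre_map, ← hy', post_map, Category.id_comp]
    rw [t1, ← star_post, ← key, ← post_star, t2, ← pre_star, comp_post, comp_pre, star_post]
  · intro t
    change pre _ (post _ _) = _
    rw [pre_post, key1, post_post, ← pre_map, h1, G.map_id, post_id]

theorem ext_of_rep {S : Type v} {r : S → J} (hr : IsRepFamily V r)
    {F G : EnrichedFunctor V J D} {X : V} {f g : ∀ j, X ⟶ 𝓗[V] (F.obj j) (G.obj j)}
    (hf : IsVNatural F G f) (hg : IsVNatural F G g) (h : ∀ s, f (r s) = g (r s)) (j : J) :
    f j = g j := by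
  obtain ⟨s, e, e', h1, h2⟩ := hr j
  have key : ∀ {f : ∀ j, X ⟶ 𝓗[V] (F.obj j) (G.obj j)}, IsVNatural F G f →
      f j = post (pre (e ≫ F.map _ _) (f (r s))) (e' ≫ G.map _ _) := by
    intro f hf
    rw [hf.elem, post_post, ← pre_map, h1, G.map_id, post_id]
  rw [key hf, key hg, h]

variable [MonoidalClosed V] [HasLimits V]

/-- Objects of `V`-natural transformations exist on small domains. -/
theorem exists_isNatObj [IsSmall V J] (F G : EnrichedFunctor V J D) :
    ∃ (N : V) (π : ∀ j, N ⟶ 𝓗[V] (F.obj j) (G.obj j)), IsNatObj F G π := by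
  obtain ⟨S, r, hr⟩ := exists_isRepFamily V J
  let sh : MulticospanShape.{v, v} := ⟨S, S × S, Prod.fst, Prod.snd⟩
  let I : MulticospanIndex sh V :=
    { left := fun s => 𝓗[V] (F.obj (r s)) (G.obj (r s))
      right := fun p => (ihom (𝓗[V] (r p.1) (r p.2))).obj (𝓗[V] (F.obj (r p.1)) (G.obj (r p.2)))
      fst := fun p => MonoidalClosed.curry ((β_ _ _).hom ≫ star (𝟙 _) (G.map _ _))
      snd := fun p => MonoidalClosed.curry (star (F.map _ _) (𝟙 _)) }
  have hI : ∀ {X : V} (f : ∀ s, X ⟶ 𝓗[V] (F.obj (r s)) (G.obj (r s))) (p : S × S),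
      f p.1 ≫ I.fst p = f p.2 ≫ I.snd p ↔
      (β_ X (𝓗[V] (r p.1) (r p.2))).hom ≫ star (F.map (r p.1) (r p.2)) (f p.2) =
        star (f p.1) (G.map (r p.1) (r p.2)) := by
    intro X f p
    have e1 : f p.1 ≫ I.fst p =
        MonoidalClosed.curry ((β_ _ _).hom ≫ star (f p.1) (G.map _ _)) := by
      change f p.1 ≫ MonoidalClosed.curry _ = _
      rw [← MonoidalClosed.curry_natural_left, braiding_naturality_right_assoc, ← comp_star,
        Category.comp_id]
    have e2 : f p.2 ≫ I.snd p = MonoidalClosed.curry (star (F.map _ _) (f p.2)) := by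
      change f p.2 ≫ MonoidalClosed.curry _ = _
      rw [← MonoidalClosed.curry_natural_left, ← star_comp, Category.comp_id]
    rw [e1, e2, MonoidalClosed.curry_injective.eq_iff]
    constructor
    · intro h
      rw [← h, SymmetricCategory.symmetry_assoc]
    · intro h
      rw [← h, SymmetricCategory.symmetry_assoc]
  obtain ⟨π, hπ, hπr⟩ := exists_extension hr F G (fun s => Multiequalizer.ι I s)
    (fun s s' => (hI (fun s => Multiequalizer.ι I s) (s, s')).1
      (Multiequalizer.condition I (s, s')))
  refine ⟨multiequalizer I, π, hπ, fun X f hf => ?_⟩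
  refine ⟨Multiequalizer.lift I X (fun s => f (r s))
    (fun p => (hI (fun s => f (r s)) p).2 (hf (r p.1) (r p.2))), ?_, ?_⟩
  · refine ext_of_rep hr (hπ.comp _) hf fun s => ?_
    change _ ≫ π (r s) = _
    rw [hπr]
    exact Multiequalizer.lift_ι I X _ _ s
  · intro l hl
    refine Multiequalizer.hom_ext I _ _ fun s => ?_
    rw [Multiequalizer.lift_ι, ← hl, hπr]

end SmallEnds

/-! ### Functor `V`-categories -/

section FunctorCategory

variable {V : Type u} [Category.{v} V] [MonoidalCategory V] [SymmetricCategory V]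
  [MonoidalClosed V] [HasLimits V]
variable {J : Type w} [EnrichedCategory V J] [IsSmall V J] {D : Type*} [EnrichedCategory V D]

/-- The hom-object `[J, D](F, G) = ∫ j, D(F j, G j)` of the functor category. -/
def natObj (F G : EnrichedFunctor V J D) : V := (exists_isNatObj F G).choose

/-- The counit `[J, D](F, G) ⟶ D(F j, G j)` of the end. -/
def natProj (F G : EnrichedFunctor V J D) (j : J) : natObj F G ⟶ 𝓗[V] (F.obj j) (G.obj j) :=
  (exists_isNatObj F G).choose_spec.choose j

theorem isNatObj_natProj (F G : EnrichedFunctor V J D) : IsNatObj F G (natProj F G) :=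
  (exists_isNatObj F G).choose_spec.choose_spec

/-- The morphism into `[J, D](F, G)` determined by a `V`-natural family. -/
def natLift {F G : EnrichedFunctor V J D} {X : V} (f : ∀ j, X ⟶ 𝓗[V] (F.obj j) (G.obj j))
    (hf : IsVNatural F G f) : X ⟶ natObj F G :=
  ((isNatObj_natProj F G).2 X f hf).choose

@[simp] theorem natLift_proj {F G : EnrichedFunctor V J D} {X : V}
    (f : ∀ j, X ⟶ 𝓗[V] (F.obj j) (G.obj j)) (hf : IsVNatural F G f) (j : J) :
    natLift f hf ≫ natProj F G j = f j :=
  ((isNatObj_natProj F G).2 X f hf).choose_spec.1 j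

theorem natObj_hom_ext {F G : EnrichedFunctor V J D} {X : V} {p q : X ⟶ natObj F G}
    (h : ∀ j, p ≫ natProj F G j = q ≫ natProj F G j) : p = q :=
  (isNatObj_natProj F G).hom_ext h

/-- The `V`-category `[J, D]` of `V`-functors from a small `V`-category `J`. -/
instance functorCategory : EnrichedCategory V (EnrichedFunctor V J D) where
  Hom F G := natObj F G
  id F := natLift (fun j => eId V (F.obj j)) (isVNatural_id F)
  comp F G H := natLift (fun j => star (natProj F G j) (natProj G H j))
    ((isNatObj_natProj F G).1.star (isNatObj_natProj G H).1)
  id_comp F G := natObj_hom_ext fun j => by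
    have := pre_id (natProj F G j)
    simp only [Category.assoc, natLift_proj, Category.id_comp]
    rw [← comp_star, natLift_proj]
    exact this
  comp_id F G := natObj_hom_ext fun j => by
    have := post_id (natProj F G j)
    simp only [Category.assoc, natLift_proj, Category.id_comp]
    rw [← star_comp, natLift_proj]
    exact this
  assoc F G H K := natObj_hom_ext fun j => by
    simp only [Category.assoc, natLift_proj]
    rw [← comp_star, ← star_comp, natLift_proj, natLift_proj, star_star]

theorem functorCategory_id_proj (F : EnrichedFunctor V J D) (j : J) :
    eId V F ≫ natProj F F j = eId V (F.obj j) :=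
  natLift_proj _ (isVNatural_id F) j

theorem functorCategory_star_proj {F G H : EnrichedFunctor V J D} {X Y : V}
    (f : X ⟶ 𝓗[V] F G) (g : Y ⟶ 𝓗[V] G H) (j : J) :
    star f g ≫ natProj F H j = star (f ≫ natProj F G j) (g ≫ natProj G H j) := by
  rw [comp_star_comp, star, Category.assoc]
  exact congrArg _ (natLift_proj (fun j => star (natProj F G j) (natProj G H j))
    ((isNatObj_natProj F G).1.star (isNatObj_natProj G H).1) j)

end FunctorCategory

/-! ### Representable functors and the Yoneda embedding -/

section Representables

variable {V : Type u} [Category.{v} V] [MonoidalCategory V] [MonoidalClosed V]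

/-- The transpose `X ⟶ [A, B]` of a morphism `A ⊗ X ⟶ B`. -/
def ecurry {A B X : V} (f : A ⊗ X ⟶ B) : X ⟶ 𝓗[V] A B := MonoidalClosed.curry f

/-- The transpose `A ⊗ X ⟶ B` of a morphism `X ⟶ [A, B]`. -/
def euncurry {A B X : V} (f : X ⟶ 𝓗[V] A B) : A ⊗ X ⟶ B := MonoidalClosed.uncurry f

@[simp] theorem euncurry_ecurry {A B X : V} (f : A ⊗ X ⟶ B) : euncurry (ecurry f) = f :=
  MonoidalClosed.uncurry_curry f

@[simp] theorem ecurry_euncurry {A B X : V} (f : X ⟶ 𝓗[V] A B) : ecurry (euncurry f) = f :=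
  MonoidalClosed.curry_uncurry f

theorem euncurry_inj {A B X : V} {f g : X ⟶ 𝓗[V] A B} (h : euncurry f = euncurry g) : f = g :=
  MonoidalClosed.uncurry_injective h

theorem euncurry_comp {A B X Y : V} (p : Y ⟶ X) (f : X ⟶ 𝓗[V] A B) :
    euncurry (p ≫ f) = A ◁ p ≫ euncurry f :=
  MonoidalClosed.uncurry_natural_left p f

theorem comp_ecurry {A B X Y : V} (p : Y ⟶ X) (f : A ⊗ X ⟶ B) :
    p ≫ ecurry f = ecurry (A ◁ p ≫ f) :=
  (MonoidalClosed.curry_natural_left p f).symm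

theorem euncurry_eId (A : V) : euncurry (eId V A) = (ρ_ A).hom :=
  MonoidalClosed.uncurry_curry _

theorem euncurry_star {A B C X Y : V} (f : X ⟶ 𝓗[V] A B) (g : Y ⟶ 𝓗[V] B C) :
    euncurry (star f g) = (α_ A X Y).inv ≫ euncurry f ▷ Y ≫ euncurry g := by
  have h : euncurry (eComp V A B C) =
    (α_ A _ _).inv ≫ (ihom.ev A).app B ▷ _ ≫ (ihom.ev B).app C := MonoidalClosed.uncurry_curry _
  rw [star, euncurry_comp, h]
  have hf : euncurry f = A ◁ f ≫ (ihom.ev A).app B := rfl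
  have hg : euncurry g = B ◁ g ≫ (ihom.ev B).app C := rfl
  rw [hf, hg]
  exact whisker_eval_aux f g ((ihom.ev A).app B) ((ihom.ev B).app C)

variable {A : Type*} [EnrichedCategory V A]

variable (V) in
/-- The representable `V`-functor `A(a, -) : A ⟶ V`. -/
abbrev representable (a : A) : EnrichedFunctor V A V where
  obj x := 𝓗[V] a x
  map x y := ecurry (eComp V a x y)
  map_id x := euncurry_inj (by
    rw [euncurry_comp, euncurry_ecurry, euncurry_eId]
    have := e_comp_id V a x
    rw [Iso.inv_comp_eq, Category.comp_id] at this
    exact this)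
  map_comp x y z := euncurry_inj (by
    change _ = euncurry (star _ _)
    rw [euncurry_comp, euncurry_star, euncurry_ecurry, euncurry_ecurry, euncurry_ecurry]
    exact (e_assoc V a x y z).symm)

/-- The `V`-functor `A(a, T-) : J ⟶ V`, the composite of `T : J ⟶ A` and `A(a, -)`. -/
abbrev homFunctor {J : Type*} [EnrichedCategory V J] (a : A) (T : EnrichedFunctor V J A) :
    EnrichedFunctor V J V where
  obj j := 𝓗[V] a (T.obj j)
  map j j' := T.map j j' ≫ (representable V a).map (T.obj j) (T.obj j')
  map_id j := (T.comp V (representable V a)).map_id j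
  map_comp j j' j'' := (T.comp V (representable V a)).map_comp j j' j''

theorem homFunctor_eq_comp {J : Type*} [EnrichedCategory V J] (a : A)
    (T : EnrichedFunctor V J A) : homFunctor a T = T.comp V (representable V a) := rfl

theorem euncurry_comp_representable {X : V} {a x y : A} (f : X ⟶ 𝓗[V] x y) :
    euncurry (f ≫ (representable V a).map x y) = star (𝟙 _) f := by
  rw [euncurry_comp, euncurry_ecurry, star, id_tensorHom]

end Representables

/-! ### Weighted limits and colimits -/

section Weighted

variable {V : Type u} [Category.{v} V] [MonoidalCategory V] [SymmetricCategory V]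
variable {J : Type w} [EnrichedCategory V J] {A : Type*} [EnrichedCategory V A]
  {B : Type*} [EnrichedCategory V B]

/-- The opposite `V`-functor. -/
abbrev opFunctor (F : EnrichedFunctor V A B) : EnrichedFunctor V Aᵒᵖ Bᵒᵖ where
  obj a := op (F.obj a.unop)
  map a a' := F.map a'.unop a.unop
  map_id a := F.map_id a.unop
  map_comp a b c := by
    rw [tensorHom_eComp_op_eq, eComp_op_eq, Category.assoc, F.map_comp]
    rfl

variable [MonoidalClosed V]

/-- The family `A(a, L) ⟶ [φ j, A(a, T j)]` induced by a family `μ j : φ j ⟶ A(L, T j)`. -/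
def limitComparison (φ : EnrichedFunctor V J V) (T : EnrichedFunctor V J A) {L : A}
    (μ : ∀ j, φ.obj j ⟶ 𝓗[V] L (T.obj j)) (a : A) (j : J) :
    𝓗[V] a L ⟶ 𝓗[V] (φ.obj j) ((homFunctor a T).obj j) :=
  ecurry ((β_ _ _).hom ≫ star (𝟙 (𝓗[V] a L)) (μ j))

/-- `L` with the counit `μ : φ ⟶ A(L, T-)` is the limit `{φ, T}` of `T` weighted by `φ`: for
each `a`, the family induced by `μ` exhibits `A(a, L)` as the object of `V`-natural
transformations from `φ` to `A(a, T-)`, so that `A(a, L) ≅ [J, V](φ, A(a, T-))`. (The case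
`a = L`, evaluated at the identity of `L`, says in particular that `μ` is `V`-natural.) -/
def IsWeightedLimit (φ : EnrichedFunctor V J V) (T : EnrichedFunctor V J A) (L : A)
    (μ : ∀ j, φ.obj j ⟶ 𝓗[V] L (T.obj j)) : Prop :=
  ∀ a : A, IsNatObj φ (homFunctor a T) (limitComparison φ T μ a)

/-- `C` with the unit `η : φ ⟶ A(S-, C)` is the colimit `φ * S` of `S` weighted by `φ`, so
that `A(C, a) ≅ [Kᵒᵖ, V](φ, A(S-, a))`: it is the limit of `Sᵒᵖ` weighted by `φ` in `Aᵒᵖ`. -/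
def IsWeightedColimit (φ : EnrichedFunctor V Jᵒᵖ V) (S : EnrichedFunctor V J A) (C : A)
    (η : ∀ k : Jᵒᵖ, φ.obj k ⟶ 𝓗[V] (S.obj k.unop) C) : Prop :=
  IsWeightedLimit φ (opFunctor S) (op C) η

/-- `P` preserves the limit `{φ, T}`. -/
def PreservesWeightedLimit (P : EnrichedFunctor V A B) (φ : EnrichedFunctor V J V)
    (T : EnrichedFunctor V J A) : Prop :=
  ∀ (L : A) (μ : ∀ j, φ.obj j ⟶ 𝓗[V] L (T.obj j)), IsWeightedLimit φ T L μ →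
    IsWeightedLimit φ (T.comp V P) (P.obj L) (fun j => μ j ≫ P.map L (T.obj j))

/-- `P` preserves the colimit `φ * S`. -/
def PreservesWeightedColimit (P : EnrichedFunctor V A B) (φ : EnrichedFunctor V Jᵒᵖ V)
    (S : EnrichedFunctor V J A) : Prop :=
  ∀ (C : A) (η : ∀ k : Jᵒᵖ, φ.obj k ⟶ 𝓗[V] (S.obj k.unop) C), IsWeightedColimit φ S C η →
    IsWeightedColimit φ (S.comp V P) (P.obj C) (fun k => η k ≫ P.map (S.obj k.unop) C)

/-! Naturality of families with values in `V`, in terms of actions. -/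

/-- The action `F j ⊗ J(j, j') ⟶ F j'` of a `V`-functor to `V`. -/
def act (F : EnrichedFunctor V J V) (j j' : J) : F.obj j ⊗ 𝓗[V] j j' ⟶ F.obj j' :=
  euncurry (F.map j j')

theorem natural_ecurry_iff (F : EnrichedFunctor V J V) (T : EnrichedFunctor V J A)
    (a : A) {X : V} {j j' : J} (h : F.obj j ⊗ X ⟶ 𝓗[V] a (T.obj j))
    (h' : F.obj j' ⊗ X ⟶ 𝓗[V] a (T.obj j')) :
    (β_ X (𝓗[V] j j')).hom ≫ star (F.map j j') (ecurry h') =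
      star (ecurry h) ((homFunctor a T).map j j') ↔
    F.obj j ◁ (β_ X (𝓗[V] j j')).hom ≫ (α_ _ _ _).inv ≫ act F j j' ▷ X ≫ h' =
      (α_ _ _ _).inv ≫ star h (T.map j j') := by
  have h0 : euncurry ((homFunctor a T).map j j') = star (𝟙 _) (T.map j j') :=
    euncurry_comp_representable (T.map j j')
  have h1 : (α_ _ _ _).inv ≫ star h (T.map j j') =
      euncurry (star (ecurry h) ((homFunctor a T).map j j')) := by
    rw [euncurry_star, h0, euncurry_ecurry, ← comp_star, Category.comp_id]
  have h2 : F.obj j ◁ (β_ X (𝓗[V] j j')).hom ≫ (α_ _ _ _).inv ≫ act F j j' ▷ X ≫ h' =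
      euncurry ((β_ X (𝓗[V] j j')).hom ≫ star (F.map j j') (ecurry h')) := by
    rw [euncurry_comp, euncurry_star, euncurry_ecurry, act]
  rw [h1, h2]
  exact ⟨fun h => by rw [h], euncurry_inj⟩

theorem isVNatural_ecurry_iff (F : EnrichedFunctor V J V) (T : EnrichedFunctor V J A)
    (a : A) {X : V} (h : ∀ j, F.obj j ⊗ X ⟶ 𝓗[V] a (T.obj j)) :
    IsVNatural F (homFunctor a T) (fun j => ecurry (h j)) ↔
    ∀ j j' : J,
      F.obj j ◁ (β_ X (𝓗[V] j j')).hom ≫ (α_ _ _ _).inv ≫ act F j j' ▷ X ≫ h j' =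
        (α_ _ _ _).inv ≫ star (h j) (T.map j j') :=
  forall₂_congr fun j j' => natural_ecurry_iff F T a (h j) (h j')

/-- Naturality of a counit `φ j ⟶ A(L, T j)`. -/
def IsNaturalCounit (φ : EnrichedFunctor V J V) (T : EnrichedFunctor V J A) {L : A}
    (μ : ∀ j, φ.obj j ⟶ 𝓗[V] L (T.obj j)) : Prop :=
  ∀ j j', act φ j j' ≫ μ j' = star (μ j) (T.map j j')

theorem natural_limitComparison {φ : EnrichedFunctor V J V} {T : EnrichedFunctor V J A} {L : A}
    {j j' : J} {μ : φ.obj j ⟶ 𝓗[V] L (T.obj j)} {μ' : φ.obj j' ⟶ 𝓗[V] L (T.obj j')}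
    (h : act φ j j' ≫ μ' = star μ (T.map j j')) (a : A) :
    (β_ (𝓗[V] a L) (𝓗[V] j j')).hom ≫
        star (φ.map j j') (ecurry ((β_ _ _).hom ≫ star (𝟙 (𝓗[V] a L)) μ')) =
      star (ecurry ((β_ _ _).hom ≫ star (𝟙 (𝓗[V] a L)) μ)) ((homFunctor a T).map j j') := by
  refine (natural_ecurry_iff φ T a _ _).2 ?_
  rw [comp_star, braiding_naturality_left_assoc, ← star_comp, h, star_star]
  simp only [braiding_tensor_left_hom, Category.assoc, Iso.inv_hom_id_assoc, Iso.hom_inv_id_assoc,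
    whiskerLeft_symmetry_aux]

theorem isVNatural_limitComparison {φ : EnrichedFunctor V J V} {T : EnrichedFunctor V J A} {L : A}
    {μ : ∀ j, φ.obj j ⟶ 𝓗[V] L (T.obj j)} (h : IsNaturalCounit φ T μ) (a : A) :
    IsVNatural φ (homFunctor a T) (limitComparison φ T μ a) :=
  fun j j' => natural_limitComparison (h j j') a

theorem isNaturalCounit_of {φ : EnrichedFunctor V J V} {T : EnrichedFunctor V J A} {L : A}
    (h : ∀ j, φ.obj j ⊗ 𝟙_ V ⟶ 𝓗[V] L (T.obj j))
    (hf : IsVNatural φ (homFunctor L T)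
      (fun j => ecurry (h j))) :
    IsNaturalCounit φ T (fun j => (ρ_ _).inv ≫ h j) := by
  replace hf := (isVNatural_ecurry_iff _ _ _ _).1 hf
  intro j j'
  have := hf j j'
  rw [Iso.eq_inv_comp] at this
  change act φ j j' ≫ (ρ_ _).inv ≫ h j' = _
  rw [comp_star, ← this, rightUnitor_inv_naturality_assoc, braiding_tensorUnit_left]
  simp

theorem exists_extension_counit {S : Type v} {r : S → J} (hr : IsRepFamily V r)
    (φ : EnrichedFunctor V J V) (T : EnrichedFunctor V J A) {L : A}
    (μ : ∀ s, φ.obj (r s) ⟶ 𝓗[V] L (T.obj (r s)))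
    (hμ : ∀ s s', act φ (r s) (r s') ≫ μ s' = star (μ s) (T.map (r s) (r s'))) :
    ∃ ν : ∀ j, φ.obj j ⟶ 𝓗[V] L (T.obj j), IsNaturalCounit φ T ν ∧ ∀ s, ν (r s) = μ s := by
  obtain ⟨g, hg, hgr⟩ := exists_extension hr φ (homFunctor L T)
    (fun s => eId V L ≫ ecurry ((β_ _ _).hom ≫ star (𝟙 (𝓗[V] L L)) (μ s))) (fun s s' => by
      rw [comp_star, star_comp, ← natural_limitComparison (hμ s s') L,
        ← braiding_naturality_left_assoc])
  refine ⟨fun j => (ρ_ _).inv ≫ euncurry (g j),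
    isNaturalCounit_of (fun j => euncurry (g j)) (by simpa only [ecurry_euncurry] using hg), ?_⟩
  intro s
  change (ρ_ _).inv ≫ euncurry (g (r s)) = μ s
  rw [hgr, euncurry_comp, euncurry_ecurry, braiding_naturality_right_assoc, ← comp_star,
    Category.comp_id, rightUnitor_inv_braiding_assoc]
  exact pre_id (μ s)

end Weighted

/-! ### Weighted colimits in `V` -/

section ColimitsInBase

variable {V : Type u} [Category.{v} V]

theorem exists_coend_aux [HasColimits V] {L R : Type v} (fst snd : L → R) (X : L → V) (Y : R → V)
    (f : ∀ l, X l ⟶ Y (fst l)) (g : ∀ l, X l ⟶ Y (snd l)) :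
    ∃ (C : V) (π : ∀ r, Y r ⟶ C), (∀ l, f l ≫ π _ = g l ≫ π _) ∧
      (∀ (Z : V) (t : ∀ r, Y r ⟶ Z), (∀ l, f l ≫ t _ = g l ≫ t _) →
        ∃ d : C ⟶ Z, ∀ r, π r ≫ d = t r) ∧
      ∀ (Z : V) (d d' : C ⟶ Z), (∀ r, π r ≫ d = π r ≫ d') → d = d' := by
  let sh : MultispanShape.{v, v} := ⟨L, R, fst, snd⟩
  let I : MultispanIndex sh V := { left := X, right := Y, fst := f, snd := g }
  exact ⟨multicoequalizer I, Multicoequalizer.π I, Multicoequalizer.condition I,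
    fun Z t ht => ⟨Multicoequalizer.desc I Z t ht, Multicoequalizer.π_desc I Z t ht⟩,
    fun Z d d' h => Multicoequalizer.hom_ext I d d' h⟩

variable [MonoidalCategory V] [SymmetricCategory V]

theorem hexagon_aux {X Y Z : V} :
    (α_ X Z Y).hom ≫ X ◁ (β_ Z Y).hom ≫ (α_ X Y Z).inv ≫ (β_ (X ⊗ Y) Z).hom =
      (β_ X Z).hom ▷ Y ≫ (α_ Z X Y).hom := by
  simp only [braiding_tensor_left_hom, Iso.inv_hom_id_assoc, whiskerLeft_symmetry_aux,
    Iso.hom_inv_id_assoc]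

theorem hexagon_aux_assoc {X Y Z W : V} (f : Z ⊗ (X ⊗ Y) ⟶ W) :
    (α_ X Z Y).hom ≫ X ◁ (β_ Z Y).hom ≫ (α_ X Y Z).inv ≫ (β_ (X ⊗ Y) Z).hom ≫ f =
      (β_ X Z).hom ▷ Y ≫ (α_ Z X Y).hom ≫ f := by
  have h := congrArg (fun t => t ≫ f) (hexagon_aux (X := X) (Y := Y) (Z := Z))
  simpa only [Category.assoc] using h

theorem hexagon_aux' {X Y Z W : V} (f : (Y ⊗ Z) ⊗ X ⟶ W) :
    (β_ (X ⊗ Y) Z).hom ≫ Z ◁ (β_ X Y).hom ≫ (α_ _ _ _).inv ≫ (β_ Z Y).hom ▷ X ≫ f =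
      (β_ X Y).hom ▷ Z ≫ (α_ _ _ _).hom ≫ Y ◁ (β_ X Z).hom ≫ (α_ _ _ _).inv ≫ f := by
  rw [← braiding_naturality_left_assoc]
  simp only [braiding_tensor_left_hom, Category.assoc, Iso.hom_inv_id_assoc]
  rw [← comp_whiskerRight_assoc, SymmetricCategory.symmetry, id_whiskerRight, Category.id_comp]

theorem yang_baxter_aux {X Y Z W : V} (f : Z ⊗ (Y ⊗ X) ⟶ W) :
    X ◁ (β_ Y Z).hom ≫ (α_ _ _ _).inv ≫ (β_ X Z).hom ▷ Y ≫ (α_ _ _ _).hom ≫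
      Z ◁ (β_ X Y).hom ≫ f =
    (α_ _ _ _).inv ≫ (β_ X Y).hom ▷ Z ≫ (α_ _ _ _).hom ≫ Y ◁ (β_ X Z).hom ≫ (α_ _ _ _).inv ≫
      (β_ Y Z).hom ▷ X ≫ (α_ _ _ _).hom ≫ f := by
  have h := congrArg (fun t => t ≫ (α_ _ _ _).hom ≫ f)
    (braiding_naturality_right X (β_ Y Z).hom)
  simpa only [braiding_tensor_right_hom, Category.assoc, Iso.inv_hom_id_assoc] using h

variable [MonoidalClosed V]
variable {K : Type w} [EnrichedCategory V K] {A : Type*} [EnrichedCategory V A]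

/-- Naturality of a unit `φ k ⟶ A(S k, C)`. -/
def IsNaturalUnit (φ : EnrichedFunctor V Kᵒᵖ V) (S : EnrichedFunctor V K A) {C : A}
    (η : ∀ k : Kᵒᵖ, φ.obj k ⟶ 𝓗[V] (S.obj k.unop) C) : Prop :=
  ∀ k k' : Kᵒᵖ, act φ k k' ≫ η k' =
    (β_ (φ.obj k) (𝓗[V] k'.unop k.unop)).hom ≫ star (S.map k'.unop k.unop) (η k)

theorem isNaturalUnit_iff (φ : EnrichedFunctor V Kᵒᵖ V) (S : EnrichedFunctor V K A) {C : A}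
    (η : ∀ k : Kᵒᵖ, φ.obj k ⟶ 𝓗[V] (S.obj k.unop) C) :
    IsNaturalUnit φ S η ↔ IsNaturalCounit φ (opFunctor S) (L := op C) η := by
  refine forall₂_congr fun k k' => ?_
  rw [star_op]
  rfl

theorem comp_limitComparison_op (φ : EnrichedFunctor V Kᵒᵖ V) (S : EnrichedFunctor V K A) {C : A}
    (η : ∀ k : Kᵒᵖ, φ.obj k ⟶ 𝓗[V] (S.obj k.unop) C) {a : A} {X : V} (l : X ⟶ 𝓗[V] C a)
    (k : Kᵒᵖ) :
    l ≫ limitComparison φ (opFunctor S) (L := op C) η (op a) k = ecurry (star (η k) l) := by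
  change l ≫ ecurry ((β_ _ _).hom ≫ star (C := Aᵒᵖ) (𝟙 (𝓗[V] (op a) (op C))) (η k)) = _
  rw [star_op, SymmetricCategory.symmetry_assoc]
  refine (comp_ecurry _ _).trans (congrArg ecurry ?_)
  have := star_comp l (η k) (𝟙 _)
  rw [Category.comp_id] at this
  exact this.symm

theorem natural_op_iff (φ : EnrichedFunctor V Kᵒᵖ V) (F : EnrichedFunctor V K A) {a : A} {X : V}
    (h : ∀ k : Kᵒᵖ, φ.obj k ⊗ X ⟶ 𝓗[V] (F.obj k.unop) a) :
    IsVNatural φ (homFunctor (op a) (opFunctor F)) (fun k => ecurry (h k)) ↔ ∀ k k' : Kᵒᵖ,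
      act φ k k' ▷ X ≫ h k' = (β_ _ (𝓗[V] k'.unop k.unop)).hom ▷ X ≫ (α_ _ _ _).hom ≫
        star (F.map k'.unop k.unop) (h k) := by
  refine (isVNatural_ecurry_iff φ (opFunctor F) (op a) h).trans (forall₂_congr fun k k' => ?_)
  rw [star_op]
  constructor
  · intro e
    have e' := congrArg (fun t => (α_ _ _ _).hom ≫ φ.obj k ◁ (β_ _ X).hom ≫ t) e
    simp only [whiskerLeft_symmetry_aux, Iso.hom_inv_id_assoc] at e'
    exact e'.trans (hexagon_aux_assoc _)
  · intro e
    have e2 := e.trans (hexagon_aux_assoc (star (F.map k'.unop k.unop) (h k))).symm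
    refine (congrArg (fun t => φ.obj k ◁ (β_ X (𝓗[V] k'.unop k.unop)).hom ≫
      (α_ _ _ _).inv ≫ t) e2).trans ?_
    simp only [whiskerLeft_symmetry_aux, Iso.inv_hom_id_assoc]
    rfl

/-- Composition of a `V`-natural family `X ⟶ A(F k, G k)` with a natural `φ ⟶ A(G-, C)`. -/
theorem isVNatural_comp_unit {φ : EnrichedFunctor V Kᵒᵖ V} {F G : EnrichedFunctor V K A} {C : A}
    {η : ∀ k : Kᵒᵖ, φ.obj k ⟶ 𝓗[V] (G.obj k.unop) C} (hη : IsNaturalUnit φ G η) {X : V}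
    {f : ∀ k, X ⟶ 𝓗[V] (F.obj k) (G.obj k)} (hf : IsVNatural F G f) :
    IsVNatural φ (homFunctor (op C) (opFunctor F))
      (fun k => ecurry (A := φ.obj k) (B := 𝓗[V] (F.obj k.unop) C)
        ((β_ (φ.obj k) X).hom ≫ star (f k.unop) (η k))) := by
  refine (natural_op_iff φ F _).2 fun j j' => ?_
  rw [braiding_naturality_left_assoc, ← star_comp, hη, star_comp, star_star, ← hf, comp_star,
    star_comp, star_star]
  exact hexagon_aux' _

variable [HasColimits V] [IsSmall V K]

theorem exists_isWeightedColimit (φ : EnrichedFunctor V Kᵒᵖ V) (S : EnrichedFunctor V K V) :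
    ∃ (C : V) (η : ∀ k : Kᵒᵖ, φ.obj k ⟶ 𝓗[V] (S.obj k.unop) C),
      IsNaturalUnit φ S η ∧ IsWeightedColimit φ S C η := by
  obtain ⟨R, r, hr⟩ := exists_isRepFamily V K
  obtain ⟨C, π, hπ, hdesc, hext⟩ := exists_coend_aux (L := R × R) Prod.snd Prod.fst
    (fun p => S.obj (r p.2) ⊗ (φ.obj (op (r p.1)) ⊗ 𝓗[V] (r p.2) (r p.1)))
    (fun s => S.obj (r s) ⊗ φ.obj (op (r s)))
    (fun p => S.obj (r p.2) ◁ act φ (op (r p.1)) (op (r p.2)))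
    (fun p => S.obj (r p.2) ◁ (β_ _ _).hom ≫ (α_ _ _ _).inv ≫
        act S (r p.2) (r p.1) ▷ φ.obj (op (r p.1)))
  obtain ⟨η, hη, hηr⟩ : ∃ η : ∀ k : Kᵒᵖ, φ.obj k ⟶ 𝓗[V] (S.obj k.unop) C,
      IsNaturalUnit φ S η ∧ ∀ s, η (op (r s)) = ecurry (π s) := by
    obtain ⟨η, hη, hηr⟩ := exists_extension_counit hr.op φ (opFunctor S) (L := op C)
      (fun s => ecurry (π s)) (fun s s' => by
        rw [star_op]
        refine euncurry_inj (A := S.obj (r s')) (B := C) ?_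
        refine (euncurry_comp _ _).trans (Eq.trans ?_ (euncurry_comp _ _).symm)
        refine (congrArg _ (euncurry_ecurry _)).trans ?_
        refine Eq.trans ?_ (congrArg _ (euncurry_star _ _).symm)
        rw [euncurry_ecurry (π s)]
        refine (hπ (s, s')).trans ?_
        simp only [Category.assoc]
        rfl)
    exact ⟨η, (isNaturalUnit_iff φ S η).2 hη, hηr⟩
  have hlc := isVNatural_limitComparison ((isNaturalUnit_iff φ S η).1 hη)
  refine ⟨C, η, hη, fun a => ⟨hlc a, fun X f hf => ?_⟩⟩
  induction a using Opposite.rec with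
  | op a =>
  -- the transposes of the components of `f`
  let h : ∀ k : Kᵒᵖ, φ.obj k ⊗ X ⟶ 𝓗[V] (S.obj k.unop) a := fun k =>
    euncurry (B := 𝓗[V] (S.obj k.unop) a) (f k)
  have hfh : f = fun k => ecurry (h k) := funext fun k => (ecurry_euncurry _).symm
  have hf0 := hf
  rw [hfh] at hf
  replace hf := (natural_op_iff φ S h).1 hf
  have key : ∀ {l : X ⟶ 𝓗[V] C a} (k : Kᵒᵖ),
      l ≫ limitComparison φ (opFunctor S) (L := op C) η (op a) k = f k ↔ star (η k) l = h k := by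
    intro l k
    rw [comp_limitComparison_op, hfh]
    exact ⟨fun e => by simpa only [euncurry_ecurry] using congrArg euncurry e,
      fun e => congrArg ecurry e⟩
  have key2 : ∀ {l : X ⟶ 𝓗[V] C a} (s : R), star (η (op (r s))) l = h (op (r s)) ↔
      π s ▷ X ≫ euncurry l = (α_ _ _ _).hom ≫ euncurry (h (op (r s))) := by
    intro l s
    have e : euncurry (star (η (op (r s))) l) = (α_ _ _ _).inv ≫ π s ▷ X ≫ euncurry l := by
      rw [hηr, euncurry_star, euncurry_ecurry]
    rw [← Iso.inv_comp_eq]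
    refine ⟨fun h' => by rw [← e, h'], fun h' => euncurry_inj ?_⟩
    rw [e]
    exact h'
  have hcond : ∀ s s', (S.obj (r s') ◁ act φ (op (r s)) (op (r s'))) ▷ X ≫
      (α_ _ _ _).hom ≫ euncurry (h (op (r s'))) =
      (S.obj (r s') ◁ (β_ _ _).hom ≫ (α_ _ _ _).inv ≫ act S (r s') (r s) ▷ φ.obj (op (r s))) ▷ X ≫
      (α_ _ _ _).hom ≫ euncurry (h (op (r s))) := by
    intro s s'
    have e := congrArg euncurry (hf (op (r s)) (op (r s')))
    rw [euncurry_comp, euncurry_comp, euncurry_comp, euncurry_star] at e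
    rw [associator_naturality_middle_assoc]
    refine (congrArg (fun t => (α_ _ _ _).hom ≫ t) e).trans ?_
    change (α_ _ _ _).hom ≫ S.obj (r s') ◁ _ ▷ X ≫ S.obj (r s') ◁ (α_ _ _ _).hom ≫
      (α_ _ _ _).inv ≫ act S (r s') (r s) ▷ (φ.obj (op (r s)) ⊗ X) ≫ _ = _
    simp
    rfl
  have hcurry : ∀ {Y Y' : V} (p : Y ⟶ Y') (q : Y' ⊗ X ⟶ a),
      p ≫ ecurry ((β_ X Y').hom ≫ q) = ecurry ((β_ X Y).hom ≫ p ▷ X ≫ q) := by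
    intro Y Y' p q
    rw [comp_ecurry, braiding_naturality_right_assoc]
  obtain ⟨d, hd⟩ := hdesc _ (fun s => ecurry ((β_ X _).hom ≫
    (α_ _ _ _).hom ≫ euncurry (h (op (r s))))) (fun p => by
      rw [hcurry, hcurry]
      exact congrArg (fun t => ecurry ((β_ _ _).hom ≫ t)) (hcond p.1 p.2))
  have hd' : ∀ s, π s ▷ X ≫ (β_ C X).hom ≫ euncurry d =
      (α_ _ _ _).hom ≫ euncurry (h (op (r s))) := by
    intro s
    rw [braiding_naturality_left_assoc, ← euncurry_comp, hd, euncurry_ecurry,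
      SymmetricCategory.symmetry_assoc]
  refine ⟨ecurry ((β_ C X).hom ≫ euncurry d), ?_, ?_⟩
  · refine ext_of_rep hr.op ((hlc (op a)).comp _) hf0 fun s => ?_
    refine (key (op (r s))).2 ((key2 s).2 ?_)
    rw [euncurry_ecurry, hd']
  · intro l hl
    have hT : ecurry ((β_ X C).hom ≫ euncurry l) = d := hext _ _ _ fun s => by
      rw [hcurry, (key2 s).1 ((key _).1 (hl _)), hd]
    rw [← hT, euncurry_ecurry, SymmetricCategory.symmetry_assoc]
    exact (ecurry_euncurry _).symm

end ColimitsInBase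

/-! ### The functor `φ * - : [K, V] ⟶ V` -/

section ColimitFunctor

variable {V : Type u} [Category.{v} V] [MonoidalCategory V] [SymmetricCategory V]
  [MonoidalClosed V] [HasColimits V]
variable {K : Type w} [EnrichedCategory V K] [IsSmall V K]

/-- The object `φ * S` of `V`. -/
def colimObj (φ : EnrichedFunctor V Kᵒᵖ V) (S : EnrichedFunctor V K V) : V :=
  (exists_isWeightedColimit φ S).choose

/-- The unit of the colimit `φ * S`. -/
def colimUnit (φ : EnrichedFunctor V Kᵒᵖ V) (S : EnrichedFunctor V K V) (k : Kᵒᵖ) :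
    φ.obj k ⟶ 𝓗[V] (S.obj k.unop) (colimObj φ S) :=
  (exists_isWeightedColimit φ S).choose_spec.choose k

theorem isNaturalUnit_colimUnit (φ : EnrichedFunctor V Kᵒᵖ V) (S : EnrichedFunctor V K V) :
    IsNaturalUnit φ S (colimUnit φ S) :=
  (exists_isWeightedColimit φ S).choose_spec.choose_spec.1

theorem isWeightedColimit_colimUnit (φ : EnrichedFunctor V Kᵒᵖ V) (S : EnrichedFunctor V K V) :
    IsWeightedColimit φ S (colimObj φ S) (colimUnit φ S) :=
  (exists_isWeightedColimit φ S).choose_spec.choose_spec.2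

theorem colim_hom_ext {φ : EnrichedFunctor V Kᵒᵖ V} {S : EnrichedFunctor V K V} {X a : V}
    {p q : X ⟶ 𝓗[V] (colimObj φ S) a}
    (h : ∀ k, star (colimUnit φ S k) p = star (colimUnit φ S k) q) : p = q :=
  (isWeightedColimit_colimUnit φ S (op a)).hom_ext fun k => by
    refine (comp_limitComparison_op φ S _ p k).trans ?_
    rw [h k]
    exact (comp_limitComparison_op φ S _ q k).symm

variable [HasLimits V]

theorem exists_colimMap (φ : EnrichedFunctor V Kᵒᵖ V) (F G : EnrichedFunctor V K V) :
    ∃ m : 𝓗[V] F G ⟶ 𝓗[V] (colimObj φ F) (colimObj φ G), ∀ k : Kᵒᵖ,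
      star (colimUnit φ F k) m =
        (β_ (φ.obj k) (𝓗[V] F G)).hom ≫ star (natProj F G k.unop) (colimUnit φ G k) := by
  obtain ⟨m, hm, -⟩ := (isWeightedColimit_colimUnit φ F (op (colimObj φ G))).2 _ _
    (isVNatural_comp_unit (isNaturalUnit_colimUnit φ G) (isNatObj_natProj F G).1)
  refine ⟨m, fun k => ?_⟩
  have := (comp_limitComparison_op φ F _ m k).symm.trans (hm k)
  have h2 := congrArg euncurry this
  rw [euncurry_ecurry] at h2
  exact h2.trans (euncurry_ecurry _)

/-- The effect `[K, V](F, G) ⟶ [φ * F, φ * G]` of `φ * -` on hom-objects: the morphism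
compatible with the units of the two colimits. -/
def colimMap (φ : EnrichedFunctor V Kᵒᵖ V) (F G : EnrichedFunctor V K V) :
    𝓗[V] F G ⟶ 𝓗[V] (colimObj φ F) (colimObj φ G) := (exists_colimMap φ F G).choose

theorem star_colimMap (φ : EnrichedFunctor V Kᵒᵖ V) (F G : EnrichedFunctor V K V) (k : Kᵒᵖ) :
    star (colimUnit φ F k) (colimMap φ F G) =
      (β_ (φ.obj k) (𝓗[V] F G)).hom ≫ star (natProj F G k.unop) (colimUnit φ G k) :=
  (exists_colimMap φ F G).choose_spec k

/-- The `V`-functor `φ * - : [K, V] ⟶ V`. -/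
def colimFunctor (φ : EnrichedFunctor V Kᵒᵖ V) :
    EnrichedFunctor V (EnrichedFunctor V K V) V where
  obj S := colimObj φ S
  map F G := colimMap φ F G
  map_id F := colim_hom_ext fun k => by
    have h1 := post_id (colimUnit φ F k)
    have h2 := pre_id (colimUnit φ F k)
    rw [post, Iso.inv_comp_eq] at h1
    rw [pre, Iso.inv_comp_eq] at h2
    rw [star_comp, star_colimMap, braiding_naturality_right_assoc, ← comp_star,
      functorCategory_id_proj, h1, h2, braiding_tensorUnit_right]
    simp
  map_comp F G H := colim_hom_ext fun k => by
    change _ = star _ (star (colimMap φ F G) (colimMap φ G H))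
    have h : eComp V F G H ≫ natProj F H k.unop =
        star (natProj F G k.unop) (natProj G H k.unop) :=
      natLift_proj _ ((isNatObj_natProj F G).1.star (isNatObj_natProj G H).1) _
    rw [star_comp, star_colimMap, braiding_naturality_right_assoc, ← comp_star, h,
      star_star, star_colimMap, comp_star, star_star' _ (colimUnit φ G k), star_colimMap,
      star_comp, star_star _ (natProj G H k.unop)]
    simp only [braiding_tensor_right_hom, Category.assoc]
    rfl

end ColimitFunctor

/-! ### The Yoneda embedding -/

section Yoneda

variable {V : Type u} [Category.{v} V] [MonoidalCategory V] [SymmetricCategory V]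
  [MonoidalClosed V]
variable {B : Type w} [EnrichedCategory V B]

/-- Precomposition `B(b', b) ⟶ [B(b, c), B(b', c)]`. -/
def precomp (b b' c : B) : 𝓗[V] b' b ⟶ 𝓗[V] (𝓗[V] b c) (𝓗[V] b' c) :=
  ecurry ((β_ (𝓗[V] b c) (𝓗[V] b' b)).hom ≫ eComp V b' b c)

theorem isVNatural_precomp (b b' : B) :
    IsVNatural (representable V b) (representable V b') (precomp b b') := by
  intro c c'
  have h0 : act (representable V b) c c' = eComp V b c c' := euncurry_ecurry _
  have h1 : ∀ x y z : B, eComp V x y z = star (𝟙 (𝓗[V] x y)) (𝟙 (𝓗[V] y z)) := fun x y z => by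
    simp [star]
  have h := natural_limitComparison (φ := representable V b) (T := EnrichedFunctor.id V B)
    (L := b) (j := c) (j' := c') (μ := 𝟙 _) (μ' := 𝟙 _)
    (by rw [h0]; exact (Category.comp_id _).trans (h1 _ _ _)) b'
  simp only [precomp, h1 b' b]
  refine h.trans ?_
  exact congrArg (star (V := V) _) (Category.id_comp _)

theorem eId_precomp (b c : B) : eId V b ≫ precomp b b c = eId V (𝓗[V] b c) := by
  refine euncurry_inj ?_
  rw [precomp, euncurry_comp, euncurry_ecurry, euncurry_eId, braiding_naturality_right_assoc]
  have h := e_id_comp V b c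
  rw [Iso.inv_comp_eq, Category.comp_id] at h
  rw [h, braiding_tensorUnit_right]
  simp

theorem eComp_precomp (b b' b'' c : B) :
    ((β_ (𝓗[V] b' b) (𝓗[V] b'' b')).hom ≫ eComp V b'' b' b) ≫ precomp b b'' c =
      star (precomp b b' c) (precomp b' b'' c) := by
  refine euncurry_inj ?_
  rw [precomp, precomp, precomp, euncurry_comp, euncurry_star, euncurry_ecurry, euncurry_ecurry,
    euncurry_ecurry, MonoidalCategory.whiskerLeft_comp_assoc, braiding_naturality_right_assoc,
    ← e_assoc', comp_whiskerRight_assoc, braiding_naturality_left_assoc]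
  simp only [braiding_tensor_left_hom, braiding_tensor_right_hom, Category.assoc,
    Iso.inv_hom_id_assoc]
  exact yang_baxter_aux _

variable [HasLimits V]

/-- The Yoneda embedding `Y' : Bᵒᵖ ⟶ [B, V]`, sending `b` to `B(b, -)`, and acting on
hom-objects by precomposition. -/
def yonedaEmbedding (B : Type w) [EnrichedCategory V B] [IsSmall V B] :
    EnrichedFunctor V Bᵒᵖ (EnrichedFunctor V B V) where
  obj b := representable V b.unop
  map b b' := natLift (precomp b.unop b'.unop) (isVNatural_precomp b.unop b'.unop)
  map_id b := natObj_hom_ext fun c => by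
    rw [functorCategory_id_proj, Category.assoc, natLift_proj]
    exact eId_precomp b.unop c
  map_comp b b' b'' := natObj_hom_ext fun c => by
    refine Eq.trans ?_ (functorCategory_star_proj _ _ c).symm
    rw [natLift_proj, natLift_proj, Category.assoc, natLift_proj]
    exact eComp_precomp b.unop b'.unop b''.unop c

end Yoneda

/-! ### Weights, classes of weights, and small projectives -/

section Classes

/-- A weight: a `V`-functor `Kᵒᵖ ⟶ V` with small domain. The objects of `K` lie in an
arbitrary universe containing the universe `v` of small sets. -/
structure Weight (V : Type u) [Category.{v} V] [MonoidalCategory V] [SymmetricCategory V]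
    [MonoidalClosed V] where
  /-- The `V`-category whose opposite is the domain of the weight. -/
  K : Type (max v w)
  [enriched : EnrichedCategory V K]
  [small : IsSmall V K]
  /-- The underlying presheaf. -/
  functor : EnrichedFunctor V Kᵒᵖ V

attribute [instance] Weight.enriched Weight.small

variable {V : Type u} [Category.{v} V] [MonoidalCategory V] [SymmetricCategory V]
  [MonoidalClosed V]
variable {A : Type*} [EnrichedCategory V A] {B : Type*} [EnrichedCategory V B]

/-- A `V`-functor is continuous when it preserves all (small) weighted limits. -/
def IsContinuous (P : EnrichedFunctor V A B) : Prop :=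
  ∀ (ψ : Weight.{w} V) (T : EnrichedFunctor V ψ.Kᵒᵖ A), PreservesWeightedLimit P ψ.functor T

/-- A `V`-functor is cocontinuous when it preserves all (small) weighted colimits. -/
def IsCocontinuous (P : EnrichedFunctor V A B) : Prop :=
  ∀ (ψ : Weight.{w} V) (S : EnrichedFunctor V ψ.K A), PreservesWeightedColimit P ψ.functor S

/-- There is a `V`-natural isomorphism between the `V`-functors `F` and `G` to `V`: a family of
isomorphisms `F x ≅ G x` compatible with the actions of the hom-objects. -/
def AreIsomorphic (F G : EnrichedFunctor V A V) : Prop :=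
  ∃ e : ∀ x, F.obj x ≅ G.obj x, ∀ x y : A,
    act F x y ≫ (e y).hom = (e x).hom ▷ 𝓗[V] x y ≫ act G x y

/-- A `V`-functor to `V` is representable when it is `V`-naturally isomorphic to some
`A(a, -)`. -/
def IsRepresentable (P : EnrichedFunctor V A V) : Prop :=
  ∃ a : A, AreIsomorphic P (representable V a)

variable [HasLimits V]

/-- `φ` is a small projective: the representable functor
`{φ, -} = [Kᵒᵖ, V](φ, -) : [Kᵒᵖ, V] ⟶ V` is cocontinuous. -/
def IsSmallProjective {K : Type (max v w)} [EnrichedCategory V K] [IsSmall V K]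
    (φ : EnrichedFunctor V Kᵒᵖ V) : Prop :=
  IsCocontinuous.{w} (representable V φ)

variable [HasColimits V]

/-- `φ`-colimits commute with `ψ`-limits in `V`: for `φ : Lᵒᵖ ⟶ V`, the functor
`φ * - : [L, V] ⟶ V` preserves `ψ`-limits. -/
def ColimitsCommuteWithLimits (φ ψ : Weight.{w} V) : Prop :=
  ∀ T : EnrichedFunctor V ψ.Kᵒᵖ (EnrichedFunctor V φ.K V),
    PreservesWeightedLimit (colimFunctor φ.functor) ψ.functor T

/-- The class `Ψ⁺` of `Ψ`-flat weights: those `φ` for which `φ`-colimits commute in `V` with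
`Ψ`-limits. -/
def flatWeights (Ψ : Set (Weight.{w} V)) : Set (Weight.{w} V) :=
  {φ | ∀ ψ ∈ Ψ, ColimitsCommuteWithLimits φ ψ}

/-- The class `Φ⁻` of `Φ`-atomic weights: those `ψ` for which `Φ`-colimits commute in `V` with
`ψ`-limits. -/
def atomicWeights (Φ : Set (Weight.{w} V)) : Set (Weight.{w} V) :=
  {ψ | ∀ φ ∈ Φ, ColimitsCommuteWithLimits φ ψ}

/-- The class of all weights. -/
def allWeights (V : Type u) [Category.{v} V] [MonoidalCategory V] [SymmetricCategory V]
    [MonoidalClosed V] : Set (Weight.{w} V) := Set.univ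

/-- The class of small projective weights. -/
def smallProjectiveWeights (V : Type u) [Category.{v} V] [MonoidalCategory V]
    [SymmetricCategory V] [MonoidalClosed V] [HasLimits V] : Set (Weight.{w} V) :=
  {φ | IsSmallProjective.{w} φ.functor}

end Classes

end

end EnrichedWeights

open EnrichedWeights

namespace EnrichedWeights

noncomputable section

/-! ### Actions of hom-objects, without braidings -/

section Actions

variable {V : Type u} [Category.{v} V] [MonoidalCategory V] [MonoidalClosed V]
variable {K : Type*} [EnrichedCategory V K]

/-! The four conditions are all equivalent to the existence of a dual basis, as for finitely
generated projective modules. Let φ^ be the dual of φ, with φ^ c = [Bᵒᵖ, V](φ, B(-, c)) (`dual`). It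
pairs with φ by φ b ⊗ φ^ c ⟶ B(b, c), and contracting gives `dualEval` : φ b ⊗ (φ * φ^) ⟶ φ b, the
transposed form of the canonical map φ * φ^ ⟶ [Bᵒᵖ, V](φ, φ). A dual basis is an element η of φ * φ^
over the identity of φ; informally η = Σ ξᵢ ⊗ uᵢ with u = Σ ξᵢ(u) uᵢ for all u in φ.

From η one gets everything. Colimits weighted by φ are absolute (`IsDualBasis.isUniversalUnit_map`),
because the identity of φ * S factors through η; by passage to opposites, every functor preserves
φ-weighted limits. Also φ * F ≅ [B, V](φ^, F), with inverse given by acting on η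
(`IsDualBasis.isRepresentable`). Finally [Bᵒᵖ, V](φ, -) has the right adjoint a ↦ [φ^ -, a]
(`IsDualBasis.exists_rightAdjoint`), so φ is a small projective.

Conversely, φ is the colimit φ * Y of representables (`isUniversalUnit_yonedaHom`). If [Bᵒᵖ, V](φ,
-) preserves it, then [Bᵒᵖ, V](φ, φ) ≅ φ * φ^, and the identity of φ yields η
(`exists_isDualBasis`). Dually, φ^ is the limit {φ, Y'} (`isWeightedLimit_dual`). If φ * - preserves
it, then φ * φ^ is the limit of b ↦ φ * B(b, -) ≅ φ b weighted by φ, and the natural family φ b ⟶ φ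
* B(b, -) lifts to η (`exists_isDualBasis_of_isWeightedLimit`).

Representable functors are continuous, which closes the cycle. The equality with the atomic weights
is absoluteness in one direction and condition (iv) in the other; the equality with the flat weights
is condition (iii). -/

theorem act_id (F : EnrichedFunctor V K V) (a : K) :
    F.obj a ◁ eId V a ≫ act F a a = (ρ_ _).hom := by
  rw [act, ← euncurry_comp, F.map_id, euncurry_eId]

theorem act_comp (F : EnrichedFunctor V K V) (a b c : K) :
    F.obj a ◁ eComp V a b c ≫ act F a c =
      (α_ _ _ _).inv ≫ act F a b ▷ 𝓗[V] b c ≫ act F b c := by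
  rw [act, ← euncurry_comp, F.map_comp]
  exact euncurry_star _ _

variable [SymmetricCategory V]

/-- The left action `K(b, c) ⊗ φ c ⟶ φ b` of a presheaf. -/
def lact (φ : EnrichedFunctor V Kᵒᵖ V) (b c : K) :
    𝓗[V] b c ⊗ φ.obj (op c) ⟶ φ.obj (op b) :=
  (β_ _ _).hom ≫ act φ (op c) (op b)

theorem lact_id (φ : EnrichedFunctor V Kᵒᵖ V) (a : K) :
    eId V a ▷ φ.obj (op a) ≫ lact φ a a = (λ_ _).hom := by
  rw [lact, braiding_naturality_left_assoc]
  have := act_id φ (op a)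
  erw [this]
  simp

/-- Composition in the opposite category carries a braiding. It cancels those in the definition of
`lact`, leaving an associative left action in which no factors are exchanged. -/
theorem lact_comp (φ : EnrichedFunctor V Kᵒᵖ V) (a b c : K) :
    eComp V a b c ▷ φ.obj (op c) ≫ lact φ a c =
      (α_ _ _ _).hom ≫ 𝓗[V] a b ◁ lact φ b c ≫ lact φ a b := by
  have h := act_comp φ (op c) (op b) (op a)
  rw [eComp_op_eq] at h
  have h' := congrArg (fun t => (β_ (𝓗[V] a b ⊗ 𝓗[V] b c) (φ.obj (op c))).hom ≫
    φ.obj (op c) ◁ (β_ (𝓗[V] a b) (𝓗[V] b c)).hom ≫ t) h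
  simp only [MonoidalCategory.whiskerLeft_comp, Category.assoc] at h'
  erw [whiskerLeft_symmetry_aux, ← braiding_naturality_left_assoc] at h'
  refine h'.trans ?_
  simp only [lact, MonoidalCategory.whiskerLeft_comp, Category.assoc,
    braiding_naturality_right_assoc, braiding_tensor_left_hom, braiding_tensor_right_hom]
  rfl

/-! ### Natural families, without braidings -/

/-- Naturality of a family `φ b ⊗ X ⟶ G b`, for presheaves `φ` and `G`. -/
def IsLeftNatural (φ G : EnrichedFunctor V Kᵒᵖ V) {X : V}
    (f : ∀ b : K, φ.obj (op b) ⊗ X ⟶ G.obj (op b)) : Prop :=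
  ∀ b c : K, lact φ b c ▷ X ≫ f b = (α_ _ _ _).hom ≫ 𝓗[V] b c ◁ f c ≫ lact G b c

/-- Naturality of a family `X ⊗ F b ⟶ G b`, for copresheaves `F` and `G`. -/
def IsRightNatural (F G : EnrichedFunctor V K V) {X : V}
    (f : ∀ b : K, X ⊗ F.obj b ⟶ G.obj b) : Prop :=
  ∀ b c : K, (α_ _ _ _).hom ≫ X ◁ act F b c ≫ f c = f b ▷ 𝓗[V] b c ≫ act G b c

theorem isVNatural_iff_act (F G : EnrichedFunctor V K V) {X : V}
    (f : ∀ b, F.obj b ⊗ X ⟶ G.obj b) :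
    IsVNatural F G (fun b => ecurry (f b)) ↔ ∀ b c,
      F.obj b ◁ (β_ X (𝓗[V] b c)).hom ≫ (α_ _ _ _).inv ≫ act F b c ▷ X ≫ f c =
        (α_ _ _ _).inv ≫ f b ▷ _ ≫ act G b c := by
  refine forall₂_congr fun b c => ?_
  rw [← Function.Injective.eq_iff (f := euncurry (V := V)) (fun _ _ h => euncurry_inj h),
    euncurry_comp, euncurry_star, euncurry_star, euncurry_ecurry, euncurry_ecurry]
  rfl

/-- With X to the left of F b and the hom-object to the right, the two never have to cross, and a
hexagon absorbs the braiding in `IsVNatural`. -/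
theorem isRightNatural_iff (F G : EnrichedFunctor V K V) {X : V}
    (f : ∀ b, X ⊗ F.obj b ⟶ G.obj b) :
    IsVNatural F G (fun b => ecurry ((β_ _ _).hom ≫ f b)) ↔ IsRightNatural F G f := by
  refine (isVNatural_iff_act F G _).trans (forall₂_congr fun b c => ?_)
  rw [braiding_naturality_left_assoc, comp_whiskerRight_assoc]
  have key : F.obj b ◁ (β_ X (𝓗[V] b c)).hom ≫ (α_ _ _ _).inv ≫ (β_ (F.obj b ⊗ 𝓗[V] b c) X).hom =
      (α_ _ _ _).inv ≫ (β_ _ _).hom ▷ _ ≫ (α_ X (F.obj b) (𝓗[V] b c)).hom := by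
    rw [Iso.eq_inv_comp, hexagon_aux]
  have key' := congrArg (fun t => t ≫ X ◁ act F b c ≫ f c) key
  simp only [Category.assoc] at key'
  rw [key', Iso.cancel_iso_inv_left]
  rw [cancel_epi]

/-- The mirror image of `isRightNatural_iff`: for presheaves the hom-object acts on the left, so X
is kept on the right. -/
theorem isLeftNatural_iff (F G : EnrichedFunctor V Kᵒᵖ V) {X : V}
    (f : ∀ b : K, F.obj (op b) ⊗ X ⟶ G.obj (op b)) :
    IsVNatural F G (fun b => ecurry (f b.unop)) ↔ IsLeftNatural F G f := by
  refine (isVNatural_iff_act F G (fun b => f b.unop)).trans ?_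
  have key : ∀ c b : K, F.obj (op c) ◁ (β_ X (𝓗[V] b c)).hom ≫ (α_ _ _ _).inv ≫
        act F (op c) (op b) ▷ X ≫ f b =
          (α_ _ _ _).inv ≫ f c ▷ 𝓗[V] b c ≫ act G (op c) (op b) ↔
      lact F b c ▷ X ≫ f b = (α_ _ _ _).hom ≫ 𝓗[V] b c ◁ f c ≫ lact G b c := by
    intro c b
    rw [lact, lact, braiding_naturality_right_assoc, comp_whiskerRight_assoc]
    rw [← cancel_epi ((α_ _ _ _).hom ≫ (β_ (𝓗[V] b c) (F.obj (op c) ⊗ X)).hom ≫ (α_ _ _ _).hom)]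
    simp only [braiding_tensor_right_hom, Category.assoc, Iso.hom_inv_id_assoc,
      Iso.inv_hom_id_assoc]
    erw [whiskerLeft_symmetry_aux, Iso.hom_inv_id_assoc]
  exact ⟨fun h b c => (key c b).1 (h (op c) (op b)), fun h b c => (key b.unop c.unop).2 (h _ _)⟩

/-! ### Evaluation of natural transformations -/

section Evaluation

variable {K : Type w} [EnrichedCategory V K] [IsSmall V K] [HasLimits V]

/-- Evaluation `φ b ⊗ [Kᵒᵖ, V](φ, G) ⟶ G b` at `b` of transformations of presheaves. -/
def evLeft (φ G : EnrichedFunctor V Kᵒᵖ V) (b : K) :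
    φ.obj (op b) ⊗ 𝓗[V] φ G ⟶ G.obj (op b) := euncurry (natProj φ G (op b))

theorem isLeftNatural_evLeft (φ G : EnrichedFunctor V Kᵒᵖ V) :
    IsLeftNatural φ G (evLeft φ G) := by
  refine (isLeftNatural_iff φ G (evLeft φ G)).1 ?_
  simp only [evLeft, ecurry_euncurry]
  exact (isNatObj_natProj φ G).1

theorem exists_evLeft {φ G : EnrichedFunctor V Kᵒᵖ V} {X : V}
    {f : ∀ b : K, φ.obj (op b) ⊗ X ⟶ G.obj (op b)} (hf : IsLeftNatural φ G f) :
    ∃ l : X ⟶ 𝓗[V] φ G, ∀ b, φ.obj (op b) ◁ l ≫ evLeft φ G b = f b := by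
  refine ⟨natLift _ ((isLeftNatural_iff φ G f).2 hf), fun b => ?_⟩
  rw [evLeft, ← euncurry_comp, natLift_proj, euncurry_ecurry]

theorem evLeft_hom_ext {φ G : EnrichedFunctor V Kᵒᵖ V} {X : V} {p q : X ⟶ 𝓗[V] φ G}
    (h : ∀ b, φ.obj (op b) ◁ p ≫ evLeft φ G b = φ.obj (op b) ◁ q ≫ evLeft φ G b) : p = q :=
  natObj_hom_ext fun b => euncurry_inj (by
    rw [euncurry_comp, euncurry_comp]
    exact h b.unop)

theorem evLeft_id (φ : EnrichedFunctor V Kᵒᵖ V) (b : K) :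
    φ.obj (op b) ◁ eId V φ ≫ evLeft φ φ b = (ρ_ _).hom := by
  rw [evLeft, ← euncurry_comp, functorCategory_id_proj, euncurry_eId]

theorem evLeft_star {F G H : EnrichedFunctor V Kᵒᵖ V} {X Y : V} (f : X ⟶ 𝓗[V] F G)
    (g : Y ⟶ 𝓗[V] G H) (b : K) :
    F.obj (op b) ◁ star f g ≫ evLeft F H b =
      (α_ _ _ _).inv ≫ (F.obj (op b) ◁ f ≫ evLeft F G b) ▷ Y ≫
        G.obj (op b) ◁ g ≫ evLeft G H b := by
  rw [evLeft, evLeft, evLeft, ← euncurry_comp, functorCategory_star_proj, euncurry_star,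
    euncurry_comp, euncurry_comp]

/-- Evaluation `[K, V](F, G) ⊗ F b ⟶ G b` at `b` of transformations of copresheaves. -/
def evRight (F G : EnrichedFunctor V K V) (b : K) :
    𝓗[V] F G ⊗ F.obj b ⟶ G.obj b := (β_ _ _).hom ≫ euncurry (natProj F G b)

theorem ecurry_braid_evRight (F G : EnrichedFunctor V K V) (b : K) :
    ecurry ((β_ _ _).hom ≫ evRight F G b) = natProj F G b := by
  rw [evRight, SymmetricCategory.symmetry_assoc]
  exact ecurry_euncurry _

theorem whiskerRight_evRight {F G : EnrichedFunctor V K V} {X : V} (l : X ⟶ 𝓗[V] F G) (b : K) :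
    l ▷ F.obj b ≫ evRight F G b = (β_ _ _).hom ≫ euncurry (l ≫ natProj F G b) := by
  rw [evRight, braiding_naturality_left_assoc, euncurry_comp]

theorem isRightNatural_evRight (F G : EnrichedFunctor V K V) :
    IsRightNatural F G (evRight F G) := by
  refine (isRightNatural_iff F G (evRight F G)).1 ?_
  simp only [ecurry_braid_evRight]
  exact (isNatObj_natProj F G).1

theorem exists_evRight {F G : EnrichedFunctor V K V} {X : V}
    {f : ∀ b, X ⊗ F.obj b ⟶ G.obj b} (hf : IsRightNatural F G f) :
    ∃ l : X ⟶ 𝓗[V] F G, ∀ b, l ▷ F.obj b ≫ evRight F G b = f b := by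
  refine ⟨natLift _ ((isRightNatural_iff F G f).2 hf), fun b => ?_⟩
  rw [whiskerRight_evRight, natLift_proj, euncurry_ecurry, SymmetricCategory.symmetry_assoc]

theorem evRight_hom_ext {F G : EnrichedFunctor V K V} {X : V} {p q : X ⟶ 𝓗[V] F G}
    (h : ∀ b, p ▷ F.obj b ≫ evRight F G b = q ▷ F.obj b ≫ evRight F G b) : p = q :=
  natObj_hom_ext fun b => euncurry_inj (by
    have := h b
    rwa [whiskerRight_evRight, whiskerRight_evRight, cancel_epi] at this)

/-- Evaluation of a composite, written in the order of application. -/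
theorem evRight_star {F G H : EnrichedFunctor V K V} {X Y : V} (f : X ⟶ 𝓗[V] F G)
    (g : Y ⟶ 𝓗[V] G H) (b : K) :
    ((β_ Y X).hom ≫ star f g) ▷ F.obj b ≫ evRight F H b =
      (α_ _ _ _).hom ≫ Y ◁ (f ▷ F.obj b ≫ evRight F G b) ≫ g ▷ G.obj b ≫ evRight G H b := by
  rw [whiskerRight_evRight, whiskerRight_evRight, whiskerRight_evRight, Category.assoc,
    functorCategory_star_proj, euncurry_comp, euncurry_star, braiding_naturality_right_assoc,
    comp_whiskerRight_assoc, ← braiding_naturality_right_assoc]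
  simp only [braiding_tensor_left_hom, braiding_tensor_right_hom, Category.assoc]

end Evaluation

end Actions

/-! ### Universal units -/

section UniversalUnits

variable {V : Type u} [Category.{v} V] [MonoidalCategory V] [SymmetricCategory V]
  [MonoidalClosed V]
variable {K : Type*} [EnrichedCategory V K] {A : Type*} [EnrichedCategory V A]

/-- The condition that `C` with the unit `μ b : φ b ⟶ A(S b, C)` is the colimit `φ * S`,
stated without braidings. -/
def IsUniversalUnit (φ : EnrichedFunctor V Kᵒᵖ V) (S : EnrichedFunctor V K A) (C : A)
    (μ : ∀ b : K, φ.obj (op b) ⟶ 𝓗[V] (S.obj b) C) : Prop :=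
  (∀ b c, lact φ b c ≫ μ b = star (S.map b c) (μ c)) ∧
  ∀ (a : A) (X : V) (f : ∀ b, φ.obj (op b) ⊗ X ⟶ 𝓗[V] (S.obj b) a),
    (∀ b c, lact φ b c ▷ X ≫ f b = (α_ _ _ _).hom ≫ star (S.map b c) (f c)) →
    ∃! l : X ⟶ 𝓗[V] C a, ∀ b, star (μ b) l = f b

theorem IsUniversalUnit.hom_ext {φ : EnrichedFunctor V Kᵒᵖ V} {S : EnrichedFunctor V K A} {C : A}
    {μ : ∀ b : K, φ.obj (op b) ⟶ 𝓗[V] (S.obj b) C} (h : IsUniversalUnit φ S C μ) {a : A} {X : V}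
    {p q : X ⟶ 𝓗[V] C a} (hpq : ∀ b, star (μ b) p = star (μ b) q) : p = q := by
  refine (h.2 a X (fun b => star (μ b) q) fun b c => ?_).unique hpq fun _ => rfl
  rw [← comp_star, h.1, star_star']

theorem lact_homFunctor (T : EnrichedFunctor V Kᵒᵖ A) (a : A) (b c : K) {X : V}
    (f : X ⟶ 𝓗[V] a (T.obj (op c))) :
    𝓗[V] b c ◁ f ≫ lact (homFunctor a T) b c =
      (β_ (𝓗[V] b c) X).hom ≫ star f (T.map (op c) (op b)) := by
  have h : act (homFunctor a T) (op c) (op b) = star (𝟙 _) (T.map (op c) (op b)) :=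
    euncurry_comp_representable (T.map (op c) (op b))
  rw [lact, h, braiding_naturality_right_assoc]
  refine congrArg _ ?_
  refine (comp_star f (𝟙 _) (T.map (op c) (op b))).symm.trans ?_
  rw [Category.comp_id]

theorem comp_limitComparison {J : Type*} [EnrichedCategory V J] (φ : EnrichedFunctor V J V)
    (T : EnrichedFunctor V J A) {L : A} (μ : ∀ j, φ.obj j ⟶ 𝓗[V] L (T.obj j)) {a : A} {X : V}
    (l : X ⟶ 𝓗[V] a L) (j : J) :
    l ≫ limitComparison φ T μ a j = ecurry ((β_ _ _).hom ≫ star l (μ j)) := by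
  refine (comp_ecurry _ _).trans (congrArg ecurry ?_)
  rw [braiding_naturality_right_assoc, ← comp_star, Category.comp_id]

/-- The counit is what the comparison at `a = L` makes of the identity of L, so it inherits the
naturality of that comparison. -/
theorem IsWeightedLimit.isNaturalCounit {J : Type*} [EnrichedCategory V J]
    {φ : EnrichedFunctor V J V} {T : EnrichedFunctor V J A} {L : A}
    {μ : ∀ j, φ.obj j ⟶ 𝓗[V] L (T.obj j)} (h : IsWeightedLimit φ T L μ) :
    IsNaturalCounit φ T μ := by
  have h1 := (h L).1.comp (eId V L)
  simp only [comp_limitComparison] at h1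
  convert isNaturalCounit_of _ h1 using 2 with j
  rw [rightUnitor_inv_braiding_assoc]
  exact (pre_id (μ j)).symm

/-- This transposes the universal property into generalised elements, the common form from which
both limits and colimits are reduced to `IsUniversalUnit`. -/
theorem isWeightedLimit_iff (φ : EnrichedFunctor V Kᵒᵖ V) (T : EnrichedFunctor V Kᵒᵖ A) (L : A)
    (μ : ∀ j, φ.obj j ⟶ 𝓗[V] L (T.obj j)) :
    IsWeightedLimit φ T L μ ↔
      (∀ b c : K, lact φ b c ≫ μ (op b) = (β_ _ _).hom ≫ star (μ (op c)) (T.map (op c) (op b))) ∧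
      ∀ (a : A) (X : V) (f : ∀ b : K, φ.obj (op b) ⊗ X ⟶ 𝓗[V] a (T.obj (op b))),
        (∀ b c, lact φ b c ▷ X ≫ f b =
          (α_ _ _ _).hom ≫ (β_ (𝓗[V] b c) _).hom ≫ star (f c) (T.map (op c) (op b))) →
        ∃! l : X ⟶ 𝓗[V] a L, ∀ b, (β_ _ _).hom ≫ star l (μ (op b)) = f b := by
  have hnat : ∀ (a : A) (X : V) (f : ∀ b : K, φ.obj (op b) ⊗ X ⟶ 𝓗[V] a (T.obj (op b))),
      IsVNatural φ (homFunctor a T) (fun b => ecurry (f b.unop)) ↔ ∀ b c, lact φ b c ▷ X ≫ f b =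
          (α_ _ _ _).hom ≫ (β_ (𝓗[V] b c) _).hom ≫ star (f c) (T.map (op c) (op b)) := by
    intro a X f
    refine (isLeftNatural_iff φ (homFunctor a T) f).trans (forall₂_congr fun b c => ?_)
    rw [lact_homFunctor]
  have hcounit : IsNaturalCounit φ T μ ↔ ∀ b c : K,
      lact φ b c ≫ μ (op b) = (β_ _ _).hom ≫ star (μ (op c)) (T.map (op c) (op b)) := by
    have : ∀ b c : K, lact φ b c ≫ μ (op b) = (β_ (𝓗[V] b c) (φ.obj (op c))).hom ≫
        star (μ (op c)) (T.map (op c) (op b)) ↔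
          act φ (op c) (op b) ≫ μ (op b) = star (μ (op c)) (T.map (op c) (op b)) := by
      intro b c
      rw [lact, Category.assoc, cancel_epi]
    exact ⟨fun h b c => (this b c).2 (h (op c) (op b)),
      fun h b c => (this c.unop b.unop).1 (h c.unop b.unop)⟩
  rw [← hcounit]
  have hcomp : ∀ {a : A} {X : V} {l : X ⟶ 𝓗[V] a L}
      {f : ∀ b : K, φ.obj (op b) ⊗ X ⟶ 𝓗[V] a (T.obj (op b))},
      (∀ j, l ≫ limitComparison φ T μ a j = ecurry (f j.unop)) ↔
        ∀ b : K, (β_ _ _).hom ≫ star l (μ (op b)) = f b := by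
    intro a X l f
    simp only [comp_limitComparison]
    exact ⟨fun h b => by simpa using congrArg euncurry (h (op b)),
      fun h b => congrArg ecurry (h b.unop)⟩
  constructor
  · refine fun h => ⟨h.isNaturalCounit, fun a X f hf => ?_⟩
    have := (h a).2 X _ ((hnat a X f).2 hf)
    simpa only [hcomp] using this
  · refine fun h a => ⟨isVNatural_limitComparison h.1 a, fun X f hf => ?_⟩
    have hf' : f = fun j : Kᵒᵖ => ecurry (euncurry (f (op j.unop))) := funext fun j => by simp
    rw [hf'] at hf
    obtain ⟨l, hl, hl'⟩ := h.2 a X (fun b => euncurry (f (op b))) ((hnat a X _).1 hf)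
    rw [hf']
    exact ⟨l, hcomp.2 hl, fun l' h' => hl' l' (hcomp.1 h')⟩

/-- A colimit is a limit in `Aᵒᵖ`, where composition is that of A preceded by a braiding; this
cancels every braiding in `isWeightedLimit_iff`. -/
theorem isWeightedColimit_iff (φ : EnrichedFunctor V Kᵒᵖ V) (S : EnrichedFunctor V K A) (C : A)
    (η : ∀ k : Kᵒᵖ, φ.obj k ⟶ 𝓗[V] (S.obj k.unop) C) :
    IsWeightedColimit φ S C η ↔ IsUniversalUnit φ S C (fun b => η (op b)) := by
  have e : ∀ {a b c : A} {X Y : V} (g : Y ⟶ 𝓗[V] a b) (f : X ⟶ 𝓗[V] b c),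
      (β_ Y X).hom ≫ star (C := Aᵒᵖ) (a := op c) (b := op b) (c := op a) f g = star g f := by
    intro a b c X Y g f
    rw [star_op, SymmetricCategory.symmetry_assoc]
  refine (isWeightedLimit_iff φ (opFunctor S) (op C) η).trans (and_congr ?_ ?_)
  · refine forall₂_congr fun b c => ?_
    exact ⟨fun h => h.trans (e _ _), fun h => h.trans (e _ _).symm⟩
  · constructor
    · intro h a X f hf
      obtain ⟨l, hl, hl'⟩ := h (op a) X f fun b c =>
        (hf b c).trans (congrArg _ (e (S.map b c) (f c)).symm)
      exact ⟨l, fun b => (e _ _).symm.trans (hl b), fun l' h' => hl' l' fun b => (e _ _).trans (h' b)⟩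
    · intro h a X f hf
      obtain ⟨l, hl, hl'⟩ := h a.unop X f fun b c =>
        (hf b c).trans (congrArg _ (e (S.map b c) (f c)))
      exact ⟨l, fun b => (e _ _).trans (hl b), fun l' h' =>
        hl' l' fun b => (e _ _).symm.trans (h' b)⟩

/-- The `V`-functor `K ⟶ Aᵒᵖ` corresponding to `T : Kᵒᵖ ⟶ A`. -/
abbrev rightOpFunctor (T : EnrichedFunctor V Kᵒᵖ A) : EnrichedFunctor V K Aᵒᵖ where
  obj b := op (T.obj (op b))
  map b c := T.map (op c) (op b)
  map_id b := T.map_id (op b)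
  map_comp b c d := by
    have h := T.map_comp (op d) (op c) (op b)
    rw [eComp_op_eq, Category.assoc] at h
    refine Eq.trans ?_ (star_op (J := A) (a := op (T.obj (op b))) (b := op (T.obj (op c)))
      (c := op (T.obj (op d))) (T.map (op c) (op b)) (T.map (op d) (op c))).symm
    refine Eq.trans ?_ (congrArg (fun t => (β_ (𝓗[V] b c) (𝓗[V] c d)).hom ≫ t) h)
    exact (SymmetricCategory.symmetry_assoc _ _ _).symm

/-- A limit in A is a colimit in `Aᵒᵖ`. This allows absoluteness to be proved for colimits only and
then transferred to limits. -/
theorem isWeightedLimit_iff_isUniversalUnit (φ : EnrichedFunctor V Kᵒᵖ V)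
    (T : EnrichedFunctor V Kᵒᵖ A) (L : A) (μ : ∀ j, φ.obj j ⟶ 𝓗[V] L (T.obj j)) :
    IsWeightedLimit φ T L μ ↔
      IsUniversalUnit φ (rightOpFunctor T) (op L) (fun b => μ (op b)) := by
  have e : ∀ {a b c : A} {X Y : V} (g : Y ⟶ 𝓗[V] a b) (f : X ⟶ 𝓗[V] b c),
      star (C := Aᵒᵖ) (a := op c) (b := op b) (c := op a) f g = (β_ X Y).hom ≫ star g f :=
    fun g f => star_op _ _
  refine (isWeightedLimit_iff φ T L μ).trans (and_congr ?_ ?_)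
  · refine forall₂_congr fun b c => ?_
    exact ⟨fun h => h.trans (e _ _).symm, fun h => h.trans (e _ _)⟩
  · constructor
    · intro h a X f hf
      obtain ⟨l, hl, hl'⟩ := h a.unop X f fun b c =>
        (hf b c).trans (congrArg _ (e (f c) (T.map (op c) (op b))))
      exact ⟨l, fun b => (e _ _).trans (hl b),
        fun l' h' => hl' l' fun b => (e _ _).symm.trans (h' b)⟩
    · intro h a X f hf
      obtain ⟨l, hl, hl'⟩ := h (op a) X f fun b c =>
        (hf b c).trans (congrArg _ (e (f c) (T.map (op c) (op b))).symm)
      exact ⟨l, fun b => (e _ _).symm.trans (hl b), fun l' h' =>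
        hl' l' fun b => (e _ _).trans (h' b)⟩

end UniversalUnits

/-! ### Weighted colimits in the base -/

section ColimitsInV

variable {V : Type u} [Category.{v} V] [MonoidalCategory V] [SymmetricCategory V]
  [MonoidalClosed V]
variable {K : Type*} [EnrichedCategory V K]
variable {φ : EnrichedFunctor V Kᵒᵖ V} {S : EnrichedFunctor V K V} {C : V}
  {μ : ∀ b : K, φ.obj (op b) ⟶ 𝓗[V] (S.obj b) C}

theorem IsUniversalUnit.dinatural (h : IsUniversalUnit φ S C μ) (b c : K) :
    (α_ _ _ _).inv ≫ act S b c ▷ φ.obj (op c) ≫ euncurry (μ c) =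
      S.obj b ◁ lact φ b c ≫ euncurry (μ b) := by
  rw [← euncurry_comp, h.1, euncurry_star]
  rfl

/-- A map out of C ⊗ X is a generalised element of [C, Z], to which the enriched universal property
applies. The variants below follow by currying or by taking X to be the unit. -/
theorem IsUniversalUnit.tensor_hom_ext (h : IsUniversalUnit φ S C μ) {X Z : V}
    {p q : C ⊗ X ⟶ Z} (hpq : ∀ b, euncurry (μ b) ▷ X ≫ p = euncurry (μ b) ▷ X ≫ q) : p = q := by
  have : ecurry p = ecurry q := h.hom_ext fun b => euncurry_inj (by
    rw [euncurry_star, euncurry_star, euncurry_ecurry, euncurry_ecurry, hpq])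
  simpa using congrArg euncurry this

theorem IsUniversalUnit.tensor_tensor_hom_ext (h : IsUniversalUnit φ S C μ) {W X Z : V}
    {p q : W ⊗ (C ⊗ X) ⟶ Z}
    (hpq : ∀ b, W ◁ (euncurry (μ b) ▷ X) ≫ p = W ◁ (euncurry (μ b) ▷ X) ≫ q) : p = q := by
  have : ecurry p = ecurry q := h.tensor_hom_ext fun b => by
    rw [comp_ecurry, comp_ecurry, hpq]
  simpa using congrArg euncurry this

theorem IsUniversalUnit.base_hom_ext (h : IsUniversalUnit φ S C μ) {Z : V}
    {p q : C ⟶ Z} (hpq : ∀ b, euncurry (μ b) ≫ p = euncurry (μ b) ≫ q) : p = q := by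
  have : (ρ_ C).hom ≫ p = (ρ_ C).hom ≫ q := h.tensor_hom_ext fun b => by
    rw [rightUnitor_naturality_assoc, rightUnitor_naturality_assoc, hpq]
  simpa using this

theorem IsUniversalUnit.tensorLeft_hom_ext (h : IsUniversalUnit φ S C μ) {W Z : V}
    {p q : W ⊗ C ⟶ Z}
    (hpq : ∀ b, W ◁ euncurry (μ b) ≫ p = W ◁ euncurry (μ b) ≫ q) : p = q := by
  have : ecurry p = ecurry q := h.base_hom_ext fun b => by
    rw [comp_ecurry, comp_ecurry, hpq]
  simpa using congrArg euncurry this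

/-- Tensoring with X preserves the colimit because V is closed: the family `t` transposes to a
natural family with parameter X and values in [S b, Z]. -/
theorem IsUniversalUnit.exists_tensor_desc (h : IsUniversalUnit φ S C μ) {X Z : V}
    (t : ∀ b, (S.obj b ⊗ φ.obj (op b)) ⊗ X ⟶ Z)
    (ht : ∀ b c, (α_ _ _ _).inv ▷ X ≫ act S b c ▷ φ.obj (op c) ▷ X ≫ t c =
      (S.obj b ◁ lact φ b c) ▷ X ≫ t b) :
    ∃ d : C ⊗ X ⟶ Z, ∀ b, euncurry (μ b) ▷ X ≫ d = t b := by
  obtain ⟨l, hl, -⟩ := h.2 Z X (fun b => ecurry ((α_ _ _ _).inv ≫ t b)) fun b c => by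
    refine euncurry_inj ?_
    rw [euncurry_comp, euncurry_comp, euncurry_star, euncurry_ecurry, euncurry_ecurry]
    have := congrArg (fun s => (α_ _ _ _).inv ≫ s) (ht b c)
    change S.obj b ◁ lact φ b c ▷ X ≫ (α_ _ _ _).inv ≫ t b = S.obj b ◁ (α_ _ _ _).hom ≫
      (α_ _ _ _).inv ≫ act S b c ▷ (φ.obj (op c) ⊗ X) ≫ (α_ _ _ _).inv ≫ t c
    rw [associator_inv_naturality_middle_assoc, ← this]
    simp
  refine ⟨euncurry l, fun b => ?_⟩
  have := congrArg euncurry (hl b)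
  rwa [euncurry_star, euncurry_ecurry, Iso.cancel_iso_inv_left] at this

theorem IsUniversalUnit.exists_tensorLeft_desc (h : IsUniversalUnit φ S C μ) {X Z : V}
    (t : ∀ b, X ⊗ (S.obj b ⊗ φ.obj (op b)) ⟶ Z)
    (ht : ∀ b c, X ◁ (α_ _ _ _).inv ≫ X ◁ (act S b c ▷ φ.obj (op c)) ≫ t c =
      X ◁ (S.obj b ◁ lact φ b c) ≫ t b) :
    ∃ d : X ⊗ C ⟶ Z, ∀ b, X ◁ euncurry (μ b) ≫ d = t b := by
  obtain ⟨d, hd⟩ := h.exists_tensor_desc (fun b => (β_ _ _).hom ≫ t b) fun b c => by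
    rw [braiding_naturality_left_assoc, braiding_naturality_left_assoc,
      braiding_naturality_left_assoc, ht]
  refine ⟨(β_ _ _).hom ≫ d, fun b => ?_⟩
  rw [braiding_naturality_right_assoc, hd, SymmetricCategory.symmetry_assoc]

theorem IsUniversalUnit.exists_desc (h : IsUniversalUnit φ S C μ) {Z : V}
    (t : ∀ b, S.obj b ⊗ φ.obj (op b) ⟶ Z)
    (ht : ∀ b c, (α_ _ _ _).inv ≫ act S b c ▷ φ.obj (op c) ≫ t c =
      S.obj b ◁ lact φ b c ≫ t b) :
    ∃ d : C ⟶ Z, ∀ b, euncurry (μ b) ≫ d = t b := by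
  obtain ⟨d, hd⟩ := h.exists_tensor_desc (fun b => (ρ_ _).hom ≫ t b) fun b c => by
    rw [rightUnitor_naturality_assoc, rightUnitor_naturality_assoc,
      rightUnitor_naturality_assoc, ht]
  refine ⟨(ρ_ _).inv ≫ d, fun b => ?_⟩
  rw [rightUnitor_inv_naturality_assoc, hd, Iso.inv_hom_id_assoc]

end ColimitsInV

/-! ### The covariant Yoneda embedding -/

section CovariantYoneda

variable {V : Type u} [Category.{v} V] [MonoidalCategory V] [MonoidalClosed V]
variable {B : Type w} [EnrichedCategory V B]

theorem act_representable (b c d : B) : act (representable V b) c d = eComp V b c d :=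
  euncurry_ecurry _

variable [SymmetricCategory V]

variable (V) in
/-- The representable presheaf `B(-, c)`. -/
def presheaf (c : B) : EnrichedFunctor V Bᵒᵖ V := representable V (op c)

theorem lact_presheaf (a b c : B) : lact (presheaf V c) a b = eComp V a b c := by
  have h : act (presheaf V c) (op b) (op a) = (β_ (𝓗[V] b c) (𝓗[V] a b)).hom ≫ eComp V a b c :=
    (act_representable (op c) (op b) (op a)).trans (eComp_op_eq V (op a) (op b) (op c))
  rw [lact, h]
  exact SymmetricCategory.symmetry_assoc _ _ _

theorem isLeftNatural_lact (φ : EnrichedFunctor V Bᵒᵖ V) (b : B) :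
    IsLeftNatural (presheaf V b) φ (fun a => lact φ a b) := by
  intro a a'
  rw [lact_presheaf]
  exact lact_comp φ a a' b

variable [IsSmall V B] [HasLimits V]

/-- Evaluation of transformations from a representable presheaf. -/
def evFrom (b : B) (G : EnrichedFunctor V Bᵒᵖ V) (a : B) :
    𝓗[V] a b ⊗ 𝓗[V] (presheaf V b) G ⟶ G.obj (op a) := evLeft (presheaf V b) G a

/-- Evaluation of transformations into a representable presheaf. -/
def evInto (F : EnrichedFunctor V Bᵒᵖ V) (c a : B) :
    F.obj (op a) ⊗ 𝓗[V] F (presheaf V c) ⟶ 𝓗[V] a c := evLeft F (presheaf V c) a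

/-- Evaluation of transformations between representable presheaves. -/
def evHom (b c a : B) : 𝓗[V] a b ⊗ 𝓗[V] (presheaf V b) (presheaf V c) ⟶ 𝓗[V] a c :=
  evLeft (presheaf V b) (presheaf V c) a

theorem evFrom_natural (b : B) (G : EnrichedFunctor V Bᵒᵖ V) (a a' : B) :
    eComp V a a' b ▷ 𝓗[V] (presheaf V b) G ≫ evFrom b G a =
      (α_ _ _ _).hom ≫ 𝓗[V] a a' ◁ evFrom b G a' ≫ lact G a a' := by
  rw [← lact_presheaf]
  exact isLeftNatural_evLeft _ _ _ _

theorem evInto_natural (F : EnrichedFunctor V Bᵒᵖ V) (c a a' : B) :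
    lact F a a' ▷ 𝓗[V] F (presheaf V c) ≫ evInto F c a =
      (α_ _ _ _).hom ≫ 𝓗[V] a a' ◁ evInto F c a' ≫ eComp V a a' c := by
  rw [← lact_presheaf]
  exact isLeftNatural_evLeft _ _ _ _

theorem evFrom_hom_ext {b : B} {G : EnrichedFunctor V Bᵒᵖ V} {X : V}
    {p q : X ⟶ 𝓗[V] (presheaf V b) G}
    (h : ∀ a, 𝓗[V] a b ◁ p ≫ evFrom b G a = 𝓗[V] a b ◁ q ≫ evFrom b G a) : p = q :=
  evLeft_hom_ext h

theorem evInto_hom_ext {F : EnrichedFunctor V Bᵒᵖ V} {c : B} {X : V}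
    {p q : X ⟶ 𝓗[V] F (presheaf V c)}
    (h : ∀ a, F.obj (op a) ◁ p ≫ evInto F c a = F.obj (op a) ◁ q ≫ evInto F c a) : p = q :=
  evLeft_hom_ext h

theorem exists_evInto {F : EnrichedFunctor V Bᵒᵖ V} {c : B} {X : V}
    (f : ∀ a, F.obj (op a) ⊗ X ⟶ 𝓗[V] a c)
    (hf : ∀ a a', lact F a a' ▷ X ≫ f a = (α_ _ _ _).hom ≫ 𝓗[V] a a' ◁ f a' ≫ eComp V a a' c) :
    ∃ l : X ⟶ 𝓗[V] F (presheaf V c), ∀ a, F.obj (op a) ◁ l ≫ evInto F c a = f a := by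
  refine exists_evLeft (G := presheaf V c) (f := f) fun a a' => ?_
  rw [lact_presheaf]
  exact hf a a'

theorem evHom_hom_ext {b c : B} {X : V} {p q : X ⟶ 𝓗[V] (presheaf V b) (presheaf V c)}
    (h : ∀ a, 𝓗[V] a b ◁ p ≫ evHom b c a = 𝓗[V] a b ◁ q ≫ evHom b c a) : p = q :=
  evLeft_hom_ext h

theorem evHom_id (b a : B) : 𝓗[V] a b ◁ eId V (presheaf V b) ≫ evHom b b a = (ρ_ _).hom :=
  evLeft_id (presheaf V b) a

theorem evHom_star {b c d : B} {X Y : V} (f : X ⟶ 𝓗[V] (presheaf V b) (presheaf V c))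
    (g : Y ⟶ 𝓗[V] (presheaf V c) (presheaf V d)) (a : B) :
    𝓗[V] a b ◁ star f g ≫ evHom b d a =
      (α_ _ _ _).inv ≫ (𝓗[V] a b ◁ f ≫ evHom b c a) ▷ Y ≫ 𝓗[V] a c ◁ g ≫ evHom c d a :=
  evLeft_star f g a

theorem evFrom_star {b : B} {G H : EnrichedFunctor V Bᵒᵖ V} {X Y : V}
    (f : X ⟶ 𝓗[V] (presheaf V b) G) (g : Y ⟶ 𝓗[V] G H) (a : B) :
    𝓗[V] a b ◁ star f g ≫ evFrom b H a =
      (α_ _ _ _).inv ≫ (𝓗[V] a b ◁ f ≫ evFrom b G a) ▷ Y ≫ G.obj (op a) ◁ g ≫ evLeft G H a :=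
  evLeft_star f g a

theorem evInto_star_presheaf {F : EnrichedFunctor V Bᵒᵖ V} {b c : B} {X Y : V}
    (f : X ⟶ 𝓗[V] F (presheaf V b)) (g : Y ⟶ 𝓗[V] (presheaf V b) (presheaf V c)) (a : B) :
    F.obj (op a) ◁ star f g ≫ evInto F c a =
      (α_ _ _ _).inv ≫ (F.obj (op a) ◁ f ≫ evInto F b a) ▷ Y ≫
        𝓗[V] a b ◁ g ≫ evHom b c a :=
  evLeft_star f g a

/-- The Yoneda map `φ b ⟶ [Bᵒᵖ, V](B(-, b), φ)`. -/
def yonedaHom (φ : EnrichedFunctor V Bᵒᵖ V) (b : B) :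
    φ.obj (op b) ⟶ 𝓗[V] (presheaf V b) φ :=
  (exists_evLeft (isLeftNatural_lact φ b)).choose

theorem yonedaHom_ev (φ : EnrichedFunctor V Bᵒᵖ V) (a b : B) :
    𝓗[V] a b ◁ yonedaHom φ b ≫ evFrom b φ a = lact φ a b :=
  (exists_evLeft (isLeftNatural_lact φ b)).choose_spec a

/-- Evaluation `[Bᵒᵖ, V](B(-, b), φ) ⟶ φ b` at the identity. -/
def yonedaEval (φ : EnrichedFunctor V Bᵒᵖ V) (b : B) :
    𝓗[V] (presheaf V b) φ ⟶ φ.obj (op b) :=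
  (λ_ _).inv ≫ eId V b ▷ _ ≫ evFrom b φ b

theorem yonedaHom_eval (φ : EnrichedFunctor V Bᵒᵖ V) (b : B) :
    yonedaHom φ b ≫ yonedaEval φ b = 𝟙 _ := by
  rw [yonedaEval, leftUnitor_inv_naturality_assoc, whisker_exchange_assoc, yonedaHom_ev,
    lact_id, Iso.inv_hom_id]

/-- A transformation out of B(-, b) is recovered from its value at the identity by naturality; this
is the half of the Yoneda lemma that makes `yonedaEval` an isomorphism. -/
theorem whiskerLeft_yonedaEval_lact (φ : EnrichedFunctor V Bᵒᵖ V) (a b : B) :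
    𝓗[V] a b ◁ yonedaEval φ b ≫ lact φ a b = evFrom b φ a := by
  have h := evFrom_natural b φ a b
  rw [← Iso.inv_comp_eq] at h
  rw [yonedaEval, MonoidalCategory.whiskerLeft_comp, MonoidalCategory.whiskerLeft_comp,
    Category.assoc, Category.assoc, ← h]
  rw [associator_inv_naturality_middle_assoc, ← comp_whiskerRight_assoc]
  have e := e_comp_id V a b
  rw [Iso.inv_comp_eq, Category.comp_id] at e
  rw [e]
  simp

theorem yonedaEval_hom (φ : EnrichedFunctor V Bᵒᵖ V) (b : B) :
    yonedaEval φ b ≫ yonedaHom φ b = 𝟙 _ := by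
  refine evFrom_hom_ext fun a => ?_
  rw [MonoidalCategory.whiskerLeft_comp, Category.assoc, yonedaHom_ev,
    whiskerLeft_yonedaEval_lact]
  simp

theorem star_yonedaEval {φ G : EnrichedFunctor V Bᵒᵖ V} {b : B} {X Y : V}
    (x : X ⟶ 𝓗[V] (presheaf V b) φ) (l : Y ⟶ 𝓗[V] φ G) :
    star x l ≫ yonedaEval G b = ((x ≫ yonedaEval φ b) ⊗ₘ l) ≫ evLeft φ G b := by
  rw [yonedaEval, leftUnitor_inv_naturality_assoc, whisker_exchange_assoc, evFrom_star, yonedaEval,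
    MonoidalCategory.tensorHom_def, Category.assoc]
  have : x ≫ (λ_ _).inv ≫ eId V b ▷ _ ≫ evFrom b φ b =
    (λ_ _).inv ≫ eId V b ▷ _ ≫ 𝓗[V] b b ◁ x ≫ evFrom b φ b := by
    rw [leftUnitor_inv_naturality_assoc, whisker_exchange_assoc]
  rw [this]
  simp

/-- The action `B(b, c) ⟶ [Bᵒᵖ, V](B(-, b), B(-, c))` of the Yoneda embedding. -/
def coYonedaMap (b c : B) : 𝓗[V] b c ⟶ 𝓗[V] (presheaf V b) (presheaf V c) :=
  yonedaHom (presheaf V c) b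

theorem coYonedaMap_ev (a b c : B) :
    𝓗[V] a b ◁ coYonedaMap b c ≫ evHom b c a = eComp V a b c :=
  (yonedaHom_ev (presheaf V c) a b).trans (lact_presheaf a b c)

variable (V B) in
/-- The Yoneda embedding `B ⟶ [Bᵒᵖ, V]`, sending `c` to `B(-, c)`. -/
def coYoneda : EnrichedFunctor V B (EnrichedFunctor V Bᵒᵖ V) where
  obj c := presheaf V c
  map b c := coYonedaMap b c
  map_id b := evHom_hom_ext fun a => by
    rw [evHom_id, MonoidalCategory.whiskerLeft_comp, Category.assoc, coYonedaMap_ev]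
    have e := e_comp_id V a b
    rwa [Iso.inv_comp_eq, Category.comp_id] at e
  map_comp b c d := evHom_hom_ext fun a => by
    change _ = _ ◁ star _ _ ≫ _
    rw [evHom_star, MonoidalCategory.whiskerLeft_comp, Category.assoc, coYonedaMap_ev,
      coYonedaMap_ev, coYonedaMap_ev, e_assoc]

theorem star_coYonedaMap {b c : B} {F : EnrichedFunctor V Bᵒᵖ V} {X : V}
    (f : X ⟶ 𝓗[V] (presheaf V c) F) :
    star (coYonedaMap b c) f ≫ yonedaEval F b = 𝓗[V] b c ◁ (f ≫ yonedaEval F c) ≫ lact F b c := by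
  have e : coYonedaMap b c ≫ yonedaEval (presheaf V c) b = 𝟙 _ := yonedaHom_eval _ _
  rw [MonoidalCategory.whiskerLeft_comp, Category.assoc, whiskerLeft_yonedaEval_lact]
  refine (star_yonedaEval (coYonedaMap b c) f).trans ?_
  refine (congrArg (fun t => (t ⊗ₘ f) ≫ evLeft (presheaf V c) F b) e).trans ?_
  exact congrArg (fun t => t ≫ evLeft (presheaf V c) F b) (id_tensorHom _ _)

theorem yonedaEval_inj {X : V} {F : EnrichedFunctor V Bᵒᵖ V} {b : B}
    {p q : X ⟶ 𝓗[V] (presheaf V b) F} (h : p ≫ yonedaEval F b = q ≫ yonedaEval F b) : p = q := by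
  simpa only [Category.assoc, yonedaEval_hom, Category.comp_id] using
    congrArg (fun t => t ≫ yonedaHom F b) h

theorem lact_yonedaHom (φ : EnrichedFunctor V Bᵒᵖ V) (b c : B) :
    lact φ b c ≫ yonedaHom φ b = star (coYonedaMap b c) (yonedaHom φ c) := by
  refine yonedaEval_inj ?_
  rw [star_coYonedaMap, Category.assoc, yonedaHom_eval, yonedaHom_eval]
  simp

theorem star_yonedaHom_eval {φ F : EnrichedFunctor V Bᵒᵖ V} {X : V} (l : X ⟶ 𝓗[V] φ F) (b : B) :
    star (yonedaHom φ b) l ≫ yonedaEval F b = φ.obj (op b) ◁ l ≫ evLeft φ F b := by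
  rw [star_yonedaEval, yonedaHom_eval, id_tensorHom]

/-- Every presheaf is the colimit of representable presheaves weighted by itself. -/
theorem isUniversalUnit_yonedaHom (φ : EnrichedFunctor V Bᵒᵖ V) :
    IsUniversalUnit φ (coYoneda V B) φ (yonedaHom φ) := by
  refine ⟨lact_yonedaHom φ, fun F X (f : ∀ b, φ.obj (op b) ⊗ X ⟶ 𝓗[V] (presheaf V b) F) hf => ?_⟩
  -- By Yoneda, a family φ b ⊗ X ⟶ [Bᵒᵖ, V](B(-, b), F) is a family φ b ⊗ X ⟶ F b, and naturality on
  -- one side becomes naturality on the other.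
  obtain ⟨l, hl⟩ := exists_evLeft (φ := φ) (G := F) (f := fun b => f b ≫ yonedaEval F b)
    (fun b c => by
      have h : lact φ b c ▷ X ≫ f b = (α_ _ _ _).hom ≫ star (coYonedaMap b c) (f c) := hf b c
      rw [← Category.assoc, h, Category.assoc, star_coYonedaMap])
  refine ⟨l, fun b => yonedaEval_inj ((star_yonedaHom_eval l b).trans (hl b)),
    fun l' hl' => evLeft_hom_ext fun b => ?_⟩
  have h : star (yonedaHom φ b) l' = f b := hl' b
  rw [hl, ← star_yonedaHom_eval, h]

end CovariantYoneda

/-! ### The dual of a weight and its universal property -/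

section Dual

variable {V : Type u} [Category.{v} V] [MonoidalCategory V] [MonoidalClosed V]
  [SymmetricCategory V] [HasLimits V]
variable {B : Type w} [EnrichedCategory V B] [IsSmall V B]

/-- The dual `c ↦ [Bᵒᵖ, V](φ, B(-, c))` of a weight `φ`. -/
def dual (φ : EnrichedFunctor V Bᵒᵖ V) : EnrichedFunctor V B V :=
  (coYoneda V B).comp V (representable V φ)

/-- The canonical pairing of a weight with its dual. -/
def pairing (φ : EnrichedFunctor V Bᵒᵖ V) (b c : B) :
    φ.obj (op b) ⊗ (dual φ).obj c ⟶ 𝓗[V] b c := evInto φ c b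

theorem pairing_natural_left (φ : EnrichedFunctor V Bᵒᵖ V) (a b c : B) :
    lact φ a b ▷ (dual φ).obj c ≫ pairing φ a c =
      (α_ _ _ _).hom ≫ 𝓗[V] a b ◁ pairing φ b c ≫ eComp V a b c :=
  evInto_natural φ c a b

theorem act_dual (φ : EnrichedFunctor V Bᵒᵖ V) (c d : B) :
    act (dual φ) c d = star (𝟙 (𝓗[V] φ (presheaf V c))) (coYonedaMap c d) :=
  euncurry_comp_representable (coYonedaMap c d)

/-- The dual acts by postcomposition with maps of representables, which evaluates to composition in
B. With `pairing_natural_left`, this makes the pairing a map of bimodules. -/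
theorem pairing_natural_right (φ : EnrichedFunctor V Bᵒᵖ V) (b c d : B) :
    φ.obj (op b) ◁ act (dual φ) c d ≫ pairing φ b d =
      (α_ _ _ _).inv ≫ pairing φ b c ▷ 𝓗[V] c d ≫ eComp V b c d := by
  rw [act_dual]
  refine (evInto_star_presheaf (𝟙 (𝓗[V] φ (presheaf V c))) (coYonedaMap c d) b).trans ?_
  rw [coYonedaMap_ev]
  refine congrArg (fun t => (α_ _ _ _).inv ≫ t ▷ _ ≫ eComp V b c d) ?_
  exact (congrArg (fun t => t ≫ evInto φ c b) (MonoidalCategory.whiskerLeft_id _ _)).trans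
    (Category.id_comp _)

theorem pairing_hom_ext {φ : EnrichedFunctor V Bᵒᵖ V} {c : B} {X : V} {p q : X ⟶ (dual φ).obj c}
    (h : ∀ b, φ.obj (op b) ◁ p ≫ pairing φ b c = φ.obj (op b) ◁ q ≫ pairing φ b c) : p = q :=
  evInto_hom_ext h

theorem exists_pairing_lift {φ : EnrichedFunctor V Bᵒᵖ V} {c : B} {X : V}
    (f : ∀ a, φ.obj (op a) ⊗ X ⟶ 𝓗[V] a c)
    (hf : ∀ a a', lact φ a a' ▷ X ≫ f a = (α_ _ _ _).hom ≫ 𝓗[V] a a' ◁ f a' ≫ eComp V a a' c) :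
    ∃ l : X ⟶ (dual φ).obj c, ∀ a, φ.obj (op a) ◁ l ≫ pairing φ a c = f a :=
  exists_evInto f hf

/-- Evaluation of transformations into a representable copresheaf. -/
def evCo (F : EnrichedFunctor V B V) (b c : B) :
    𝓗[V] F ((yonedaEmbedding B).obj (op b)) ⊗ F.obj c ⟶ 𝓗[V] b c :=
  evRight F (representable V b) c

theorem evCo_natural (F : EnrichedFunctor V B V) (b c d : B) :
    (α_ _ _ _).hom ≫ 𝓗[V] F ((yonedaEmbedding B).obj (op b)) ◁ act F c d ≫ evCo F b d =
      evCo F b c ▷ 𝓗[V] c d ≫ eComp V b c d := by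
  rw [← act_representable]
  exact isRightNatural_evRight F (representable V b) c d

theorem evCo_hom_ext {F : EnrichedFunctor V B V} {b : B} {X : V}
    {p q : X ⟶ 𝓗[V] F ((yonedaEmbedding B).obj (op b))}
    (h : ∀ c, p ▷ F.obj c ≫ evCo F b c = q ▷ F.obj c ≫ evCo F b c) : p = q :=
  evRight_hom_ext h

theorem exists_evCo {F : EnrichedFunctor V B V} {b : B} {X : V}
    (f : ∀ c, X ⊗ F.obj c ⟶ 𝓗[V] b c)
    (hf : ∀ c d, (α_ _ _ _).hom ≫ X ◁ act F c d ≫ f d = f c ▷ 𝓗[V] c d ≫ eComp V b c d) :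
    ∃ l : X ⟶ 𝓗[V] F ((yonedaEmbedding B).obj (op b)),
      ∀ c, l ▷ F.obj c ≫ evCo F b c = f c := by
  refine exists_evRight (G := representable V b) (f := f) fun c d => ?_
  rw [act_representable]
  exact hf c d

theorem evCo_star {F G : EnrichedFunctor V B V} {b : B} {X Y : V} (f : X ⟶ 𝓗[V] F G)
    (g : Y ⟶ 𝓗[V] G ((yonedaEmbedding B).obj (op b))) (c : B) :
    ((β_ Y X).hom ≫ star f g) ▷ F.obj c ≫ evCo F b c =
      (α_ _ _ _).hom ≫ Y ◁ (f ▷ F.obj c ≫ evRight F G c) ≫ g ▷ G.obj c ≫ evCo G b c :=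
  evRight_star f g c

/-- Evaluation of transformations between representable copresheaves. -/
def evCoHom (b c d : B) :
    𝓗[V] ((yonedaEmbedding (V := V) B).obj (op c)) ((yonedaEmbedding B).obj (op b)) ⊗ 𝓗[V] c d ⟶
      𝓗[V] b d :=
  evRight (representable V c) (representable V b) d

theorem yonedaEmbedding_map_ev (b c d : B) :
    (yonedaEmbedding B).map (op c) (op b) ▷ 𝓗[V] c d ≫ evCoHom b c d = eComp V b c d := by
  refine (whiskerRight_evRight (F := representable V c) (G := representable V b)
    ((yonedaEmbedding B).map (op c) (op b)) d).trans ?_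
  have h : (yonedaEmbedding B).map (op c) (op b) ≫
      natProj (representable V c) (representable V b) d = precomp c b d :=
    natLift_proj _ (isVNatural_precomp c b) d
  refine (congrArg (fun t => (β_ (𝓗[V] b c) (𝓗[V] c d)).hom ≫ euncurry t) h).trans ?_
  rw [precomp, euncurry_ecurry]
  exact SymmetricCategory.symmetry_assoc _ _ _

theorem evCo_star_yonedaEmbedding_map {F : EnrichedFunctor V B V} {b c : B} {X : V}
    (f : X ⟶ 𝓗[V] F ((yonedaEmbedding B).obj (op c))) (d : B) :
    ((β_ (𝓗[V] b c) X).hom ≫ star f ((yonedaEmbedding B).map (op c) (op b))) ▷ F.obj d ≫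
        evCo F b d =
      (α_ _ _ _).hom ≫ 𝓗[V] b c ◁ (f ▷ F.obj d ≫ evCo F c d) ≫ eComp V b c d := by
  rw [← yonedaEmbedding_map_ev]
  exact evRight_star f ((yonedaEmbedding B).map (op c) (op b)) d

/-- For fixed b the pairing is natural in c, so it is a generalised element of [B, V](φ^, B(b, -))
with parameter φ b. -/
theorem exists_dualCounit (φ : EnrichedFunctor V Bᵒᵖ V) (b : B) :
    ∃ l : φ.obj (op b) ⟶ 𝓗[V] (dual φ) ((yonedaEmbedding B).obj (op b)),
      ∀ c, l ▷ (dual φ).obj c ≫ evCo (dual φ) b c = pairing φ b c :=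
  exists_evCo (fun c => pairing φ b c) fun c d => by
    rw [pairing_natural_right, Iso.hom_inv_id_assoc]

/-- The counit of the limit of the Yoneda embedding weighted by `φ`. -/
def dualCounit (φ : EnrichedFunctor V Bᵒᵖ V) (b : Bᵒᵖ) :
    φ.obj b ⟶ 𝓗[V] (dual φ) ((yonedaEmbedding B).obj b) :=
  (exists_dualCounit φ b.unop).choose

theorem dualCounit_ev (φ : EnrichedFunctor V Bᵒᵖ V) (b c : B) :
    dualCounit φ (op b) ▷ (dual φ).obj c ≫ evCo (dual φ) b c = pairing φ b c :=
  (exists_dualCounit φ b).choose_spec c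

/-- The dual of `φ` is the limit of the Yoneda embedding weighted by `φ`. -/
theorem isWeightedLimit_dual (φ : EnrichedFunctor V Bᵒᵖ V) :
    IsWeightedLimit φ (yonedaEmbedding B) (dual φ) (dualCounit φ) := by
  have hstar : ∀ {F : EnrichedFunctor V B V} {X : V} (l : X ⟶ 𝓗[V] F (dual φ)) (b c : B),
      ((β_ (φ.obj (op b)) X).hom ≫ star l (dualCounit φ (op b))) ▷ F.obj c ≫ evCo F b c =
        (α_ _ _ _).hom ≫ φ.obj (op b) ◁ (l ▷ F.obj c ≫ evRight F (dual φ) c) ≫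
          pairing φ b c := by
    intro F X l b c
    rw [evCo_star, dualCounit_ev]
  refine (isWeightedLimit_iff φ _ _ _).2 ⟨fun b c => evCo_hom_ext fun d => ?_,
    fun F X f hf => ?_⟩
  · refine Eq.trans ?_ (evCo_star_yonedaEmbedding_map (dualCounit φ (op c)) d).symm
    rw [comp_whiskerRight_assoc, dualCounit_ev, dualCounit_ev, pairing_natural_left]
  -- Both {φ, Y'} and φ^ are computed pointwise. For fixed c, evaluating `f` at c gives a family φ a
  -- ⊗ (X ⊗ F c) ⟶ B(a, c) natural in a, hence a map `m c` : X ⊗ F c ⟶ φ^ c.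
  · have hf' : ∀ a a' c, (lact φ a a' ▷ X) ▷ F.obj c ≫ f a ▷ F.obj c ≫ evCo F a c =
        (α_ _ _ _).hom ▷ F.obj c ≫ (α_ _ _ _).hom ≫
          𝓗[V] a a' ◁ (f a' ▷ F.obj c ≫ evCo F a' c) ≫ eComp V a a' c := by
      intro a a' c
      have h := evCo_star_yonedaEmbedding_map (b := a) (c := a') (f a') c
      rw [← h, ← comp_whiskerRight_assoc, ← comp_whiskerRight_assoc]
      exact congrArg (fun t => t ▷ F.obj c ≫ evCo F a c) (hf a a')
    choose m hm using fun c => exists_pairing_lift (φ := φ) (c := c) (X := X ⊗ F.obj c)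
      (fun a => (α_ _ _ _).inv ≫ f a ▷ F.obj c ≫ evCo F a c) fun a a' => by
        have h := congrArg (fun t => (α_ _ _ _).inv ≫ t) (hf' a a' c)
        rw [associator_inv_naturality_left_assoc]
        refine h.trans ?_
        generalize f a' ▷ F.obj c ≫ evCo F a' c = e
        simp
    -- The maps `m c` are natural in c, as can be tested after pairing with φ, so they assemble into
    -- an element of [B, V](F, φ^).
    obtain ⟨l, hl⟩ := exists_evRight (F := F) (G := dual φ) (f := m) fun c d =>
      pairing_hom_ext fun a => by
        have he : (α_ _ _ _).hom ≫ (φ.obj (op a) ⊗ X) ◁ act F c d ≫ f a ▷ F.obj d ≫ evCo F a d =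
            (f a ▷ F.obj c ≫ evCo F a c) ▷ 𝓗[V] c d ≫ eComp V a c d := by
          rw [whisker_exchange_assoc, comp_whiskerRight_assoc, ← evCo_natural,
            associator_naturality_left_assoc]
        simp only [MonoidalCategory.whiskerLeft_comp, Category.assoc]
        rw [pairing_natural_right, associator_inv_naturality_middle_assoc,
          ← comp_whiskerRight_assoc, hm, hm, comp_whiskerRight_assoc, ← he,
          associator_inv_naturality_right_assoc]
        simp
    refine ⟨l, fun b => evCo_hom_ext fun c => ?_, fun l' hl' => evRight_hom_ext fun c =>
      pairing_hom_ext fun a => ?_⟩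
    · refine (hstar l b c).trans ?_
      rw [hl, hm, Iso.hom_inv_id_assoc]
    · rw [hl, hm, ← hl' a, hstar, Iso.inv_hom_id_assoc]

end Dual

/-! ### Weights with a dual basis -/

section

variable {V : Type u} [Category.{v} V] [MonoidalCategory V]
variable {B : Type*} [EnrichedCategory V B] {A : Type*} [EnrichedCategory V A]

theorem comp_eComp_map (S : EnrichedFunctor V B A) {a b c : B} {X : V} (f : X ⟶ 𝓗[V] b c) :
    𝓗[V] a b ◁ f ≫ eComp V a b c ≫ S.map a c = star (S.map a b) (f ≫ S.map b c) := by
  rw [S.map_comp, ← id_tensorHom, tensorHom_comp_tensorHom_assoc, Category.id_comp]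
  rfl

end

section DualBasis

variable {V : Type u} [Category.{v} V] [MonoidalCategory V] [MonoidalClosed V]
  [SymmetricCategory V] [HasColimits V]
variable {B : Type w} [EnrichedCategory V B] [IsSmall V B]

theorem isUniversalUnit_colimUnit (φ : EnrichedFunctor V Bᵒᵖ V) (F : EnrichedFunctor V B V) :
    IsUniversalUnit φ F (colimObj φ F) (fun b => colimUnit φ F (op b)) :=
  (isWeightedColimit_iff φ F _ _).1 (isWeightedColimit_colimUnit φ F)

/-- The coprojection `F b ⊗ φ b ⟶ φ * F`. -/
def colimInj (φ : EnrichedFunctor V Bᵒᵖ V) (F : EnrichedFunctor V B V) (b : B) :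
    F.obj b ⊗ φ.obj (op b) ⟶ colimObj φ F := euncurry (colimUnit φ F (op b))

theorem colimInj_dinatural (φ : EnrichedFunctor V Bᵒᵖ V) (F : EnrichedFunctor V B V) (b c : B) :
    (α_ _ _ _).inv ≫ act F b c ▷ φ.obj (op c) ≫ colimInj φ F c =
      F.obj b ◁ lact φ b c ≫ colimInj φ F b :=
  (isUniversalUnit_colimUnit φ F).dinatural b c

theorem colim_tensor_hom_ext {φ : EnrichedFunctor V Bᵒᵖ V} {F : EnrichedFunctor V B V} {X Z : V}
    {p q : colimObj φ F ⊗ X ⟶ Z}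
    (h : ∀ b, colimInj φ F b ▷ X ≫ p = colimInj φ F b ▷ X ≫ q) : p = q :=
  (isUniversalUnit_colimUnit φ F).tensor_hom_ext h

theorem colim_tensor_tensor_hom_ext {φ : EnrichedFunctor V Bᵒᵖ V} {F : EnrichedFunctor V B V}
    {W X Z : V} {p q : W ⊗ (colimObj φ F ⊗ X) ⟶ Z}
    (h : ∀ b, W ◁ (colimInj φ F b ▷ X) ≫ p = W ◁ (colimInj φ F b ▷ X) ≫ q) : p = q :=
  (isUniversalUnit_colimUnit φ F).tensor_tensor_hom_ext h

theorem colimObj_hom_ext {φ : EnrichedFunctor V Bᵒᵖ V} {F : EnrichedFunctor V B V} {Z : V}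
    {p q : colimObj φ F ⟶ Z} (h : ∀ b, colimInj φ F b ≫ p = colimInj φ F b ≫ q) : p = q :=
  (isUniversalUnit_colimUnit φ F).base_hom_ext h

theorem colim_tensorLeft_hom_ext {φ : EnrichedFunctor V Bᵒᵖ V} {F : EnrichedFunctor V B V}
    {W Z : V} {p q : W ⊗ colimObj φ F ⟶ Z}
    (h : ∀ b, W ◁ colimInj φ F b ≫ p = W ◁ colimInj φ F b ≫ q) : p = q :=
  (isUniversalUnit_colimUnit φ F).tensorLeft_hom_ext h

theorem exists_colim_tensor_desc {φ : EnrichedFunctor V Bᵒᵖ V} {F : EnrichedFunctor V B V} {X Z : V}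
    (t : ∀ b, (F.obj b ⊗ φ.obj (op b)) ⊗ X ⟶ Z)
    (ht : ∀ b c, (α_ _ _ _).inv ▷ X ≫ act F b c ▷ φ.obj (op c) ▷ X ≫ t c =
      (F.obj b ◁ lact φ b c) ▷ X ≫ t b) :
    ∃ d : colimObj φ F ⊗ X ⟶ Z, ∀ b, colimInj φ F b ▷ X ≫ d = t b :=
  (isUniversalUnit_colimUnit φ F).exists_tensor_desc t ht

theorem exists_colim_tensorLeft_desc {φ : EnrichedFunctor V Bᵒᵖ V} {F : EnrichedFunctor V B V}
    {X Z : V} (t : ∀ b, X ⊗ (F.obj b ⊗ φ.obj (op b)) ⟶ Z)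
    (ht : ∀ b c, X ◁ (α_ _ _ _).inv ≫ X ◁ (act F b c ▷ φ.obj (op c)) ≫ t c =
      X ◁ (F.obj b ◁ lact φ b c) ≫ t b) :
    ∃ d : X ⊗ colimObj φ F ⟶ Z, ∀ b, X ◁ colimInj φ F b ≫ d = t b :=
  (isUniversalUnit_colimUnit φ F).exists_tensorLeft_desc t ht

theorem exists_colim_desc {φ : EnrichedFunctor V Bᵒᵖ V} {F : EnrichedFunctor V B V} {Z : V}
    (t : ∀ b, F.obj b ⊗ φ.obj (op b) ⟶ Z)
    (ht : ∀ b c, (α_ _ _ _).inv ≫ act F b c ▷ φ.obj (op c) ≫ t c = F.obj b ◁ lact φ b c ≫ t b) :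
    ∃ d : colimObj φ F ⟶ Z, ∀ b, colimInj φ F b ≫ d = t b :=
  (isUniversalUnit_colimUnit φ F).exists_desc t ht

variable [HasLimits V]

/-- The contraction φ b ⊗ φ^ c ⊗ φ c ⟶ B(b, c) ⊗ φ c ⟶ φ b is dinatural in c, since the pairing is
natural in c and the action on φ is associative. -/
theorem exists_coevaluation (φ : EnrichedFunctor V Bᵒᵖ V) (b : B) :
    ∃ d : φ.obj (op b) ⊗ colimObj φ (dual φ) ⟶ φ.obj (op b), ∀ c,
      φ.obj (op b) ◁ colimInj φ (dual φ) c ≫ d =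
        (α_ _ _ _).inv ≫ pairing φ b c ▷ φ.obj (op c) ≫ lact φ b c := by
  refine exists_colim_tensorLeft_desc _ fun c d => ?_
  rw [associator_inv_naturality_middle_assoc, ← comp_whiskerRight_assoc, pairing_natural_right,
    associator_inv_naturality_right_assoc, whisker_exchange_assoc]
  simp only [comp_whiskerRight, Category.assoc, lact_comp]
  simp

/-- The morphism `φ b ⊗ (φ * [Bᵒᵖ, V](φ, Y-)) ⟶ φ b` induced by the pairing of `φ` with its
dual. -/
def dualEval (φ : EnrichedFunctor V Bᵒᵖ V) (b : B) :
    φ.obj (op b) ⊗ colimObj φ (dual φ) ⟶ φ.obj (op b) := (exists_coevaluation φ b).choose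

theorem inj_dualEval (φ : EnrichedFunctor V Bᵒᵖ V) (b c : B) :
    φ.obj (op b) ◁ colimInj φ (dual φ) c ≫ dualEval φ b =
      (α_ _ _ _).inv ≫ pairing φ b c ▷ φ.obj (op c) ≫ lact φ b c :=
  (exists_coevaluation φ b).choose_spec c

/-- A dual basis of `φ`: an element of `φ * [Bᵒᵖ, V](φ, Y-)` corresponding to the identity of
`φ`. -/
def IsDualBasis (φ : EnrichedFunctor V Bᵒᵖ V) (η : 𝟙_ V ⟶ colimObj φ (dual φ)) : Prop :=
  ∀ b, φ.obj (op b) ◁ η ≫ dualEval φ b = (ρ_ _).hom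

/-! ### Absoluteness of colimits and limits weighted by a weight with a dual basis -/

section Absolute

variable {A : Type*} [EnrichedCategory V A] {D : Type*} [EnrichedCategory V D]

/-- Colimits weighted by a weight with a dual basis are absolute. -/
theorem IsDualBasis.isUniversalUnit_map {φ : EnrichedFunctor V Bᵒᵖ V}
    {η : 𝟙_ V ⟶ colimObj φ (dual φ)} (hη : IsDualBasis φ η) {S : EnrichedFunctor V B A} {C : A}
    {μ : ∀ b : B, φ.obj (op b) ⟶ 𝓗[V] (S.obj b) C} (h : IsUniversalUnit φ S C μ)
    (H : EnrichedFunctor V A D) :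
    IsUniversalUnit φ (S.comp V H) (H.obj C) (fun b => μ b ≫ H.map (S.obj b) C) := by
  -- An element ξ of φ^ c gives a cocone φ b ⟶ B(b, c) ⟶ A(S b, S c), and so a map `ν c` from the
  -- colimit C back to S c.
  choose ν hν using fun c => (h.2 (S.obj c) ((dual φ).obj c)
    (fun b => pairing φ b c ≫ S.map b c) (fun a b => by
      rw [← Category.assoc, pairing_natural_left, Category.assoc, Category.assoc,
        comp_eComp_map])).exists
  have hν' : ∀ b c, act (dual φ) b c ≫ ν c = star (ν b) (S.map b c) := fun b c =>
    h.hom_ext fun a => by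
      rw [star_comp, hν, star_star, hν, ← Category.assoc, pairing_natural_right]
      simp only [Category.assoc]
      rw [S.map_comp, ← tensorHom_id, tensorHom_comp_tensorHom_assoc, Category.id_comp]
      rfl
  have hnat : ∀ a b, lact φ a b ≫ μ a ≫ H.map (S.obj a) C =
      star (S.map a b ≫ H.map _ _) (μ b ≫ H.map _ _) := by
    intro a b
    rw [← Category.assoc, h.1, star_map]
  have hμν : ∀ b c, star (μ b ≫ H.map (S.obj b) C) (ν c ≫ H.map C (S.obj c)) =
      pairing φ b c ≫ S.map b c ≫ H.map (S.obj b) (S.obj c) := by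
    intro b c
    rw [← star_map, hν, Category.assoc]
  -- `Θ` sends ξ ⊗ u to the endomorphism of C that goes to S b by ν(ξ) and returns by μ(u). Since μ
  -- followed by `Θ` is governed by `dualEval`, the dual basis is sent to the identity of C. This
  -- factorisation is preserved by any functor H.
  obtain ⟨Θ, hΘ⟩ := exists_colim_desc (φ := φ) (F := dual φ) (fun b => star (ν b) (μ b))
    fun b c => by
      rw [← comp_star, hν', ← star_comp, h.1, star_star]
  have hμΘ : ∀ b, star (μ b) Θ = dualEval φ b ≫ μ b := by
    intro b
    refine colim_tensorLeft_hom_ext fun c => ?_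
    rw [← star_comp, hΘ, star_star, hν, comp_star, ← h.1, ← Category.assoc (_ ◁ _), inj_dualEval]
    simp only [Category.assoc]
  have hid : η ≫ Θ = eId V C := h.hom_ext fun b => by
    rw [star_comp, hμΘ, ← Category.assoc, hη b, ← Iso.eq_inv_comp]
    exact (post_id (μ b)).symm
  refine ⟨hnat, fun a X (f : ∀ b, φ.obj (op b) ⊗ X ⟶ 𝓗[V] (H.obj (S.obj b)) a) hf0 => ?_⟩
  have hf : ∀ b c, lact φ b c ▷ X ≫ f b =
      (α_ _ _ _).hom ≫ star (S.map b c ≫ H.map (S.obj b) (S.obj c)) (f c) := hf0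
  -- A cocone `f` on the image diagram is extended to H C by going back along H(ν) and then applying
  -- `f`; the required map is this one evaluated at η.
  obtain ⟨Λ, hΛ⟩ := exists_colim_tensor_desc (φ := φ) (F := dual φ)
    (fun b => (α_ _ _ _).hom ≫ star (ν b ≫ H.map C (S.obj b)) (f b)) (fun b c => by
      rw [associator_naturality_middle_assoc, ← star_comp, hf, associator_naturality_left_assoc,
        ← comp_star, ← Category.assoc (act _ _ _), hν', star_map,
        star_comp (α_ _ _ _).hom, star_star]
      simp)
  have hμΛ : ∀ b, star (μ b ≫ H.map (S.obj b) C) Λ =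
      (α_ _ _ _).inv ≫ dualEval φ b ▷ X ≫ f b := by
    intro b
    refine colim_tensor_tensor_hom_ext fun c => ?_
    rw [← star_comp, hΛ, star_comp, star_star, hμν, associator_inv_naturality_middle_assoc,
      ← comp_whiskerRight_assoc, inj_dualEval]
    simp only [comp_whiskerRight, Category.assoc]
    rw [hf, comp_star]
    simp
  refine ⟨(λ_ X).inv ≫ η ▷ X ≫ Λ, fun b => ?_, fun l hl => ?_⟩
  · change star (μ b ≫ H.map (S.obj b) C) _ = f b
    rw [star_comp, star_comp, hμΛ, associator_inv_naturality_middle_assoc,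
      ← comp_whiskerRight_assoc, hη]
    simp
  · have hl' : ∀ b, star (μ b ≫ H.map (S.obj b) C) l = f b := hl
    -- For uniqueness, any solution `l` satisfies `Λ` = H(`Θ`) followed by `l`, and evaluating at η
    -- turns H(`Θ`) into the identity of H C.
    have hΛ' : star (Θ ≫ H.map C C) l = Λ := colim_tensor_hom_ext fun b => by
      rw [← comp_star, ← Category.assoc, hΘ, hΛ, star_map, star_star', hl']
    rw [← hΛ', ← comp_star, ← Category.assoc η, hid, H.map_id]
    exact (pre_id l).symm

/-- Every `V`-functor preserves limits weighted by a weight with a dual basis. -/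
theorem IsDualBasis.preservesWeightedLimit {φ : EnrichedFunctor V Bᵒᵖ V}
    {η : 𝟙_ V ⟶ colimObj φ (dual φ)} (hη : IsDualBasis φ η) (H : EnrichedFunctor V A D)
    (T : EnrichedFunctor V Bᵒᵖ A) : PreservesWeightedLimit H φ T := fun L μ hL =>
  (isWeightedLimit_iff_isUniversalUnit φ (T.comp V H) (H.obj L) _).2
    (hη.isUniversalUnit_map ((isWeightedLimit_iff_isUniversalUnit φ T L μ).1 hL) (opFunctor H))

end Absolute

end DualBasis

/-! ### Representability of `φ * -` from a dual basis -/

section Representability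

variable {V : Type u} [Category.{v} V] [MonoidalCategory V] [MonoidalClosed V]
  [SymmetricCategory V] [HasLimits V] [HasColimits V]
variable {B : Type w} [EnrichedCategory V B] [IsSmall V B]

/-- The action `[B, V](F, G) ⊗ (φ * F) ⟶ φ * G`. -/
def colimAct (φ : EnrichedFunctor V Bᵒᵖ V) (F G : EnrichedFunctor V B V) :
    𝓗[V] F G ⊗ colimObj φ F ⟶ colimObj φ G := (β_ _ _).hom ≫ euncurry (colimMap φ F G)

theorem euncurry_colimMap_comp (φ : EnrichedFunctor V Bᵒᵖ V) (F G H : EnrichedFunctor V B V) :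
    colimObj φ F ◁ eComp V F G H ≫ euncurry (colimMap φ F H) =
      (α_ _ _ _).inv ≫ euncurry (colimMap φ F G) ▷ 𝓗[V] G H ≫ euncurry (colimMap φ G H) :=
  act_comp (colimFunctor φ) F G H

/-- This is `star_colimMap` with the transformation moved to the left, where the braidings
disappear: φ * - acts through the components. -/
theorem inj_colimAct (φ : EnrichedFunctor V Bᵒᵖ V) (F G : EnrichedFunctor V B V) (b : B) :
    𝓗[V] F G ◁ colimInj φ F b ≫ colimAct φ F G =
      (α_ _ _ _).inv ≫ evRight F G b ▷ φ.obj (op b) ≫ colimInj φ G b := by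
  have h := congrArg euncurry (star_colimMap φ F G (op b))
  rw [euncurry_star, euncurry_comp, euncurry_star, Iso.inv_comp_eq] at h
  rw [colimAct, braiding_naturality_right_assoc]
  refine (congrArg (fun t => (β_ _ _).hom ≫ t) h).trans ?_
  change (β_ (𝓗[V] F G) (F.obj b ⊗ φ.obj (op b))).hom ≫ (α_ _ _ _).hom ≫
    F.obj b ◁ (β_ (φ.obj (op b)) (𝓗[V] F G)).hom ≫ (α_ _ _ _).inv ≫
      euncurry (natProj F G b) ▷ φ.obj (op b) ≫ colimInj φ G b = _
  simp only [braiding_tensor_right_hom, Category.assoc, Iso.inv_hom_id_assoc,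
    whiskerLeft_symmetry_aux, Iso.hom_inv_id_assoc, evRight, comp_whiskerRight]

/-- The maps F b ⊗ φ b ⊗ φ^ c ⟶ F b ⊗ B(b, c) ⟶ F c are dinatural in b, by naturality of the pairing
and associativity of the action on F. -/
theorem exists_dualPairing (φ : EnrichedFunctor V Bᵒᵖ V) (F : EnrichedFunctor V B V) (c : B) :
    ∃ d : colimObj φ F ⊗ (dual φ).obj c ⟶ F.obj c, ∀ b,
      colimInj φ F b ▷ (dual φ).obj c ≫ d =
        (α_ _ _ _).hom ≫ F.obj b ◁ pairing φ b c ≫ act F b c := by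
  refine exists_colim_tensor_desc _ fun a b => ?_
  rw [associator_naturality_middle_assoc, ← MonoidalCategory.whiskerLeft_comp_assoc,
    pairing_natural_left, associator_naturality_left_assoc, ← whisker_exchange_assoc]
  simp only [MonoidalCategory.whiskerLeft_comp, Category.assoc, act_comp]
  simp

/-- The morphism `(φ * F) ⊗ [Bᵒᵖ, V](φ, B(-, c)) ⟶ F c` induced by the pairing. -/
def dualPairing (φ : EnrichedFunctor V Bᵒᵖ V) (F : EnrichedFunctor V B V) (c : B) :
    colimObj φ F ⊗ (dual φ).obj c ⟶ F.obj c := (exists_dualPairing φ F c).choose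

theorem inj_dualPairing (φ : EnrichedFunctor V Bᵒᵖ V) (F : EnrichedFunctor V B V) (b c : B) :
    colimInj φ F b ▷ (dual φ).obj c ≫ dualPairing φ F c =
      (α_ _ _ _).hom ≫ F.obj b ◁ pairing φ b c ≫ act F b c :=
  (exists_dualPairing φ F c).choose_spec b

theorem isRightNatural_dualPairing (φ : EnrichedFunctor V Bᵒᵖ V) (F : EnrichedFunctor V B V) :
    IsRightNatural (dual φ) F (dualPairing φ F) := by
  intro c d
  rw [← cancel_epi (α_ _ _ _).inv]
  refine colim_tensor_hom_ext fun b => ?_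
  rw [Iso.inv_hom_id_assoc, ← whisker_exchange_assoc, inj_dualPairing,
    associator_inv_naturality_left_assoc, ← comp_whiskerRight_assoc, inj_dualPairing,
    associator_naturality_right_assoc, ← MonoidalCategory.whiskerLeft_comp_assoc,
    pairing_natural_right]
  simp only [MonoidalCategory.whiskerLeft_comp, comp_whiskerRight, Category.assoc, act_comp]
  simp

theorem exists_colimToHom (φ : EnrichedFunctor V Bᵒᵖ V) (F : EnrichedFunctor V B V) :
    ∃ l : colimObj φ F ⟶ 𝓗[V] (dual φ) F, ∀ c,
      l ▷ (dual φ).obj c ≫ evRight (dual φ) F c = dualPairing φ F c :=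
  exists_evRight (isRightNatural_dualPairing φ F)

/-- The canonical comparison `φ * F ⟶ [B, V]([Bᵒᵖ, V](φ, Y-), F)`. -/
def colimToHom (φ : EnrichedFunctor V Bᵒᵖ V) (F : EnrichedFunctor V B V) :
    colimObj φ F ⟶ 𝓗[V] (dual φ) F := (exists_colimToHom φ F).choose

theorem colimToHom_ev (φ : EnrichedFunctor V Bᵒᵖ V) (F : EnrichedFunctor V B V) (c : B) :
    colimToHom φ F ▷ (dual φ).obj c ≫ evRight (dual φ) F c = dualPairing φ F c :=
  (exists_colimToHom φ F).choose_spec c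

/-- On F b ⊗ φ b ⊗ φ^ c ⊗ φ c, both sides contract the middle factors to B(b, c); it then acts on F
b or on φ c, and dinaturality of the coprojections identifies the two. Inserting η gives one of the
inverse laws for `colimToHom`. -/
theorem inj_colimToHom_colimAct (φ : EnrichedFunctor V Bᵒᵖ V) (F : EnrichedFunctor V B V) (b : B) :
    (colimInj φ F b ≫ colimToHom φ F) ▷ _ ≫ colimAct φ (dual φ) F =
      (α_ _ _ _).hom ≫ F.obj b ◁ dualEval φ b ≫ colimInj φ F b := by
  refine colim_tensorLeft_hom_ext fun c => ?_
  rw [whisker_exchange_assoc, inj_colimAct, associator_inv_naturality_left_assoc,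
    ← comp_whiskerRight_assoc, comp_whiskerRight _ _ ((dual φ).obj c), Category.assoc,
    colimToHom_ev, inj_dualPairing, associator_naturality_right_assoc,
    ← MonoidalCategory.whiskerLeft_comp_assoc, inj_dualEval]
  simp only [MonoidalCategory.whiskerLeft_comp, comp_whiskerRight, Category.assoc]
  rw [← colimInj_dinatural]
  simp

/-- Naturality of `dualPairing` in F, which is naturality of a transformation F ⟶ G with respect to
the action of B(b, c). -/
theorem colimAct_dualPairing (φ : EnrichedFunctor V Bᵒᵖ V) (F G : EnrichedFunctor V B V) (c : B) :
    colimAct φ F G ▷ (dual φ).obj c ≫ dualPairing φ G c =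
      (α_ _ _ _).hom ≫ 𝓗[V] F G ◁ dualPairing φ F c ≫ evRight F G c := by
  rw [← Iso.inv_comp_eq]
  refine colim_tensor_tensor_hom_ext fun b => ?_
  rw [associator_inv_naturality_middle_assoc, ← comp_whiskerRight_assoc, inj_colimAct,
    ← MonoidalCategory.whiskerLeft_comp_assoc, inj_dualPairing]
  simp only [MonoidalCategory.whiskerLeft_comp, comp_whiskerRight, Category.assoc]
  rw [inj_dualPairing]
  have h := isRightNatural_evRight F G b c
  rw [← Iso.eq_inv_comp] at h
  rw [h]
  rw [associator_inv_naturality_right_assoc, whisker_exchange_assoc,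
    associator_naturality_left_assoc]
  simp

/-- Both sides contract φ b ⊗ φ^ d ⊗ φ d ⊗ φ^ c to B(b, d) ⊗ B(d, c) and compose. -/
theorem dualPairing_dual_pairing (φ : EnrichedFunctor V Bᵒᵖ V) (b c : B) :
    φ.obj (op b) ◁ dualPairing φ (dual φ) c ≫ pairing φ b c =
      (α_ _ _ _).inv ≫ dualEval φ b ▷ (dual φ).obj c ≫ pairing φ b c := by
  refine colim_tensor_tensor_hom_ext fun d => ?_
  rw [associator_inv_naturality_middle_assoc, ← comp_whiskerRight_assoc, inj_dualEval,
    ← MonoidalCategory.whiskerLeft_comp_assoc, inj_dualPairing]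
  simp only [MonoidalCategory.whiskerLeft_comp, comp_whiskerRight, Category.assoc]
  rw [pairing_natural_left, pairing_natural_right]
  rw [associator_inv_naturality_right_assoc, whisker_exchange_assoc,
    associator_naturality_left_assoc]
  simp

variable {φ : EnrichedFunctor V Bᵒᵖ V} {η : 𝟙_ V ⟶ colimObj φ (dual φ)}

/-- The second triangle identity. It comes for free from the first, which defines a dual basis,
because maps into φ^ are detected by pairing with φ. -/
theorem IsDualBasis.whiskerRight_dualPairing (hη : IsDualBasis φ η) (c : B) :
    η ▷ (dual φ).obj c ≫ dualPairing φ (dual φ) c = (λ_ _).hom := by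
  refine pairing_hom_ext fun b => ?_
  rw [MonoidalCategory.whiskerLeft_comp, Category.assoc, dualPairing_dual_pairing,
    associator_inv_naturality_middle_assoc, ← comp_whiskerRight_assoc, hη]
  simp

/-- A weight `φ` with a dual basis represents `φ * -`. -/
theorem IsDualBasis.isRepresentable (hη : IsDualBasis φ η) :
    IsRepresentable (colimFunctor φ) := by
  -- The inverse of `colimToHom` is the Yoneda map of η, sending α : φ^ ⟶ F to the image of η under
  -- φ * α.
  let h : ∀ F : EnrichedFunctor V B V, 𝓗[V] (dual φ) F ⟶ colimObj φ F := fun F =>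
    (ρ_ _).inv ≫ 𝓗[V] (dual φ) F ◁ η ≫ colimAct φ (dual φ) F
  have hgh : ∀ F, colimToHom φ F ≫ h F = 𝟙 _ := by
    intro F
    refine colimObj_hom_ext fun b => ?_
    change _ ≫ _ ≫ (ρ_ _).inv ≫ _ ◁ η ≫ _ = _
    rw [← Category.assoc, rightUnitor_inv_naturality_assoc, ← whisker_exchange_assoc,
      inj_colimToHom_colimAct, associator_naturality_right_assoc,
      ← MonoidalCategory.whiskerLeft_comp_assoc, hη]
    simp
  have hhg : ∀ F, h F ≫ colimToHom φ F = 𝟙 _ := by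
    intro F
    refine evRight_hom_ext fun c => ?_
    rw [comp_whiskerRight, Category.assoc, colimToHom_ev]
    change ((ρ_ _).inv ≫ _ ◁ η ≫ _) ▷ _ ≫ _ = _
    simp only [comp_whiskerRight, Category.assoc]
    rw [colimAct_dualPairing, associator_naturality_middle_assoc,
      ← MonoidalCategory.whiskerLeft_comp_assoc, hη.whiskerRight_dualPairing]
    simp
  have hh : ∀ F, h F = (λ_ _).inv ≫ η ▷ _ ≫ euncurry (colimMap φ (dual φ) F) := by
    intro F
    change (ρ_ _).inv ≫ _ ◁ η ≫ (β_ _ _).hom ≫ _ = _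
    rw [braiding_naturality_right_assoc, rightUnitor_inv_braiding_assoc]
  -- Naturality is clear for the Yoneda map `h`, by functoriality of φ * -, and passes to its
  -- inverse `colimToHom`.
  have hnat : ∀ F G : EnrichedFunctor V B V, eComp V (dual φ) F G ≫ h G =
      h F ▷ 𝓗[V] F G ≫ euncurry (colimMap φ F G) := by
    intro F G
    rw [hh, hh, leftUnitor_inv_naturality_assoc, whisker_exchange_assoc]
    rw [euncurry_colimMap_comp]
    simp
  refine ⟨dual φ, fun F => ⟨colimToHom φ F, h F, hgh F, hhg F⟩, fun F G => ?_⟩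
  rw [act_representable]
  change euncurry (colimMap φ F G) ≫ colimToHom φ G = colimToHom φ F ▷ _ ≫ eComp V (dual φ) F G
  have h1 : eComp V (dual φ) F G =
      h F ▷ 𝓗[V] F G ≫ euncurry (colimMap φ F G) ≫ colimToHom φ G := by
    rw [← Category.assoc, ← hnat, Category.assoc, hhg, Category.comp_id]
  rw [h1, ← comp_whiskerRight_assoc, hgh, id_whiskerRight, Category.id_comp]

end Representability

/-! ### Small projectives and dual bases -/

section RepresentableLeftAdjoint

variable {V : Type u} [Category.{v} V] [MonoidalCategory V] [MonoidalClosed V]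
  [SymmetricCategory V]
variable {K : Type*} [EnrichedCategory V K] {A : Type*} [EnrichedCategory V A]

/-- A representable functor with a right adjoint preserves colimits. -/
theorem IsUniversalUnit.representable_map {x : A}
    (h : ∀ a : V, ∃ (r : A) (e : 𝓗[V] x r ⟶ a), ∀ (y : A) (X : V) (t : 𝓗[V] x y ⊗ X ⟶ a),
      ∃! s : X ⟶ 𝓗[V] y r, star (𝟙 (𝓗[V] x y)) s ≫ e = t)
    {φ : EnrichedFunctor V Kᵒᵖ V} {S : EnrichedFunctor V K A} {C : A}
    {μ : ∀ b : K, φ.obj (op b) ⟶ 𝓗[V] (S.obj b) C} (hμ : IsUniversalUnit φ S C μ) :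
    IsUniversalUnit φ (S.comp V (representable V x)) (𝓗[V] x C)
      (fun b => μ b ≫ (representable V x).map (S.obj b) C) := by
  have hnat : ∀ a b, lact φ a b ≫ μ a ≫ (representable V x).map (S.obj a) C =
      star (S.map a b ≫ (representable V x).map _ _) (μ b ≫ (representable V x).map _ _) := by
    intro a b
    rw [← Category.assoc, hμ.1, star_map]
  refine ⟨hnat, fun a X (f : ∀ b, φ.obj (op b) ⊗ X ⟶ 𝓗[V] (𝓗[V] x (S.obj b)) a) hf0 => ?_⟩
  have hf : ∀ b c, lact φ b c ▷ X ≫ f b =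
      (α_ _ _ _).hom ≫ star (S.map b c ≫ (representable V x).map (S.obj b) (S.obj c)) (f c) := hf0
  obtain ⟨r, e, he⟩ := h a
  have hinj : ∀ {y : A} {X : V} {s s' : X ⟶ 𝓗[V] y r},
      star (𝟙 (𝓗[V] x y)) s ≫ e = star (𝟙 (𝓗[V] x y)) s' ≫ e → s = s' :=
    fun h => (he _ _ _).unique h rfl
  -- Each component of the cocone is transposed across the adjunction to A(S b, r), where the
  -- universal property of C applies.
  choose s hs hs' using fun b => he (S.obj b) _ (euncurry (f b))
  have hs2 : ∀ b, star (𝟙 (𝓗[V] x (S.obj b))) (s b) ≫ e = euncurry (f b) := hs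
  have hstar : ∀ {l : X ⟶ 𝓗[V] C r} (b : K),
      star (μ b ≫ (representable V x).map (S.obj b) C) (ecurry (star (𝟙 (𝓗[V] x C)) l ≫ e)) =
        ecurry (star (𝟙 (𝓗[V] x (S.obj b))) (star (μ b) l) ≫ e) := by
    intro l b
    refine euncurry_inj ?_
    rw [euncurry_star, euncurry_comp_representable, euncurry_ecurry, euncurry_ecurry,
      star_star, ← Category.assoc (star _ _ ▷ _), ← comp_star, Category.comp_id, Category.assoc]
  obtain ⟨l, hl, hl'⟩ := hμ.2 r X s fun b c => hinj (by
    rw [star_comp, Category.assoc, hs2, star_comp, star_star, ← euncurry_comp, hf, euncurry_comp,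
      euncurry_star, euncurry_comp_representable, ← hs2]
    simp only [Category.assoc]
    rw [← Category.assoc (star _ _ ▷ _), ← comp_star, Category.comp_id])
  refine ⟨ecurry (star (𝟙 (𝓗[V] x C)) l ≫ e), fun b => ?_, fun l' hl2 => ?_⟩
  · refine (hstar b).trans ?_
    rw [hl, hs2, ecurry_euncurry]
  -- A competitor `l'` is itself the transpose of some `k`, and uniqueness is then that of the
  -- factorisation through C.
  · obtain ⟨k, hk, -⟩ := he C X (euncurry l')
    have hk2 : star (𝟙 (𝓗[V] x C)) k ≫ e = euncurry l' := hk
    have hk3 : l' = ecurry (star (𝟙 (𝓗[V] x C)) k ≫ e) := by rw [hk2, ecurry_euncurry]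
    rw [hk3]
    rw [hl' k fun b => hinj ?_]
    rw [hs2, ← hl2 b, hk3]
    refine Eq.trans ?_ (congrArg euncurry (hstar (l := k) b).symm)
    rw [euncurry_ecurry]

end RepresentableLeftAdjoint

/-! ### The presheaf `b ↦ [F b, a]`, the candidate value of the right adjoint -/

section HomInto

variable {V : Type u} [Category.{v} V] [MonoidalCategory V] [MonoidalClosed V]
  [SymmetricCategory V]
variable {B : Type w} [EnrichedCategory V B]

/-- The presheaf `b ↦ [F b, a]`. -/
def homInto (F : EnrichedFunctor V B V) (a : V) : EnrichedFunctor V Bᵒᵖ V :=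
  homFunctor (op a) (opFunctor F)

/-- The evaluation `F b ⊗ [F b, a] ⟶ a`. -/
def homIntoEval (F : EnrichedFunctor V B V) (a : V) (b : B) :
    F.obj b ⊗ (homInto F a).obj (op b) ⟶ a := euncurry (B := a) (𝟙 (𝓗[V] (F.obj b) a))

theorem homIntoEval_hom_ext {F : EnrichedFunctor V B V} {a : V} {b : B} {X : V}
    {p q : X ⟶ (homInto F a).obj (op b)}
    (h : F.obj b ◁ p ≫ homIntoEval F a b = F.obj b ◁ q ≫ homIntoEval F a b) : p = q := by
  have hp : ∀ p : X ⟶ 𝓗[V] (F.obj b) a, euncurry p = F.obj b ◁ p ≫ homIntoEval F a b := by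
    intro p
    refine Eq.trans ?_ (euncurry_comp p (𝟙 (𝓗[V] (F.obj b) a)))
    rw [Category.comp_id]
  exact euncurry_inj (A := F.obj b) (B := a) ((hp p).trans (h.trans (hp q).symm))

theorem exists_homIntoEval {F : EnrichedFunctor V B V} {a : V} {b : B} {X : V}
    (f : F.obj b ⊗ X ⟶ a) :
    ∃ p : X ⟶ (homInto F a).obj (op b), F.obj b ◁ p ≫ homIntoEval F a b = f := by
  refine ⟨ecurry (A := F.obj b) (B := a) f, ?_⟩
  refine (euncurry_comp (A := F.obj b) (B := a) (ecurry f) (𝟙 (𝓗[V] (F.obj b) a))).symm.trans ?_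
  exact (congrArg euncurry (Category.comp_id _)).trans (euncurry_ecurry f)

/-- The action on [F -, a] is precomposition with the action on F, which makes evaluation dinatural.
-/
theorem lact_homInto (F : EnrichedFunctor V B V) (a : V) (b c : B) :
    F.obj b ◁ lact (homInto F a) b c ≫ homIntoEval F a b =
      (α_ _ _ _).inv ≫ act F b c ▷ _ ≫ homIntoEval F a c := by
  have h : lact (homInto F a) b c = star (F.map b c) (𝟙 (𝓗[V] (F.obj c) a)) := by
    have h1 := lact_homFunctor (opFunctor F) (op a) b c
      (𝟙 (𝓗[V] (op a) ((opFunctor F).obj (op c))))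
    rw [MonoidalCategory.whiskerLeft_id, Category.id_comp, star_op,
      SymmetricCategory.symmetry_assoc] at h1
    exact h1
  refine (congrArg (fun t => F.obj b ◁ t ≫ homIntoEval F a b) h).trans ?_
  refine (euncurry_comp (A := F.obj b) (B := a) (star (F.map b c) (𝟙 (𝓗[V] (F.obj c) a)))
    (𝟙 (𝓗[V] (F.obj b) a))).symm.trans ?_
  refine (congrArg euncurry (Category.comp_id _)).trans ?_
  rw [euncurry_star]
  rfl

end HomInto

/-! ### Small projectivity from a dual basis -/

section SmallProjective

variable {V : Type u} [Category.{v} V] [MonoidalCategory V] [MonoidalClosed V]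
  [SymmetricCategory V] [HasLimits V]
variable {B : Type w} [EnrichedCategory V B] [IsSmall V B]

/-- Composition `[Bᵒᵖ, V](φ, B(-, b)) ⊗ F b ⟶ [Bᵒᵖ, V](φ, F)`. -/
def dualComp (φ F : EnrichedFunctor V Bᵒᵖ V) (b : B) :
    (dual φ).obj b ⊗ F.obj (op b) ⟶ 𝓗[V] φ F :=
  star (𝟙 (𝓗[V] φ (presheaf V b))) (yonedaHom F b)

theorem dualComp_ev (φ F : EnrichedFunctor V Bᵒᵖ V) (a b : B) :
    φ.obj (op a) ◁ dualComp φ F b ≫ evLeft φ F a =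
      (α_ _ _ _).inv ≫ pairing φ a b ▷ F.obj (op b) ≫ lact F a b := by
  rw [← yonedaHom_ev]
  refine (evLeft_star (𝟙 (𝓗[V] φ (presheaf V b))) (yonedaHom F b) a).trans ?_
  rw [MonoidalCategory.whiskerLeft_id, Category.id_comp]
  rfl

theorem dualComp_dinatural (φ F : EnrichedFunctor V Bᵒᵖ V) (b c : B) :
    (dual φ).obj b ◁ lact F b c ≫ dualComp φ F b =
      (α_ _ _ _).inv ≫ act (dual φ) b c ▷ F.obj (op c) ≫ dualComp φ F c := by
  have h := star_comp (lact F b c) (𝟙 (𝓗[V] φ (presheaf V b))) (yonedaHom F b)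
  refine h.symm.trans ?_
  rw [lact_yonedaHom, star_star, act_dual]
  refine congrArg (fun t => (α_ _ _ _).inv ≫ t) ?_
  refine Eq.trans ?_ (comp_star _ _ _)
  exact congrArg (fun t => star t _) (Category.comp_id _).symm

/-- Composing the Yoneda transformation of an element y of F b with s : F ⟶ G gives the Yoneda
transformation of s(y), so `dualComp` is natural in its second argument. -/
theorem dualComp_star (φ : EnrichedFunctor V Bᵒᵖ V) {F G : EnrichedFunctor V Bᵒᵖ V} {X : V}
    (s : X ⟶ 𝓗[V] F G) (b : B) :
    dualComp φ F b ▷ X ≫ star (𝟙 (𝓗[V] φ F)) s =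
      (α_ _ _ _).hom ≫ (dual φ).obj b ◁ (F.obj (op b) ◁ s ≫ evLeft F G b) ≫ dualComp φ G b := by
  have h : star (yonedaHom F b) s = (F.obj (op b) ◁ s ≫ evLeft F G b) ≫ yonedaHom G b := by
    refine yonedaEval_inj ?_
    rw [star_yonedaHom_eval, Category.assoc, yonedaHom_eval, Category.comp_id]
  have h2 := star_star' (𝟙 (𝓗[V] φ (presheaf V b))) (yonedaHom F b) s
  rw [h, star_comp] at h2
  rw [← comp_star, Category.comp_id]
  exact h2

variable [HasColimits V]

variable {φ : EnrichedFunctor V Bᵒᵖ V} {η : 𝟙_ V ⟶ colimObj φ (dual φ)}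

/-- The hypothesis presents [Bᵒᵖ, V](φ, φ) as a colimit φ * φ^. The comparison `m` to the chosen
colimit turns evaluation into `dualEval`, so the image of the identity of φ is a dual basis. -/
theorem exists_isDualBasis (h : IsUniversalUnit φ (dual φ) (𝓗[V] φ φ)
    (fun b => yonedaHom φ b ≫ (representable V φ).map (presheaf V b) φ)) :
    ∃ η, IsDualBasis φ η := by
  have hinj : ∀ b, euncurry (yonedaHom φ b ≫ (representable V φ).map (presheaf V b) φ) =
      dualComp φ φ b := fun b => euncurry_comp_representable _
  obtain ⟨m, hm⟩ := h.exists_desc (fun b => colimInj φ (dual φ) b)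
    (fun b c => colimInj_dinatural φ (dual φ) b c)
  have hm' : ∀ b, dualComp φ φ b ≫ m = colimInj φ (dual φ) b := by
    intro b
    rw [← hinj]
    exact hm b
  have key : ∀ a, φ.obj (op a) ◁ m ≫ dualEval φ a = evLeft φ φ a := by
    intro a
    refine h.tensorLeft_hom_ext fun b => ?_
    have h1 : φ.obj (op a) ◁ dualComp φ φ b ≫ φ.obj (op a) ◁ m ≫ dualEval φ a =
        φ.obj (op a) ◁ dualComp φ φ b ≫ evLeft φ φ a := by
      rw [← MonoidalCategory.whiskerLeft_comp_assoc, hm', inj_dualEval, dualComp_ev]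
    rw [← hinj] at h1
    exact h1
  refine ⟨eId V φ ≫ m, fun a => ?_⟩
  rw [MonoidalCategory.whiskerLeft_comp, Category.assoc, key, evLeft_id]

/-- Here `k` sends ξ ⊗ u and α : φ ⟶ F to ξ followed by the Yoneda transformation of α(u). -/
theorem exists_dualBasisExpansion (φ F : EnrichedFunctor V Bᵒᵖ V) :
    ∃ k : colimObj φ (dual φ) ⊗ 𝓗[V] φ F ⟶ 𝓗[V] φ F, ∀ b, colimInj φ (dual φ) b ▷ 𝓗[V] φ F ≫ k =
      (α_ _ _ _).hom ≫ (dual φ).obj b ◁ evLeft φ F b ≫ dualComp φ F b := by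
  refine exists_colim_tensor_desc _ fun b c => ?_
  have h := isLeftNatural_evLeft φ F b c
  rw [associator_naturality_middle_assoc, ← MonoidalCategory.whiskerLeft_comp_assoc, h,
    associator_naturality_left_assoc, ← whisker_exchange_assoc]
  simp only [MonoidalCategory.whiskerLeft_comp, Category.assoc]
  rw [dualComp_dinatural]
  simp

/-- Informally, α = Σ α(uᵢ) ξᵢ. On an element u, the right-hand side is α(Σ ξᵢ(u) uᵢ) by naturality
of α, which is α(u). -/
theorem IsDualBasis.expansion (hη : IsDualBasis φ η) {F : EnrichedFunctor V Bᵒᵖ V}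
    {k : colimObj φ (dual φ) ⊗ 𝓗[V] φ F ⟶ 𝓗[V] φ F}
    (hk : ∀ b, colimInj φ (dual φ) b ▷ 𝓗[V] φ F ≫ k =
      (α_ _ _ _).hom ≫ (dual φ).obj b ◁ evLeft φ F b ≫ dualComp φ F b) :
    η ▷ 𝓗[V] φ F ≫ k = (λ_ _).hom := by
  refine evLeft_hom_ext fun a => ?_
  have key : φ.obj (op a) ◁ k ≫ evLeft φ F a =
      (α_ _ _ _).inv ≫ dualEval φ a ▷ _ ≫ evLeft φ F a := by
    refine colim_tensor_tensor_hom_ext fun b => ?_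
    have h := isLeftNatural_evLeft φ F a b
    rw [← MonoidalCategory.whiskerLeft_comp_assoc, hk, associator_inv_naturality_middle_assoc,
      ← comp_whiskerRight_assoc, inj_dualEval]
    simp only [MonoidalCategory.whiskerLeft_comp, comp_whiskerRight, Category.assoc]
    rw [h, dualComp_ev, associator_inv_naturality_right_assoc, whisker_exchange_assoc,
      associator_naturality_left_assoc]
    simp
  rw [MonoidalCategory.whiskerLeft_comp, Category.assoc, key,
    associator_inv_naturality_middle_assoc, ← comp_whiskerRight_assoc, hη]
  simp

/-- This is the trace-like map sending ξ ⊗ u and α : φ ⟶ [φ^ -, a] to α(u) evaluated at ξ; with η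
inserted it is the counit of the adjunction. -/
theorem exists_homIntoCounit (φ : EnrichedFunctor V Bᵒᵖ V) (a : V) :
    ∃ q : colimObj φ (dual φ) ⊗ 𝓗[V] φ (homInto (dual φ) a) ⟶ a, ∀ b,
      colimInj φ (dual φ) b ▷ _ ≫ q = (α_ _ _ _).hom ≫
        (dual φ).obj b ◁ evLeft φ (homInto (dual φ) a) b ≫ homIntoEval (dual φ) a b := by
  refine exists_colim_tensor_desc _ fun b c => ?_
  have h := isLeftNatural_evLeft φ (homInto (dual φ) a) b c
  rw [associator_naturality_middle_assoc, ← MonoidalCategory.whiskerLeft_comp_assoc, h,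
    associator_naturality_left_assoc, ← whisker_exchange_assoc]
  simp only [MonoidalCategory.whiskerLeft_comp, Category.assoc]
  rw [lact_homInto]
  simp

/-- For a weight `φ` with a dual basis, `[Bᵒᵖ, V](φ, -)` has a right adjoint. -/
theorem IsDualBasis.exists_rightAdjoint (hη : IsDualBasis φ η) (a : V) :
    ∃ (r : EnrichedFunctor V Bᵒᵖ V) (e : 𝓗[V] φ r ⟶ a),
      ∀ (F : EnrichedFunctor V Bᵒᵖ V) (X : V) (t : 𝓗[V] φ F ⊗ X ⟶ a),
        ∃! s : X ⟶ 𝓗[V] F r, star (𝟙 (𝓗[V] φ F)) s ≫ e = t := by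
  obtain ⟨q, hq⟩ := exists_homIntoCounit φ a
  refine ⟨homInto (dual φ) a, (λ_ _).inv ≫ η ▷ _ ≫ q, fun F X t => ?_⟩
  -- On ξ followed by the Yoneda transformation of y, the counit returns y(ξ); this is where the
  -- second triangle identity enters.
  have hcounit : ∀ b, dualComp φ (homInto (dual φ) a) b ≫ (λ_ _).inv ≫ η ▷ _ ≫ q =
      homIntoEval (dual φ) a b := by
    intro b
    have key : colimObj φ (dual φ) ◁ dualComp φ (homInto (dual φ) a) b ≫ q =
        (α_ _ _ _).inv ≫ dualPairing φ (dual φ) b ▷ _ ≫ homIntoEval (dual φ) a b := by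
      refine colim_tensor_hom_ext fun c => ?_
      rw [← whisker_exchange_assoc, hq, associator_naturality_right_assoc,
        ← MonoidalCategory.whiskerLeft_comp_assoc, dualComp_ev,
        associator_inv_naturality_left_assoc, ← comp_whiskerRight_assoc, inj_dualPairing]
      simp only [MonoidalCategory.whiskerLeft_comp, comp_whiskerRight, Category.assoc]
      rw [lact_homInto]
      simp
    rw [leftUnitor_inv_naturality_assoc, whisker_exchange_assoc, key,
      associator_inv_naturality_left_assoc, ← comp_whiskerRight_assoc, hη.whiskerRight_dualPairing]
    simp
  -- By the dual basis expansion, it suffices to know that `s` corresponds to `t` on transformations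
  -- of the form `dualComp`.
  have hstar : ∀ (s : X ⟶ 𝓗[V] F (homInto (dual φ) a)),
      (∀ b, (dual φ).obj b ◁ (F.obj (op b) ◁ s ≫ evLeft F _ b) ≫ homIntoEval (dual φ) a b =
        (α_ _ _ _).inv ≫ dualComp φ F b ▷ X ≫ t) →
      star (𝟙 (𝓗[V] φ F)) s ≫ (λ_ _).inv ≫ η ▷ _ ≫ q = t := by
    intro s hs
    obtain ⟨k, hk⟩ := exists_dualBasisExpansion φ F
    have key : colimObj φ (dual φ) ◁ star (𝟙 (𝓗[V] φ F)) s ≫ q =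
        (α_ _ _ _).inv ≫ k ▷ X ≫ t := by
      refine colim_tensor_hom_ext fun b => ?_
      rw [← whisker_exchange_assoc, hq, associator_naturality_right_assoc,
        ← MonoidalCategory.whiskerLeft_comp_assoc, evLeft_star,
        associator_inv_naturality_left_assoc, ← comp_whiskerRight_assoc, hk,
        MonoidalCategory.whiskerLeft_id, Category.id_comp]
      simp only [MonoidalCategory.whiskerLeft_comp, comp_whiskerRight, Category.assoc] at hs ⊢
      rw [hs]
      simp
    rw [leftUnitor_inv_naturality_assoc, whisker_exchange_assoc, key,
      associator_inv_naturality_left_assoc, ← comp_whiskerRight_assoc, hη.expansion hk]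
    simp
  -- That condition dictates the transpose: its component at b is φ^ b ⊗ F b ⊗ X ⟶ [Bᵒᵖ, V](φ, F) ⊗
  -- X ⟶ a, curried in φ^ b.
  choose p hp using fun b => exists_homIntoEval (F := dual φ) (a := a) (b := b)
    ((α_ _ _ _).inv ≫ dualComp φ F b ▷ X ≫ t)
  obtain ⟨s, hs⟩ := exists_evLeft (φ := F) (G := homInto (dual φ) a) (f := p) fun b c =>
    homIntoEval_hom_ext (by
      rw [MonoidalCategory.whiskerLeft_comp, Category.assoc, hp,
        associator_inv_naturality_middle_assoc, ← comp_whiskerRight_assoc, dualComp_dinatural]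
      simp only [MonoidalCategory.whiskerLeft_comp, Category.assoc]
      rw [lact_homInto, associator_inv_naturality_right_assoc, whisker_exchange_assoc, hp]
      simp)
  refine ⟨s, hstar s fun b => by rw [hs, hp], fun s' hs' => evLeft_hom_ext fun b =>
    homIntoEval_hom_ext ?_⟩
  rw [hs, hp, ← hs', ← Category.assoc (dualComp φ F b ▷ X), dualComp_star]
  simp only [Category.assoc]
  rw [Iso.inv_hom_id_assoc, hcounit]

end SmallProjective

/-! ### Weighted limits in the base -/

section LimitsInBase

variable {V : Type u} [Category.{v} V] [MonoidalCategory V] [MonoidalClosed V]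
  [SymmetricCategory V]
variable {J : Type*} [EnrichedCategory V J] {A : Type*} [EnrichedCategory V A]

theorem isVNatural_homFunctor_iff (φ : EnrichedFunctor V J V) (T : EnrichedFunctor V J V) {a X : V}
    (h : ∀ j, φ.obj j ⊗ X ⟶ 𝓗[V] a (T.obj j)) :
    IsVNatural φ (homFunctor a T) (fun j => ecurry (h j)) ↔
      IsRightNatural φ T (fun j => (α_ a X (φ.obj j)).hom ≫ a ◁ (β_ _ _).hom ≫
        euncurry (h j)) := by
  refine (isVNatural_ecurry_iff φ T a h).trans (forall₂_congr fun j j' => ?_)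
  rw [← Function.Injective.eq_iff (f := euncurry (V := V)) (fun _ _ h => euncurry_inj h),
    euncurry_comp, euncurry_comp, euncurry_comp, euncurry_comp, euncurry_star,
    ← cancel_epi (((α_ a X (φ.obj j)).hom ≫ a ◁ (β_ X (φ.obj j)).hom) ▷ 𝓗[V] j j' ≫
      (α_ _ _ _).hom ≫ a ◁ (α_ _ _ _).hom)]
  have e : (α_ X (φ.obj j) (𝓗[V] j j')).hom ≫ (β_ X (φ.obj j ⊗ 𝓗[V] j j')).hom =
      (β_ _ _).hom ▷ _ ≫ (α_ _ _ _).hom ≫ φ.obj j ◁ (β_ X (𝓗[V] j j')).hom ≫ (α_ _ _ _).inv := by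
    rw [braiding_tensor_right_hom, Iso.hom_inv_id_assoc]
  have e1 : (((α_ a X (φ.obj j)).hom ≫ a ◁ (β_ X (φ.obj j)).hom) ▷ 𝓗[V] j j' ≫
      (α_ _ _ _).hom ≫ a ◁ (α_ _ _ _).hom) ≫ a ◁ φ.obj j ◁ (β_ X (𝓗[V] j j')).hom ≫
        a ◁ (α_ _ _ _).inv ≫ a ◁ act φ j j' ▷ X ≫ euncurry (h j') =
      (α_ (a ⊗ X) (φ.obj j) (𝓗[V] j j')).hom ≫ (a ⊗ X) ◁ act φ j j' ≫
        (α_ a X (φ.obj j')).hom ≫ a ◁ (β_ X (φ.obj j')).hom ≫ euncurry (h j') := by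
    have e' := congrArg (fun t => (α_ a X (φ.obj j)).hom ▷ 𝓗[V] j j' ≫ (α_ _ _ _).hom ≫
      a ◁ t ≫ a ◁ act φ j j' ▷ X ≫ euncurry (h j')) e
    simp only [MonoidalCategory.whiskerLeft_comp, Category.assoc, comp_whiskerRight,
      whisker_assoc] at e' ⊢
    rw [← MonoidalCategory.whiskerLeft_comp_assoc a (β_ _ _).hom (act φ j j' ▷ X),
      ← braiding_naturality_right] at e'
    simp only [Iso.inv_hom_id_assoc]
    refine e'.symm.trans ?_
    rw [MonoidalCategory.whiskerLeft_comp, Category.assoc,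
      pentagon_assoc, associator_naturality_right_assoc]
  have e2 : (((α_ a X (φ.obj j)).hom ≫ a ◁ (β_ X (φ.obj j)).hom) ▷ 𝓗[V] j j' ≫
      (α_ _ _ _).hom ≫ a ◁ (α_ _ _ _).hom) ≫ a ◁ (α_ _ _ _).inv ≫ (α_ _ _ _).inv ≫
        euncurry (h j) ▷ _ ≫ euncurry (T.map j j') =
      ((α_ a X (φ.obj j)).hom ≫ a ◁ (β_ _ _).hom ≫ euncurry (h j)) ▷ 𝓗[V] j j' ≫
        act T j j' := by
    simp [act]
  rw [e1, e2]

/-- Families φ j ⊗ X ⟶ [a, T j] uncurry to families (a ⊗ X) ⊗ φ j ⟶ T j, so in V it is enough to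
test against ordinary maps into L. -/
theorem isWeightedLimit_of_base {φ : EnrichedFunctor V J V} {T : EnrichedFunctor V J V} {L : V}
    {μ : ∀ j, φ.obj j ⟶ 𝓗[V] L (T.obj j)} (hμ : IsNaturalCounit φ T μ)
    (h : ∀ (X : V) (f : ∀ j, X ⊗ φ.obj j ⟶ T.obj j), IsRightNatural φ T f →
      ∃! l : X ⟶ L, ∀ j, l ▷ φ.obj j ≫ euncurry (μ j) = f j) : IsWeightedLimit φ T L μ := by
  refine fun a => ⟨isVNatural_limitComparison hμ a, fun X f hf => ?_⟩
  have hf' : f = fun j => ecurry (euncurry (f j)) := funext fun j => by simp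
  rw [hf'] at hf
  obtain ⟨l, hl, hl'⟩ := h _ _ ((isVNatural_homFunctor_iff φ T _).1 hf)
  have key : ∀ (k : X ⟶ 𝓗[V] a L) j, k ≫ limitComparison φ T μ a j = f j ↔
      euncurry k ▷ φ.obj j ≫ euncurry (μ j) =
        (α_ a X (φ.obj j)).hom ≫ a ◁ (β_ _ _).hom ≫ euncurry (euncurry (f j)) := by
    intro k j
    rw [comp_limitComparison]
    constructor
    · intro h
      have h' := congrArg (fun t => euncurry (euncurry t)) h
      simp only [euncurry_ecurry, euncurry_comp, euncurry_star] at h'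
      rw [← h', whiskerLeft_symmetry_aux, Iso.hom_inv_id_assoc]
    · intro h
      refine euncurry_inj (euncurry_inj ?_)
      rw [euncurry_ecurry, euncurry_comp, euncurry_star, h, Iso.inv_hom_id_assoc,
        whiskerLeft_symmetry_aux]
  refine ⟨ecurry l, fun j => (key _ j).2 (by rw [euncurry_ecurry, hl j]), fun k hk => ?_⟩
  rw [← hl' (euncurry k) fun j => (key k j).1 (hk j), ecurry_euncurry]

theorem IsWeightedLimit.exists_base_lift {φ : EnrichedFunctor V J V} {T : EnrichedFunctor V J V}
    {L : V} {μ : ∀ j, φ.obj j ⟶ 𝓗[V] L (T.obj j)} (h : IsWeightedLimit φ T L μ) {X : V}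
    {f : ∀ j, X ⊗ φ.obj j ⟶ T.obj j} (hf : IsRightNatural φ T f) :
    ∃ l : X ⟶ L, ∀ j, l ▷ φ.obj j ≫ euncurry (μ j) = f j := by
  -- An ordinary map X ⟶ L is a unit-parametrised element of [X, L], so the enriched property is
  -- used at `a = X` with the unit as parameter.
  obtain ⟨l, hl, -⟩ := (h X).2 (𝟙_ V) (fun j => ecurry ((β_ _ _).hom ≫ ecurry
    ((α_ _ _ _).inv ≫ (ρ_ X).hom ▷ φ.obj j ≫ f j))) ((isVNatural_homFunctor_iff φ T _).2 (by
      simp only [euncurry_comp, euncurry_ecurry, whiskerLeft_symmetry_aux, Iso.hom_inv_id_assoc]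
      intro j j'
      rw [whisker_exchange_assoc, ← associator_naturality_left_assoc, hf j j']
      simp))
  refine ⟨(ρ_ X).inv ≫ euncurry l, fun j => ?_⟩
  have h1 := (comp_limitComparison φ T μ l j).symm.trans (hl j)
  have h2 := congrArg (fun t => (β_ _ _).hom ≫ euncurry t) h1
  simp only [euncurry_ecurry, SymmetricCategory.symmetry_assoc] at h2
  have h3 := congrArg euncurry h2
  rw [euncurry_star, euncurry_ecurry, Iso.cancel_iso_inv_left] at h3
  rw [comp_whiskerRight, Category.assoc, h3, ← comp_whiskerRight_assoc]
  simp

/-- A `V`-functor isomorphic to a representable preserves all limits. -/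
theorem AreIsomorphic.preservesWeightedLimit {P : EnrichedFunctor V A V} {a : A}
    (hP : AreIsomorphic P (representable V a)) (φ : EnrichedFunctor V J V)
    (T : EnrichedFunctor V J A) : PreservesWeightedLimit P φ T := by
  obtain ⟨e, he⟩ := hP
  have he' : ∀ x y, act P x y ≫ (e y).hom = (e x).hom ▷ 𝓗[V] x y ≫ eComp V a x y := by
    intro x y
    rw [he, act_representable]
  intro L μ hL
  have hμ := hL.isNaturalCounit
  have hcounit : ∀ j j', act φ j j' ≫ μ j' ≫ P.map L (T.obj j') =
      star (μ j ≫ P.map L (T.obj j)) (T.map j j' ≫ P.map _ _) := by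
    intro j j'
    rw [← Category.assoc, hμ, star_map]
  -- Transported along `e`, the image of the counit is composition with μ, so the universal property
  -- of P L in V is that of A(a, L).
  have hev : ∀ {X : V} (l : X ⟶ 𝓗[V] a L) (j : J), (l ≫ (e L).inv) ▷ φ.obj j ≫
      euncurry (μ j ≫ P.map L (T.obj j)) ≫ (e (T.obj j)).hom = star l (μ j) := by
    intro X l j
    have h1 : euncurry (μ j ≫ P.map L (T.obj j)) = P.obj L ◁ μ j ≫ act P _ _ := euncurry_comp _ _
    rw [h1, Category.assoc, he', whisker_exchange_assoc, ← comp_whiskerRight_assoc, Category.assoc,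
      Iso.inv_hom_id, Category.comp_id, star, MonoidalCategory.tensorHom_def, Category.assoc]
  refine isWeightedLimit_of_base (T := T.comp V P) hcounit
    fun X (f : ∀ j, X ⊗ φ.obj j ⟶ P.obj (T.obj j)) hf => ?_
  have hf' : ∀ j j', (α_ _ _ _).hom ≫ X ◁ act φ j j' ≫ f j' =
      f j ▷ 𝓗[V] j j' ≫ P.obj (T.obj j) ◁ T.map j j' ≫ act P _ _ := fun j j' =>
    (hf j j').trans (congrArg _ (euncurry_comp _ _))
  have hnat : IsRightNatural φ (homFunctor a T) (fun j => f j ≫ (e (T.obj j)).hom) := by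
    intro j j'
    have h0 : act (homFunctor a T) j j' = 𝓗[V] a (T.obj j) ◁ T.map j j' ≫ eComp V _ _ _ :=
      (euncurry_comp_representable (T.map j j')).trans (by rw [star, id_tensorHom])
    rw [h0, ← Category.assoc (X ◁ _), ← Category.assoc, hf', Category.assoc, Category.assoc, he',
      whisker_exchange_assoc, comp_whiskerRight, Category.assoc]
  obtain ⟨l, hl, hl'⟩ := (hL a).2 X _ ((isRightNatural_iff φ (homFunctor a T) _).2 hnat)
  have key : ∀ (k : X ⟶ 𝓗[V] a L) j, k ≫ limitComparison φ T μ a j =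
      ecurry ((β_ (φ.obj j) X).hom ≫ f j ≫ (e (T.obj j)).hom) ↔
        (k ≫ (e L).inv) ▷ φ.obj j ≫ euncurry (μ j ≫ P.map L (T.obj j)) = f j := by
    intro k j
    rw [comp_limitComparison, ← cancel_mono (e (T.obj j)).hom, Category.assoc, hev]
    constructor
    · intro h
      have h' := congrArg euncurry h
      rwa [euncurry_ecurry, euncurry_ecurry, cancel_epi] at h'
    · intro h
      rw [h]
  refine ⟨l ≫ (e L).inv, fun j => (key l j).1 (hl j), fun k hk => ?_⟩
  rw [← hl' (k ≫ (e L).hom) fun j => (key _ j).2 ?_, Category.assoc, Iso.hom_inv_id,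
    Category.comp_id]
  rw [Category.assoc, Iso.hom_inv_id, Category.comp_id]
  exact hk j

end LimitsInBase

/-! ### A dual basis from the preservation of one limit -/

section DualBasisOfLimit

variable {V : Type u} [Category.{v} V] [MonoidalCategory V] [MonoidalClosed V]
  [SymmetricCategory V] [HasLimits V] [HasColimits V]
variable {B : Type w} [EnrichedCategory V B] [IsSmall V B]

/-- The coprojection `B(b, c) ⊗ φ c ⟶ φ * B(b, -)`. -/
def repInj (φ : EnrichedFunctor V Bᵒᵖ V) (b c : B) :
    𝓗[V] b c ⊗ φ.obj (op c) ⟶ colimObj φ ((yonedaEmbedding B).obj (op b)) :=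
  colimInj φ ((yonedaEmbedding B).obj (op b)) c

theorem repInj_dinatural (φ : EnrichedFunctor V Bᵒᵖ V) (b c d : B) :
    𝓗[V] b c ◁ lact φ c d ≫ repInj φ b c =
      (α_ _ _ _).inv ≫ eComp V b c d ▷ φ.obj (op d) ≫ repInj φ b d := by
  rw [← act_representable]
  exact (colimInj_dinatural φ (representable V b) c d).symm

/-- The co-Yoneda map φ * B(b, -) ⟶ φ b, a retraction of `repUnit`; dinaturality of its components
is associativity of the action on φ. -/
theorem exists_repDesc (φ : EnrichedFunctor V Bᵒᵖ V) (b : B) :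
    ∃ p : colimObj φ ((yonedaEmbedding B).obj (op b)) ⟶ φ.obj (op b),
      ∀ c, repInj φ b c ≫ p = lact φ b c :=
  exists_colim_desc (F := representable V b) (fun c => lact φ b c) fun c d => by
    rw [act_representable, lact_comp, Iso.inv_hom_id_assoc]

/-- The morphism `φ b ⟶ φ * B(b, -)` given by the identity of `b`. -/
def repUnit (φ : EnrichedFunctor V Bᵒᵖ V) (b : B) :
    φ.obj (op b) ⟶ colimObj φ ((yonedaEmbedding B).obj (op b)) :=
  (λ_ _).inv ≫ eId V b ▷ _ ≫ repInj φ b b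

theorem lact_repUnit (φ : EnrichedFunctor V Bᵒᵖ V) (b c : B) :
    lact φ b c ≫ repUnit φ b = repInj φ b c := by
  have e := e_id_comp V b c
  rw [Iso.inv_comp_eq, Category.comp_id] at e
  rw [repUnit, leftUnitor_inv_naturality_assoc, whisker_exchange_assoc, repInj_dinatural,
    associator_inv_naturality_left_assoc, ← comp_whiskerRight_assoc, e]
  simp

theorem repInj_colimAct (φ : EnrichedFunctor V Bᵒᵖ V) (b c d : B) :
    𝓗[V] b c ◁ repInj φ c d ≫ (yonedaEmbedding B).map (op c) (op b) ▷ _ ≫ colimAct φ _ _ =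
      (α_ _ _ _).inv ≫ eComp V b c d ▷ φ.obj (op d) ≫ repInj φ b d := by
  rw [← yonedaEmbedding_map_ev, whisker_exchange_assoc, comp_whiskerRight, Category.assoc,
    ← associator_inv_naturality_left_assoc]
  exact congrArg _ (inj_colimAct φ ((yonedaEmbedding B).obj (op c))
    ((yonedaEmbedding B).obj (op b)) d)

theorem whiskerLeft_repUnit_colimAct (φ : EnrichedFunctor V Bᵒᵖ V) (b c : B) :
    𝓗[V] b c ◁ repUnit φ c ≫ (yonedaEmbedding B).map (op c) (op b) ▷ _ ≫ colimAct φ _ _ =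
      repInj φ b c := by
  have e := e_comp_id V b c
  rw [Iso.inv_comp_eq, Category.comp_id] at e
  rw [repUnit, MonoidalCategory.whiskerLeft_comp, MonoidalCategory.whiskerLeft_comp,
    Category.assoc, Category.assoc, repInj_colimAct, associator_inv_naturality_middle_assoc,
    ← comp_whiskerRight_assoc, e]
  simp

theorem braiding_colimAct (φ : EnrichedFunctor V Bᵒᵖ V) {F G : EnrichedFunctor V B V} {X : V}
    (f : X ⟶ 𝓗[V] F G) :
    (β_ (colimObj φ F) X).hom ≫ f ▷ _ ≫ colimAct φ F G = euncurry (f ≫ colimMap φ F G) := by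
  rw [colimAct, braiding_naturality_left_assoc, SymmetricCategory.symmetry_assoc, euncurry_comp]

/-- Both ways around send φ c ⊗ B(b, c) to the coprojection `repInj`. The unit factor is kept
because the family is to be lifted to a map out of the unit object. -/
theorem repUnit_naturality (φ : EnrichedFunctor V Bᵒᵖ V) (b c : B) :
    (α_ (𝟙_ V) (φ.obj (op c)) (𝓗[V] b c)).hom ≫ 𝟙_ V ◁ ((β_ _ (𝓗[V] b c)).hom ≫ lact φ b c) ≫
        (λ_ _).hom ≫ repUnit φ b =
      ((λ_ _).hom ≫ repUnit φ c) ▷ 𝓗[V] b c ≫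
        euncurry (A := colimObj φ ((yonedaEmbedding B).obj (op c)))
          ((yonedaEmbedding B).map (op c) (op b) ≫ colimMap φ _ _) := by
  have h : repUnit φ c ▷ 𝓗[V] b c ≫ euncurry (A := colimObj φ ((yonedaEmbedding B).obj (op c)))
      ((yonedaEmbedding B).map (op c) (op b) ≫ colimMap φ _ _) =
      (β_ _ (𝓗[V] b c)).hom ≫ repInj φ b c := by
    rw [← whiskerLeft_repUnit_colimAct, ← braiding_naturality_left_assoc]
    exact congrArg (fun t => repUnit φ c ▷ 𝓗[V] b c ≫ t)
      (braiding_colimAct φ ((yonedaEmbedding B).map (op c) (op b))).symm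
  rw [comp_whiskerRight, Category.assoc, h, leftUnitor_naturality_assoc, Category.assoc,
    lact_repUnit]
  simp

/-- The hypothesis makes φ * φ^ a limit, so the natural family `repUnit` lifts to an element η.
Applying the co-Yoneda retraction to the defining equations of η gives the dual basis identity. -/
theorem exists_isDualBasis_of_isWeightedLimit (φ : EnrichedFunctor V Bᵒᵖ V)
    (h : IsWeightedLimit φ ((yonedaEmbedding B).comp V (colimFunctor φ)) (colimObj φ (dual φ))
      (fun b => dualCounit φ b ≫ colimMap φ (dual φ) ((yonedaEmbedding B).obj b))) :
    ∃ η, IsDualBasis φ η := by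
  have hnat : ∀ b c : B, (α_ _ _ _).hom ≫ 𝟙_ V ◁ act φ (op c) (op b) ≫
      (λ_ _).hom ≫ repUnit φ b =
        ((λ_ _).hom ≫ repUnit φ c) ▷ 𝓗[V] b c ≫
          act ((yonedaEmbedding B).comp V (colimFunctor φ)) (op c) (op b) := by
    intro b c
    refine Eq.trans ?_ (repUnit_naturality φ b c)
    exact congrArg (fun t => (α_ (𝟙_ V) (φ.obj (op c)) (𝓗[V] b c)).hom ≫ 𝟙_ V ◁ t ≫
      (λ_ _).hom ≫ repUnit φ b) (SymmetricCategory.symmetry_assoc _ _ _).symm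
  obtain ⟨η, hη⟩ := h.exists_base_lift (X := 𝟙_ V)
    (f := fun b => (λ_ _).hom ≫ repUnit φ b.unop) (fun c b => hnat b.unop c.unop)
  have hη' : ∀ b, φ.obj (op b) ◁ η ≫ dualCounit φ (op b) ▷ _ ≫ colimAct φ _ _ =
      (ρ_ _).hom ≫ repUnit φ b := by
    intro b
    have h1 : η ▷ φ.obj (op b) ≫ (β_ _ _).hom ≫ dualCounit φ (op b) ▷ _ ≫ colimAct φ _ _ =
        (λ_ _).hom ≫ repUnit φ b :=
      (congrArg (fun t => η ▷ φ.obj (op b) ≫ t) (braiding_colimAct φ _)).trans (hη (op b))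
    rw [braiding_naturality_left_assoc] at h1
    rw [← cancel_epi (β_ (𝟙_ V) (φ.obj (op b))).hom, h1]
    simp
  refine ⟨η, fun b => ?_⟩
  obtain ⟨p, hp⟩ := exists_repDesc φ b
  have hp' : repUnit φ b ≫ p = 𝟙 _ := by
    rw [repUnit, Category.assoc, Category.assoc, hp, lact_id, Iso.inv_hom_id]
  -- `dualEval` factors as the limit cone φ * φ^ ⟶ φ * B(b, -), parametrised by φ b, followed by
  -- co-Yoneda, because the counit is the pairing.
  have key : dualEval φ b = dualCounit φ (op b) ▷ _ ≫ colimAct φ _ _ ≫ p := by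
    refine colim_tensorLeft_hom_ext fun c => ?_
    have h1 := inj_colimAct φ (dual φ) ((yonedaEmbedding B).obj (op b)) c
    rw [inj_dualEval, whisker_exchange_assoc, ← Category.assoc (_ ◁ colimInj _ _ _), h1, ← hp,
      ← dualCounit_ev]
    simp only [Category.assoc, comp_whiskerRight, associator_inv_naturality_left_assoc]
    rfl
  rw [key, ← Category.assoc, ← Category.assoc, Category.assoc (_ ◁ η), hη', Category.assoc, hp',
    Category.comp_id]

end DualBasisOfLimit

/-! ### Small projectives, atomic weights and flat weights -/

section Equivalence

variable {V : Type u} [Category.{v} V] [MonoidalCategory V] [SymmetricCategory V]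
  [MonoidalClosed V] [HasLimits V] [HasColimits V]
variable {B : Type (max v w)} [EnrichedCategory V B] [IsSmall V B]

theorem isSmallProjective_iff_exists_isDualBasis (φ : EnrichedFunctor V Bᵒᵖ V) :
    IsSmallProjective.{w} φ ↔ ∃ η, IsDualBasis φ η := by
  constructor
  · intro h
    -- Cocontinuity is needed for one colimit only: φ as the colimit of representables weighted by
    -- itself.
    have h1 := h ⟨B, φ⟩ (coYoneda V B) φ (fun b => yonedaHom φ b.unop)
      ((isWeightedColimit_iff _ _ _ _).2 (isUniversalUnit_yonedaHom φ))
    exact exists_isDualBasis ((isWeightedColimit_iff _ _ _ _).1 h1)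
  · rintro ⟨η, hη⟩ ψ S C ν hν
    exact (isWeightedColimit_iff _ _ _ _).2 (IsUniversalUnit.representable_map
      hη.exists_rightAdjoint ((isWeightedColimit_iff _ _ _ _).1 hν))

theorem preservesWeightedLimit_yonedaEmbedding_iff (φ : EnrichedFunctor V Bᵒᵖ V) :
    PreservesWeightedLimit (colimFunctor φ) φ (yonedaEmbedding B) ↔ ∃ η, IsDualBasis φ η :=
  ⟨fun h => exists_isDualBasis_of_isWeightedLimit φ (h _ _ (isWeightedLimit_dual φ)),
    fun ⟨_, hη⟩ => hη.preservesWeightedLimit _ _⟩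

theorem isSmallProjective_tfae (φ : EnrichedFunctor V Bᵒᵖ V) :
    [IsSmallProjective.{w} φ, IsRepresentable (colimFunctor φ),
      IsContinuous.{w} (colimFunctor φ),
      PreservesWeightedLimit (colimFunctor φ) φ (yonedaEmbedding B)].TFAE := by
  tfae_have 1 → 2 := fun h => by
    obtain ⟨η, hη⟩ := (isSmallProjective_iff_exists_isDualBasis φ).1 h
    exact hη.isRepresentable
  tfae_have 2 → 3 := fun ⟨_, ha⟩ ψ T => ha.preservesWeightedLimit ψ.functor T
  tfae_have 3 → 4 := fun h => h ⟨B, φ⟩ (yonedaEmbedding B)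
  tfae_have 4 → 1 := fun h => (isSmallProjective_iff_exists_isDualBasis φ).2
    ((preservesWeightedLimit_yonedaEmbedding_iff φ).1 h)
  tfae_finish

/-- A dual basis makes ψ-limits absolute, hence preserved by every φ * -. Conversely, taking φ to be
ψ itself and the diagram to be the Yoneda embedding gives condition (iv). -/
theorem smallProjectiveWeights_eq_atomicWeights :
    smallProjectiveWeights.{w} V = atomicWeights (allWeights.{w} V) := by
  ext ψ
  constructor
  · intro h φ _ T
    obtain ⟨η, hη⟩ := (isSmallProjective_iff_exists_isDualBasis ψ.functor).1 h
    exact hη.preservesWeightedLimit (colimFunctor φ.functor) T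
  · intro h
    exact ((isSmallProjective_tfae ψ.functor).out 3 0).1
      (h ψ (Set.mem_univ ψ) (yonedaEmbedding ψ.K))

theorem smallProjectiveWeights_eq_flatWeights :
    smallProjectiveWeights.{w} V = flatWeights (allWeights.{w} V) := by
  ext φ
  refine ((isSmallProjective_tfae φ.functor).out 0 2).trans ?_
  exact ⟨fun h ψ _ T => h ψ T, fun h ψ T => h ψ (Set.mem_univ ψ) T⟩

end Equivalence

end

end EnrichedWeights

theorem proposition6 (V : Type u) [Category.{v} V] [MonoidalCategory V] [SymmetricCategory V]
    [MonoidalClosed V] [HasLimits V] [HasColimits V] :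
    (∀ (B : Type (max v w)) [EnrichedCategory V B] [IsSmall V B]
        (φ : EnrichedFunctor V Bᵒᵖ V),
      (∃ (L : EnrichedFunctor V B V)
        (μ : ∀ b, φ.obj b ⟶ EnrichedCategory.Hom L ((yonedaEmbedding B).obj b)),
        IsWeightedLimit φ (yonedaEmbedding B) L μ) ∧
      [IsSmallProjective.{w} φ,
        IsRepresentable (colimFunctor φ),
        IsContinuous.{w} (colimFunctor φ),
        PreservesWeightedLimit (colimFunctor φ) φ (yonedaEmbedding B)].TFAE) ∧
    smallProjectiveWeights.{w} V = atomicWeights (allWeights.{w} V) ∧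
    atomicWeights (allWeights.{w} V) = flatWeights (allWeights.{w} V) := by
  refine ⟨fun B _ _ φ => ⟨⟨dual φ, dualCounit φ, isWeightedLimit_dual φ⟩,
    isSmallProjective_tfae φ⟩, smallProjectiveWeights_eq_atomicWeights, ?_⟩
  rw [← smallProjectiveWeights_eq_atomicWeights, smallProjectiveWeights_eq_flatWeights]
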